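/- Let $D=[-\pi,\pi]^2$ be the two-dimensional torus and write $m(f)=\frac1{4\pi^2}\int_D f\,dx\,dy$ for the mean of $f$ over $D$. Let $\Lambda=\{(j,k): j\in\mathbb Z,\ k\in\mathbb N,\ k\ge 1\}$ and, for $l=(j,k)\in\Lambda$, put $|l|^2=j^2+k^2$ and $\phi_{j,k}(x,y)=e^{ijx}\sqrt2\sin(ky)$; these functions are orthonormal for $\langle f,g\rangle=m(f\bar g)$. For $s\in\mathbb R$ let $\mathcal H^s$ be the space of real distributions $u=\sum_{l\in\Lambda}\hat u_l\phi_l$, $\hat u_{-j,k}=\overline{\hat u_{j,k}}$, with $\|u\|_{\mathcal H^s}^2=\sum_{l}|\hat u_l|^2|l|^{2s}<\infty$. For $N\in\mathbb N$ let $\Lambda_N=\{l\in\Lambda:|l|^2\le N\}$, let $\mathcal H_N$ be the finite-dimensional space of those $u$ with $\hat u_l=0$ for $l\notin\Lambda_N$, and let $\Pi_Nf=\sum_{l\in\Lambda_N}\langle f,\phi_l\rangle\phi_l$ be the projection onto it. Let $\alpha,\mu,T,\delta>0$, $\beta\in\mathbb R$, and let $h$ be a smooth function on $[-\pi,\pi]\times[0,\pi]$,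 extended to $D$ as an odd function of $y$; put $h^N=\Pi_Nh$ and $\nabla^\perp=(-\partial_y,\partial_x)$. Consider on $\mathbb R\times\mathcal H_N$ the truncated barotropic quasi-geostrophic equations $$\partial_t\omega^N+\Pi_N\big(\nabla^\perp\Delta^{-1}\omega^N\cdot\nabla\omega^N\big)+L_N\omega^N=0,\qquad \frac{dU^N}{dt}=m\big(h^N\,\partial_x\Delta^{-1}\omega^N\big),$$ $$L_N\omega^N=\Big(U^N-\frac\beta\mu\Big)\partial_x\omega^N+U^N\mu\,\partial_x(\mu-\Delta)^{-1}h^N+\Pi_N\big(\nabla^\perp(\mu-\Delta)^{-1}h^N\cdot\nabla\omega^N\big)+\Pi_N\big(\nabla^\perp\Delta^{-1}\omega^N\cdot\mu\nabla(\mu-\Delta)^{-1}h^N\big)+\beta\,\partial_x\Delta^{-1}\omega^N,$$ and the Gaussian probability measure $$d\eta^N_{\alpha,\mu}(U,\omega)=\frac1{Z^N_{\alpha,\mu}}\exp\Big(-\alpha\Big[\frac\mu2U^2+\frac12m\big((\omega-\mu\Delta^{-1}\omega)\,\omega\big)\Big]\Big)\,dU\,d\omega\quad\text{on }\mathbb R\times\mathcal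 H_N .$$ For every $N$ and $\eta^N_{\alpha,\mu}$-almost every initial datum the truncated equations have a unique solution on $[0,\infty)$, and the resulting flow preserves $\eta^N_{\alpha,\mu}$. Let $\Theta^N_{\alpha,\mu}$ be the law on $C([0,T],\mathbb R\times\mathcal H^{-1-\delta})$ of the resulting stationary process $(U^N_t,\omega^N_t)_{t\in[0,T]}$ with initial law $\eta^N_{\alpha,\mu}$. Then the family of probability measures $(\Theta^N_{\alpha,\mu})_{N\in\mathbb N}$ is tight on $C([0,T],\mathbb R\times\mathcal H^{-1-\delta})$. -/

import Mathlib

open MeasureTheory Set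
open scoped ComplexConjugate

noncomputable section

namespace BQG

/-! ### Fourier modes -/

/-- The set `Λ` of modes `(j, k)`, `j ∈ ℤ`, `k ∈ {1, 2, …}`; the mode `(j, k)` stands for
the function `e_j(x) s_k(y)` on the torus `D = [-π, π]²`. -/
abbrev Mode : Type := ℤ × ℕ+

/-- `|l|² = j² + k²` for `l = (j, k)`. -/
def Mode.normSq (l : Mode) : ℝ := (l.1 : ℝ) ^ 2 + (l.2 : ℝ) ^ 2

/-- The mode `(-j, k)`, on which a real function has the complex conjugate coefficient. -/
def Mode.flip (l : Mode) : Mode := (-l.1, l.2)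

theorem Mode.normSq_flip (l : Mode) : l.flip.normSq = l.normSq := by
  simp [Mode.normSq, Mode.flip]

theorem Mode.normSq_pos (l : Mode) : 0 < l.normSq := by
  have : (0 : ℝ) < (l.2 : ℝ) := by exact_mod_cast l.2.pos
  unfold Mode.normSq
  positivity

/-- `e_j(x) = e^{ijx}`, `s_k(y) = √2 sin(ky)`: with this choice the products `e_j s_k` are
orthonormal for the inner product given by the mean over `D`. -/
def basisFun (l : Mode) (x y : ℝ) : ℂ :=
  Complex.exp (Complex.I * l.1 * x) * ((Real.sqrt 2 * Real.sin (l.2 * y) : ℝ) : ℂ)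

/-- The mean `⨍_D f` over the torus `D = [-π, π]²`. -/
def torusMean {E : Type*} [NormedAddCommGroup E] [NormedSpace ℝ E] (f : ℝ → ℝ → E) : E :=
  (4 * Real.pi ^ 2)⁻¹ • ∫ x in (-Real.pi)..Real.pi, ∫ y in (-Real.pi)..Real.pi, f x y

/-- The Fourier coefficient `⨍_D f e_{-j} s_k` of a real function `f` on `D`. -/
def fourierCoeff (f : ℝ → ℝ → ℝ) (l : Mode) : ℂ :=
  torusMean fun x y => (f x y : ℂ) * basisFun l.flip x y

theorem fourierCoeff_flip (f : ℝ → ℝ → ℝ) (l : Mode) :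
    fourierCoeff f l.flip = conj (fourierCoeff f l) := by
  have h : ∀ x y : ℝ, (f x y : ℂ) * basisFun l.flip.flip x y
      = conj ((f x y : ℂ) * basisFun l.flip x y) := by
    intro x y
    simp only [basisFun, Mode.flip, map_mul, Complex.conj_ofReal, ← Complex.exp_conj]
    simp
  unfold fourierCoeff torusMean
  simp_rw [h, intervalIntegral.intervalIntegral_conj, Complex.real_smul]
  rw [map_mul, Complex.conj_ofReal]

/-! ### Sobolev spaces of distributions odd in `y` -/

/-- Families `û` of Fourier coefficients of real distributions, odd in `y`, with
`∑ |û_{j,k}|² (j² + k²)^s < ∞`. -/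
def sobolevSubmodule (s : ℝ) : Submodule ℝ (Mode → ℂ) where
  carrier := {u | (∀ l, u l.flip = conj (u l)) ∧
    Summable fun l => ‖u l‖ ^ 2 * l.normSq ^ s}
  zero_mem' := by simp [summable_zero]
  add_mem' := by
    rintro u v ⟨hu, hu'⟩ ⟨hv, hv'⟩
    refine ⟨fun l => by simp [hu, hv], ?_⟩
    refine Summable.of_nonneg_of_le (fun l => ?_) (fun l => ?_)
      ((hu'.add hv').mul_left 2)
    · exact mul_nonneg (sq_nonneg _) (Real.rpow_nonneg l.normSq_pos.le _)
    · have h0 : 0 ≤ l.normSq ^ s := Real.rpow_nonneg l.normSq_pos.le _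
      have h1 : ‖u l + v l‖ ^ 2 ≤ 2 * (‖u l‖ ^ 2 + ‖v l‖ ^ 2) := by
        have := norm_add_le (u l) (v l)
        nlinarith [norm_nonneg (u l + v l), sq_nonneg (‖u l‖ - ‖v l‖)]
      calc ‖u l + v l‖ ^ 2 * l.normSq ^ s
          ≤ 2 * (‖u l‖ ^ 2 + ‖v l‖ ^ 2) * l.normSq ^ s := by gcongr
        _ = _ := by ring
  smul_mem' := by
    rintro c u ⟨hu, hu'⟩
    refine ⟨fun l => by simp [hu], ?_⟩
    refine (hu'.mul_left (c ^ 2)).congr fun l => ?_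
    simp [mul_pow, mul_assoc]

/-- The Sobolev space `ℋ^s` of real distributions on `D`, odd in `y`. -/
def Sobolev (s : ℝ) : Type := sobolevSubmodule s

namespace Sobolev

variable {s : ℝ}

instance : AddCommGroup (Sobolev s) := inferInstanceAs (AddCommGroup (sobolevSubmodule s))

instance : Module ℝ (Sobolev s) := inferInstanceAs (Module ℝ (sobolevSubmodule s))

/-- The Fourier coefficient `û_l`. -/
def coeff (u : Sobolev s) (l : Mode) : ℂ := u.1 l

/-- The map `û ↦ ((j² + k²)^{s/2} û_{j,k})` into `ℓ²`, from which the norm is induced. -/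
def toL2 (s : ℝ) : Sobolev s →ₗ[ℝ] lp (fun _ : Mode => ℂ) 2 where
  toFun u := ⟨fun l => ((l.normSq ^ (s / 2) : ℝ) : ℂ) * u.coeff l, by
    refine memℓp_gen ?_
    refine u.2.2.congr fun l => ?_
    have h0 := l.normSq_pos
    have h1 : (l.normSq ^ (s / 2)) ^ 2 = l.normSq ^ s := by
      rw [← Real.rpow_natCast, ← Real.rpow_mul h0.le]
      norm_num
    have h2 : ‖((l.normSq ^ (s / 2) : ℝ) : ℂ) * u.coeff l‖
        = l.normSq ^ (s / 2) * ‖u.1 l‖ := by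
      rw [norm_mul, Complex.norm_real, Real.norm_of_nonneg (Real.rpow_nonneg h0.le _), coeff]
    rw [h2, ENNReal.toReal_ofNat, Real.rpow_two, mul_pow, h1, mul_comm]⟩
  map_add' u v := by
    ext l
    exact mul_add _ (u.coeff l) (v.coeff l)
  map_smul' c u := by
    ext l
    exact mul_smul_comm c _ (u.coeff l)

theorem toL2_injective (s : ℝ) : Function.Injective (toL2 s) := by
  intro u v h
  refine Subtype.ext (funext fun l => ?_)
  have h1 : ((l.normSq ^ (s / 2) : ℝ) : ℂ) * u.coeff l
      = ((l.normSq ^ (s / 2) : ℝ) : ℂ) * v.coeff l := congrArg (fun w => w.1 l) h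
  have h2 : ((l.normSq ^ (s / 2) : ℝ) : ℂ) ≠ 0 :=
    Complex.ofReal_ne_zero.2 (Real.rpow_pos_of_pos l.normSq_pos _).ne'
  exact mul_left_cancel₀ h2 h1

instance : NormedAddCommGroup (Sobolev s) :=
  NormedAddCommGroup.induced (Sobolev s) (lp (fun _ : Mode => ℂ) 2) (toL2 s) (toL2_injective s)

instance : NormedSpace ℝ (Sobolev s) :=
  NormedSpace.induced ℝ (Sobolev s) (lp (fun _ : Mode => ℂ) 2) (toL2 s)

/-- `‖u‖² = ∑ |û_{j,k}|² (j² + k²)^s`. -/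
theorem norm_sq_eq (u : Sobolev s) :
    ‖u‖ ^ 2 = ∑' l : Mode, ‖u.coeff l‖ ^ 2 * l.normSq ^ s := by
  have h : ‖u‖ = ‖toL2 s u‖ := rfl
  have h2 := lp.norm_rpow_eq_tsum (p := 2) (by norm_num) (toL2 s u)
  rw [ENNReal.toReal_ofNat, Real.rpow_two] at h2
  rw [h, h2]
  refine tsum_congr fun l => ?_
  have h0 := l.normSq_pos
  have h1 : (l.normSq ^ (s / 2)) ^ 2 = l.normSq ^ s := by
    rw [← Real.rpow_natCast, ← Real.rpow_mul h0.le]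
    norm_num
  have h3 : ‖(toL2 s u).1 l‖ = l.normSq ^ (s / 2) * ‖u.coeff l‖ := by
    change ‖((l.normSq ^ (s / 2) : ℝ) : ℂ) * u.coeff l‖ = _
    rw [norm_mul, Complex.norm_real, Real.norm_of_nonneg (Real.rpow_nonneg h0.le _)]
  rw [h3, Real.rpow_two, mul_pow, h1, mul_comm]

end Sobolev

/-! ### The finite-dimensional spaces `ℋ_N` -/

/-- `Λ_N = {(j, k) ∈ Λ : j² + k² ≤ N}`. -/
abbrev ModeN (N : ℕ) : Type := {l : Mode // l.1 ^ 2 + (l.2 : ℤ) ^ 2 ≤ N}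

instance (N : ℕ) : Finite (ModeN N) := by
  refine Finite.of_injective
    (fun l : ModeN N => ((⟨l.1.1, ?_⟩, ⟨(l.1.2 : ℤ), ?_⟩) :
      Icc (-(N : ℤ)) N × Icc (-(N : ℤ)) N)) ?_
  · have := l.2
    constructor <;> nlinarith [sq_nonneg (l.1.2 : ℤ)]
  · have := l.2
    constructor <;> nlinarith [sq_nonneg l.1.1]
  · intro a b h
    have h1 : a.1.1 = b.1.1 := congrArg (fun p => (p.1 : ℤ)) h
    have h2 : (a.1.2 : ℤ) = (b.1.2 : ℤ) := congrArg (fun p => (p.2 : ℤ)) h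
    exact Subtype.ext (Prod.ext h1 (PNat.coe_injective (by exact_mod_cast h2)))

instance (N : ℕ) : Fintype (ModeN N) := Fintype.ofFinite _

/-- The mode `(-j, k)` in `Λ_N`. -/
def ModeN.flip {N : ℕ} (l : ModeN N) : ModeN N :=
  ⟨l.1.flip, by simpa [Mode.flip] using l.2⟩

/-- `ℋ_N`: Fourier coefficients `ξ ∈ ℂ^{Λ_N}` with `ξ_{-j,k} = conj ξ_{j,k}`. -/
def HN (N : ℕ) : Submodule ℝ (ModeN N → ℂ) where
  carrier := {ξ | ∀ l, ξ l.flip = conj (ξ l)}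
  zero_mem' := by simp
  add_mem' := by
    intro u v hu hv l
    simp [hu l, hv l]
  smul_mem' := by
    intro c u hu l
    simp [hu l]

namespace HN

variable {N : ℕ}

/-- The real function `∑ ξ_{j,k} e_j(x) s_k(y)` (the sum is real; `re` only changes the type). -/
def toFun (ξ : HN N) (x y : ℝ) : ℝ := (∑ l : ModeN N, ξ.1 l * basisFun l.1 x y).re

/-- The projection `Π_N f` of a real function on `D`. -/
def proj (N : ℕ) (f : ℝ → ℝ → ℝ) : HN N :=
  ⟨fun l => fourierCoeff f l.1, fun l => fourierCoeff_flip f l.1⟩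

/-- `∂_x` on `ℋ_N`. -/
def dx (ξ : HN N) : HN N :=
  ⟨fun l => Complex.I * l.1.1 * ξ.1 l, fun l => by
    beta_reduce
    rw [ξ.2 l]
    simp [ModeN.flip, Mode.flip]⟩

/-- `Δ⁻¹` on `ℋ_N`. -/
def invLaplacian (ξ : HN N) : HN N :=
  ⟨fun l => -(((l.1.normSq)⁻¹ : ℝ) : ℂ) * ξ.1 l, fun l => by
    beta_reduce
    rw [ξ.2 l]
    simp [ModeN.flip, Mode.normSq_flip]⟩

/-- `(μ - Δ)⁻¹` on `ℋ_N`. -/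
def resolvent (μ : ℝ) (ξ : HN N) : HN N :=
  ⟨fun l => (((μ + l.1.normSq)⁻¹ : ℝ) : ℂ) * ξ.1 l, fun l => by
    beta_reduce
    rw [ξ.2 l]
    simp [ModeN.flip, Mode.normSq_flip]⟩

open Classical in
/-- The inclusion `ℋ_N ⊆ ℋ^s`: the coefficients outside `Λ_N` are zero. -/
def toSobolev (s : ℝ) (ξ : HN N) : Sobolev s :=
  ⟨fun l => if h : l.1 ^ 2 + (l.2 : ℤ) ^ 2 ≤ N then ξ.1 ⟨l, h⟩ else 0, by
    constructor
    · intro l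
      by_cases h : l.1 ^ 2 + (l.2 : ℤ) ^ 2 ≤ N
      · have h' : l.flip.1 ^ 2 + (l.flip.2 : ℤ) ^ 2 ≤ N := by simpa [Mode.flip] using h
        beta_reduce
        rw [dif_pos h, dif_pos h']
        exact ξ.2 ⟨l, h⟩
      · have h' : ¬ l.flip.1 ^ 2 + (l.flip.2 : ℤ) ^ 2 ≤ N := by simpa [Mode.flip] using h
        beta_reduce
        rw [dif_neg h, dif_neg h', map_zero]
    · have hf : {l : Mode | l.1 ^ 2 + (l.2 : ℤ) ^ 2 ≤ N}.Finite :=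
        inferInstanceAs (Finite (ModeN N))
      refine summable_of_hasFiniteSupport (hf.subset fun l hl => ?_)
      by_contra h
      exact hl (by simp [dif_neg (show ¬ l.1 ^ 2 + (l.2 : ℤ) ^ 2 ≤ N from h)])⟩

theorem continuous_toSobolev (s : ℝ) : Continuous (toSobolev s : HN N → Sobolev s) := by
  have hlin : IsLinearMap ℝ (toSobolev s : HN N → Sobolev s) := by
    constructor
    · intro u v
      refine Subtype.ext (funext fun l => ?_)
      change (if h : _ then (u + v).1 ⟨l, h⟩ else 0) =
        (if h : _ then u.1 ⟨l, h⟩ else 0) + (if h : _ then v.1 ⟨l, h⟩ else 0)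
      split_ifs
      · rfl
      · simp
    · intro c u
      refine Subtype.ext (funext fun l => ?_)
      change (if h : _ then (c • u).1 ⟨l, h⟩ else 0) =
        c • (if h : _ then u.1 ⟨l, h⟩ else 0)
      split_ifs
      · rfl
      · simp
  exact (hlin.mk' _).continuous_of_finiteDimensional

end HN

/-! ### The truncated equations -/

/-- `∇^⊥ f · ∇ g` with `∇^⊥ = (-∂_y, ∂_x)`. -/
def advection (f g : ℝ → ℝ → ℝ) (x y : ℝ) : ℝ :=
  -(deriv (fun y' => f x y') y) * deriv (fun x' => g x' y) x
    + deriv (fun x' => f x' y) x * deriv (fun y' => g x y') y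

/-- The extension of a function on the channel `[-π, π] × [0, π]` to `D`, odd in `y`. -/
def oddExtension (h : ℝ → ℝ → ℝ) (x y : ℝ) : ℝ := if 0 ≤ y then h x y else -h x (-y)

/-- The topography `h^N = Π_N h`. -/
def topographyN (h : ℝ → ℝ → ℝ) (N : ℕ) : HN N := HN.proj N (oddExtension h)

/-- The affine terms
`L_N ω = (U - β/μ) ∂_x ω + U μ ∂_x (μ-Δ)⁻¹ h^N + Π_N (∇^⊥ (μ-Δ)⁻¹ h^N · ∇ω)
  + Π_N (∇^⊥ Δ⁻¹ ω · μ ∇ (μ-Δ)⁻¹ h^N) + β ∂_x Δ⁻¹ ω`. -/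
def affineTerm (μ β : ℝ) (h : ℝ → ℝ → ℝ) {N : ℕ} (U : ℝ) (ω : HN N) : HN N :=
  (U - β / μ) • HN.dx ω
    + (U * μ) • HN.dx (HN.resolvent μ (topographyN h N))
    + HN.proj N (advection (HN.toFun (HN.resolvent μ (topographyN h N))) (HN.toFun ω))
    + HN.proj N (advection (HN.toFun (HN.invLaplacian ω))
        (HN.toFun (μ • HN.resolvent μ (topographyN h N))))
    + β • HN.dx (HN.invLaplacian ω)

/-- The vector field `B^N` on `ℝ × ℋ_N`:
`dU/dt = ⨍_D h^N ∂_x Δ⁻¹ ω`, `∂_t ω = - Π_N (∇^⊥ Δ⁻¹ ω · ∇ω) - L_N ω`. -/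
def galerkinField (μ β : ℝ) (h : ℝ → ℝ → ℝ) (N : ℕ) (u : ℝ × HN N) : ℝ × HN N :=
  (torusMean fun x y =>
      HN.toFun (topographyN h N) x y * HN.toFun (HN.dx (HN.invLaplacian u.2)) x y,
    -HN.proj N (advection (HN.toFun (HN.invLaplacian u.2)) (HN.toFun u.2))
      - affineTerm μ β h u.1 u.2)

/-- `v` solves the truncated equations on `[0, ∞)` with initial datum `u₀`. -/
def IsGalerkinSolution (μ β : ℝ) (h : ℝ → ℝ → ℝ) (N : ℕ) (u₀ : ℝ × HN N)
    (v : ℝ → ℝ × HN N) : Prop :=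
  v 0 = u₀ ∧ ∀ t, 0 ≤ t → HasDerivWithinAt v (galerkinField μ β h N (v t)) (Ici 0) t

open Classical in
/-- The solution `t ↦ (U^N_t, ω^N_t)` with initial datum `u₀` (constant if there is none). -/
def galerkinFlow (μ β : ℝ) (h : ℝ → ℝ → ℝ) (N : ℕ) (u₀ : ℝ × HN N) : ℝ → ℝ × HN N :=
  if H : ∃ v, IsGalerkinSolution μ β h N u₀ v then H.choose else fun _ => u₀

theorem continuousOn_galerkinFlow (μ β : ℝ) (h : ℝ → ℝ → ℝ) (N : ℕ) (u₀ : ℝ × HN N) :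
    ContinuousOn (galerkinFlow μ β h N u₀) (Ici 0) := by
  unfold galerkinFlow
  split_ifs with H
  · intro t ht
    exact (H.choose_spec.2 t ht).continuousWithinAt
  · exact continuousOn_const

/-! ### Gibbs measures and laws on path space -/

/-- The pseudoenergy `μ/2 U² + 1/2 ⨍_D (ω - μ Δ⁻¹ ω) ω`, in Fourier coefficients. -/
def pseudoenergy (μ : ℝ) {N : ℕ} (u : ℝ × HN N) : ℝ :=
  μ / 2 * u.1 ^ 2 + 1 / 2 * ∑ l : ModeN N, (1 + μ / l.1.normSq) * ‖u.2.1 l‖ ^ 2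

/-- `dη^N = Z⁻¹ exp(-α S_μ(U, ω)) dU dω` on `ℝ × ℋ_N`; the normalisation of the Lebesgue measure
`dU dω` is irrelevant, since it is absorbed in `Z`. -/
def gibbsMeasure (α μ : ℝ) (N : ℕ) : Measure (ℝ × HN N) :=
  (Measure.addHaar : Measure (ℝ × HN N)).tilted fun u => -α * pseudoenergy μ u

/-- The space `C([0,T], ℝ × ℋ^s)`, with the topology of uniform convergence. -/
abbrev PathSpace (T s : ℝ) : Type := C(Icc (0 : ℝ) T, ℝ × Sobolev s)

instance (T s : ℝ) : MeasurableSpace (PathSpace T s) := borel _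

instance (T s : ℝ) : BorelSpace (PathSpace T s) := ⟨rfl⟩

/-- The trajectory on `[0, T]` started at `u₀`, as a path in `ℝ × ℋ^s`. -/
def galerkinPath (μ β : ℝ) (h : ℝ → ℝ → ℝ) (T s : ℝ) (N : ℕ) (u₀ : ℝ × HN N) :
    PathSpace T s where
  toFun t := ((galerkinFlow μ β h N u₀ t).1, HN.toSobolev s (galerkinFlow μ β h N u₀ t).2)
  continuous_toFun := by
    have hc : Continuous fun t : Icc (0 : ℝ) T => galerkinFlow μ β h N u₀ t :=
      (continuousOn_galerkinFlow μ β h N u₀).comp_continuous continuous_subtype_val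
        fun t => t.2.1
    exact hc.fst.prodMk ((HN.continuous_toSobolev s).comp hc.snd)

/-- The law `Θ^N` on `C([0,T], ℝ × ℋ^s)` of the Galerkin process with initial law `η^N`. -/
def galerkinLaw (α μ β : ℝ) (h : ℝ → ℝ → ℝ) (T s : ℝ) (N : ℕ) : Measure (PathSpace T s) :=
  (gibbsMeasure α μ N).map (galerkinPath μ β h T s N)

end BQG

end

/-! Tightness follows from bounds, uniform in `N`, on each Fourier mode separately. Three
ingredients carry it.

Invariance. In real coordinates the truncated system is a polynomial ODE. Its field is tangent to
the level sets of the pseudoenergy (`coordField_energy`), and its `i`-th component does not involve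
the `i`-th variable (`coordField_update`); both rest on the total antisymmetry of `⨍ J(f, g) k`.
Energy conservation confines trajectories to compact sets, so solutions are global. The second
property says that each coordinate direction acts as a shear, which preserves Lebesgue measure; the
flow is a limit of compositions of shears, so it preserves Lebesgue measure and, with the energy,
the Gaussian measure (`measurePreserving_flow`).

Moments of the field. Under the Gaussian measure the `l`-th component of the field has second moment
at most `C |l|⁶`, with `C` independent of `N` (`exists_sqBound_coordField`). The delicate term is
`J(Δ⁻¹ω, ω)`. Symmetrising in the two input modes `p`, `q` gives the coefficient `(|p|⁻² - |q|⁻²) ⨍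
J(φ_p, φ_q) φ_l / 2`, which vanishes for `p = q`, so the second moment is controlled by the sum of
the squared coefficients. The factor `|q|² - |p|²` is a commutator with the Laplacian: it can be
traded for derivatives of the fixed mode `l`. Bessel's inequality in one input mode and convergence
of `∑ |p|⁻⁴` in two dimensions then bound the sum (`sum_interaction_sq_le`).

Paths. For a coordinate `y` with `y' = f`, the quantity `y(0)^(2k+2) + ∫₀ᵀ (k+1)(y^(4k+2) + f²)`
dominates both `sup y^(2k+2)` and the square of the `1/2`-Hölder constant (`sup_and_hoelder_bound`).
By stationarity its mean is at most `C |l|⁶`. Markov's inequality at level `R |l|¹⁰` and a union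
bound cost `∑ |l|⁻⁴ / R`, so outside an event of small probability all modes satisfy `|û_l(t)| ≤ (R
|l|¹⁰)^(1/(2k+2))` and are Hölder continuous with constant `(R |l|¹⁰)^(1/2)`. For `k` large compared
with `1/δ` the first bound is square summable against the weight of `ℋ^(-1-δ)`. The Hölder constants
may grow freely, because dominated convergence still yields a common modulus of continuity. Such
paths form a compact set by Arzelà–Ascoli (`isCompact_hoelderBox_paths`). -/

noncomputable section

namespace BQG

/-! ### Conservative divergence-free ordinary differential equations -/

section Conservative

open Filter Topology Function
open scoped NNReal ENNReal

variable {ι : Type*} [Fintype ι]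

/-- `v` solves `dv/dt = F v` on `[0, ∞)` with `v 0 = x₀`. -/
def IsTrajectory {E : Type*} [NormedAddCommGroup E] [NormedSpace ℝ E] (F : E → E) (x₀ : E)
    (v : ℝ → E) : Prop :=
  v 0 = x₀ ∧ ∀ t, 0 ≤ t → HasDerivWithinAt v (F (v t)) (Ici 0) t

/-- The diagonal quadratic form `∑ wᵢ xᵢ²`. -/
def quadEnergy (w x : ι → ℝ) : ℝ := ∑ i, w i * x i ^ 2

/-- A `C¹` vector field which is tangent to the level sets of `quadEnergy w` and whose `i`-th
component does not depend on the `i`-th coordinate. -/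
structure IsConservativeField [DecidableEq ι] (w : ι → ℝ) (F : (ι → ℝ) → ι → ℝ) : Prop where
  contDiff : ContDiff ℝ 1 F
  weight_pos : ∀ i, 0 < w i
  energy : ∀ x, ∑ i, w i * x i * F x i = 0
  update : ∀ x i t, F (update x i t) i = F x i

theorem exists_norm_le_of_quadEnergy_le {w : ι → ℝ} (hw : ∀ i, 0 < w i) (R : ℝ) :
    ∃ ρ : ℝ, 0 < ρ ∧ ∀ x, quadEnergy w x ≤ R → ‖x‖ ≤ ρ := by
  -- The summand `1` avoids a square root: `x² ≤ a` implies `|x| ≤ 1 + a`.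
  refine ⟨1 + ∑ i, |R| / w i, ?_, fun x hx => ?_⟩
  · have : 0 ≤ ∑ i, |R| / w i := Finset.sum_nonneg fun i _ => by have := hw i; positivity
    linarith
  · have h0 : ∀ i, 0 ≤ |R| / w i := fun i => by have := hw i; positivity
    refine (pi_norm_le_iff_of_nonneg ?_).2 fun i => ?_
    · have : 0 ≤ ∑ i, |R| / w i := Finset.sum_nonneg fun i _ => h0 i
      linarith
    · have h1 : w i * x i ^ 2 ≤ |R| := by
        refine le_trans ?_ (hx.trans (le_abs_self R))
        exact Finset.single_le_sum (f := fun i => w i * x i ^ 2)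
          (fun i _ => mul_nonneg (hw i).le (sq_nonneg _)) (Finset.mem_univ i)
      have h2 : x i ^ 2 ≤ |R| / w i := by rw [le_div_iff₀ (hw i)]; linarith
      have h3 : |R| / w i ≤ ∑ i, |R| / w i :=
        Finset.single_le_sum (fun i _ => h0 i) (Finset.mem_univ i)
      rw [Real.norm_eq_abs]
      have := sq_abs (x i)
      nlinarith [sq_nonneg (|x i| - 1), abs_nonneg (x i)]

theorem continuous_quadEnergy (w : ι → ℝ) : Continuous (quadEnergy w) := by
  unfold quadEnergy; fun_prop

/-- The velocity `g` is left arbitrary so that the statement applies both to the field and to its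
cut-off version. -/
theorem quadEnergy_eq_of_hasDerivWithinAt {w : ι → ℝ} {v g : ℝ → ι → ℝ} {T : ℝ}
    (hv : ContinuousOn v (Icc 0 T))
    (hd : ∀ t ∈ Ico 0 T, HasDerivWithinAt v (g t) (Ici t) t)
    (hg : ∀ t ∈ Ico 0 T, ∑ i, w i * v t i * g t i = 0) {t : ℝ} (ht : t ∈ Icc 0 T) :
    quadEnergy w (v t) = quadEnergy w (v 0) := by
  refine constant_of_has_deriv_right_zero (f := fun t => quadEnergy w (v t))
    ((continuous_quadEnergy w).comp_continuousOn hv) (fun s hs => ?_) t ht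
  have h1 : ∀ i, HasDerivWithinAt (fun r => w i * v r i ^ 2)
      (w i * (2 * v s i * g s i)) (Ici s) s := fun i => by
    have := ((hasDerivWithinAt_pi.1 (hd s hs) i).pow 2).const_mul (w i)
    simpa using this
  have h2 := HasDerivWithinAt.fun_sum (u := Finset.univ) fun i _ => h1 i
  have h3 : ∑ i, w i * (2 * v s i * g s i) = 0 := by
    rw [← mul_zero (2 : ℝ), ← hg s hs, Finset.mul_sum]
    exact Finset.sum_congr rfl fun i _ => by ring
  rw [h3] at h2
  exact h2

theorem IsTrajectory.continuousOn {E : Type*} [NormedAddCommGroup E] [NormedSpace ℝ E]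
    {F : E → E} {x : E} {v : ℝ → E} (h : IsTrajectory F x v) : ContinuousOn v (Ici 0) :=
  fun t ht => (h.2 t ht).continuousWithinAt

theorem IsTrajectory.hasDerivWithinAt_Ici {E : Type*} [NormedAddCommGroup E] [NormedSpace ℝ E]
    {F : E → E} {x : E} {v : ℝ → E} (h : IsTrajectory F x v) {t : ℝ} (ht : 0 ≤ t) :
    HasDerivWithinAt v (F (v t)) (Ici t) t :=
  (h.2 t ht).mono (Ici_subset_Ici.2 ht)

theorem IsTrajectory.shift {E : Type*} [NormedAddCommGroup E] [NormedSpace ℝ E]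
    {F : E → E} {x : E} {v : ℝ → E} (h : IsTrajectory F x v) {s : ℝ} (hs : 0 ≤ s) :
    IsTrajectory F (v s) (fun t => v (s + t)) := by
  refine ⟨by simp, fun t ht => ?_⟩
  have h1 := (h.2 (s + t) (by positivity)).scomp_of_eq (h := fun t => s + t) (h' := 1) t
    ((hasDerivWithinAt_id t (Ici 0)).const_add s) (fun r hr => by
      simp only [mem_Ici] at hr ⊢; positivity) rfl
  rw [one_smul] at h1
  exact h1

theorem exists_lipschitzOnWith_closedBall {F : (ι → ℝ) → ι → ℝ} (hF : ContDiff ℝ 1 F) (ρ : ℝ) :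
    ∃ K : ℝ≥0, LipschitzOnWith K F (Metric.closedBall 0 ρ) := by
  obtain ⟨K, hK⟩ := (isCompact_closedBall (0 : ι → ℝ) ρ).exists_bound_of_continuousOn
    (hF.continuous_fderiv one_ne_zero).continuousOn
  refine ⟨K.toNNReal, (convex_closedBall (0 : ι → ℝ) ρ).lipschitzOnWith_of_nnnorm_fderiv_le
    (fun x _ => (hF.differentiable one_ne_zero) x) fun x hx => ?_⟩
  rw [← NNReal.coe_le_coe, coe_nnnorm]
  exact (hK x hx).trans (Real.le_coe_toNNReal K)

namespace IsConservativeField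

variable [DecidableEq ι] {w : ι → ℝ} {F : (ι → ℝ) → ι → ℝ}

theorem quadEnergy_trajectory (hF : IsConservativeField w F) {x : ι → ℝ} {v : ℝ → ι → ℝ}
    (hv : IsTrajectory F x v) {t : ℝ} (ht : 0 ≤ t) :
    quadEnergy w (v t) = quadEnergy w x := by
  rw [← hv.1]
  exact quadEnergy_eq_of_hasDerivWithinAt (T := t) (g := fun s => F (v s))
    (hv.continuousOn.mono Icc_subset_Ici_self)
    (fun s hs => hv.hasDerivWithinAt_Ici hs.1) (fun s _ => hF.energy _) ⟨ht, le_rfl⟩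

/-- Trajectories of bounded energy depend Lipschitz continuously on the initial datum. -/
theorem exists_dist_le (hF : IsConservativeField w F) (R : ℝ) :
    ∃ K : ℝ≥0, ∀ x y v u, quadEnergy w x ≤ R → quadEnergy w y ≤ R → IsTrajectory F x v →
      IsTrajectory F y u → ∀ t, 0 ≤ t → dist (v t) (u t) ≤ dist x y * Real.exp (K * t) := by
  obtain ⟨ρ, -, hρ⟩ := exists_norm_le_of_quadEnergy_le hF.weight_pos R
  obtain ⟨K, hK⟩ := exists_lipschitzOnWith_closedBall hF.contDiff ρ
  refine ⟨K, fun x y v u hx hy hv hu t ht => ?_⟩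
  have key : ∀ x v, quadEnergy w x ≤ R → IsTrajectory F x v → ∀ s, 0 ≤ s →
      v s ∈ Metric.closedBall (0 : ι → ℝ) ρ := fun x v hx hv s hs => by
    rw [mem_closedBall_zero_iff]
    exact hρ _ ((hF.quadEnergy_trajectory hv hs).le.trans hx)
  have := dist_le_of_trajectories_ODE_of_mem (v := fun _ => F) (a := 0) (b := t)
    (s := fun _ => Metric.closedBall 0 ρ) (fun _ _ => hK)
    (hv.continuousOn.mono Icc_subset_Ici_self) (fun s hs => hv.hasDerivWithinAt_Ici hs.1)
    (fun s hs => key x v hx hv s hs.1)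
    (hu.continuousOn.mono Icc_subset_Ici_self) (fun s hs => hu.hasDerivWithinAt_Ici hs.1)
    (fun s hs => key y u hy hu s hs.1) (by rw [hv.1, hu.1]) t ⟨ht, le_rfl⟩
  simpa using this

theorem trajectory_unique (hF : IsConservativeField w F) {x : ι → ℝ} {v u : ℝ → ι → ℝ}
    (hv : IsTrajectory F x v) (hu : IsTrajectory F x u) : EqOn v u (Ici 0) := by
  obtain ⟨K, hK⟩ := hF.exists_dist_le (quadEnergy w x)
  intro t ht
  have := hK x x v u le_rfl le_rfl hv hu t ht
  rw [dist_self, zero_mul] at this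
  exact dist_le_zero.1 this

/-- Multiplying the field by a bump function makes it bounded and globally Lipschitz, so
Picard–Lindelöf works on any interval. The cut-off field is still tangent to the energy levels,
hence its solution never leaves the ball on which the bump equals `1`, and it solves the original
equation. -/
theorem exists_solution_Icc (hF : IsConservativeField w F) (x : ι → ℝ) {T : ℝ} (hT : 0 < T) :
    ∃ v : ℝ → ι → ℝ, v 0 = x ∧
      ∀ t ∈ Icc 0 T, HasDerivWithinAt v (F (v t)) (Icc 0 T) t := by
  obtain ⟨ρ, hρ0, hρ⟩ := exists_norm_le_of_quadEnergy_le hF.weight_pos (quadEnergy w x)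
  let χ : ContDiffBump (0 : ι → ℝ) := ⟨ρ, ρ + 1, hρ0, by linarith⟩
  let G : (ι → ℝ) → ι → ℝ := fun y => χ y • F y
  have hG : ContDiff ℝ 1 G := χ.contDiff.smul hF.contDiff
  have hGc : HasCompactSupport G := χ.hasCompactSupport.smul_right
  obtain ⟨K, hK⟩ := hG.lipschitzWith_of_hasCompactSupport hGc one_ne_zero
  obtain ⟨C, hC⟩ := hG.continuous.bounded_above_of_compact_support hGc
  have hpl : IsPicardLindelof (fun _ => G) (tmin := 0) (tmax := T) ⟨0, le_rfl, hT.le⟩ x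
      (C.toNNReal * T.toNNReal) 0 C.toNNReal K :=
    .of_time_independent (fun y _ => (hC y).trans (Real.le_coe_toNNReal C))
      hK.lipschitzOnWith (by simp [hT.le])
  obtain ⟨v, hv0, hv⟩ := hpl.exists_eq_forall_mem_Icc_hasDerivWithinAt₀
  have hv0' : v 0 = x := hv0
  have hE : ∀ t ∈ Icc 0 T, quadEnergy w (v t) = quadEnergy w x := fun t ht => by
    rw [← hv0']
    refine quadEnergy_eq_of_hasDerivWithinAt (T := T) (g := fun s => G (v s))
      (fun t ht => (hv t ht).continuousWithinAt)
      (fun s hs => (hv s ⟨hs.1, hs.2.le⟩).mono_of_mem_nhdsWithin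
        (Icc_mem_nhdsGE_of_mem hs)) (fun s _ => ?_) ht
    have := hF.energy (v s)
    calc ∑ i, w i * v s i * G (v s) i = χ (v s) * ∑ i, w i * v s i * F (v s) i := by
          rw [Finset.mul_sum]
          exact Finset.sum_congr rfl fun i _ => by simp only [G, Pi.smul_apply, smul_eq_mul]; ring
      _ = 0 := by rw [this, mul_zero]
  refine ⟨v, hv0', fun t ht => ?_⟩
  have h1 : χ (v t) = 1 := χ.one_of_mem_closedBall <| by
    rw [mem_closedBall_zero_iff]
    exact hρ _ (hE t ht).le
  have h2 := hv t ht
  simp only [G, h1, one_smul] at h2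
  exact h2

theorem exists_trajectory (hF : IsConservativeField w F) (x : ι → ℝ) :
    ∃ v, IsTrajectory F x v := by
  choose v hv0 hv using fun n : ℕ => hF.exists_solution_Icc x (T := n + 1) (by positivity)
  have hE : ∀ n : ℕ, ∀ t ∈ Icc (0 : ℝ) (n + 1), quadEnergy w (v n t) = quadEnergy w x :=
    fun n t ht => by
      rw [← hv0 n]
      exact quadEnergy_eq_of_hasDerivWithinAt (T := n + 1) (g := fun s => F (v n s))
        (fun t ht => (hv n t ht).continuousWithinAt)
        (fun s hs => (hv n s ⟨hs.1, hs.2.le⟩).mono_of_mem_nhdsWithin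
          (Icc_mem_nhdsGE_of_mem hs)) (fun s _ => hF.energy _) ht
  obtain ⟨ρ, -, hρ⟩ := exists_norm_le_of_quadEnergy_le hF.weight_pos (quadEnergy w x)
  obtain ⟨K, hK⟩ := exists_lipschitzOnWith_closedBall hF.contDiff ρ
  have hag : ∀ n m : ℕ, n ≤ m → EqOn (v n) (v m) (Icc 0 (n + 1)) := fun n m hnm => by
    have hnm' : (n : ℝ) ≤ m := by exact_mod_cast hnm
    refine ODE_solution_unique_of_mem_Icc_right (v := fun _ => F) (K := K)
      (s := fun _ => Metric.closedBall 0 ρ) (fun _ _ => hK)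
      (fun t ht => (hv n t ht).continuousWithinAt)
      (fun s hs => (hv n s ⟨hs.1, hs.2.le⟩).mono_of_mem_nhdsWithin (Icc_mem_nhdsGE_of_mem hs))
      (fun s hs => ?_)
      (fun t ht => ((hv m t ⟨ht.1, by linarith [ht.2]⟩).continuousWithinAt).mono
        (Icc_subset_Icc_right (by linarith)))
      (fun s hs => (hv m s ⟨hs.1, by linarith [hs.2]⟩).mono_of_mem_nhdsWithin
        (Icc_mem_nhdsGE_of_mem ⟨hs.1, by linarith [hs.2]⟩))
      (fun s hs => ?_) (by rw [hv0, hv0])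
    · rw [mem_closedBall_zero_iff]
      exact hρ _ (hE n s ⟨hs.1, hs.2.le⟩).le
    · rw [mem_closedBall_zero_iff]
      exact hρ _ (hE m s ⟨hs.1, by linarith [hs.2]⟩).le
  -- The `n`-th solution lives on `[0, n + 1]`, so near `t` the glued function agrees with the
  -- solution of index `⌈t⌉₊ + 1`, whose interval contains a full neighbourhood of `t` in `[0, ∞)`.
  refine ⟨fun t => v ⌈t⌉₊ t, by simp [hv0], fun t ht => ?_⟩
  have hloc : ∀ s ∈ Icc (0 : ℝ) (⌈t⌉₊ + 1), v ⌈s⌉₊ s = v (⌈t⌉₊ + 1) s := fun s hs => by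
    refine hag _ _ (Nat.ceil_le.2 (by exact_mod_cast hs.2)) ⟨hs.1, ?_⟩
    linarith [Nat.le_ceil s]
  have ht1 : t < ⌈t⌉₊ + 1 := by linarith [Nat.le_ceil t]
  have h1 : HasDerivWithinAt (v (⌈t⌉₊ + 1)) (F (v (⌈t⌉₊ + 1) t)) (Icc 0 (⌈t⌉₊ + 1)) t := by
    refine (hv (⌈t⌉₊ + 1) t ⟨ht, ?_⟩).mono (Icc_subset_Icc_right ?_)
    · push_cast; linarith
    · push_cast; linarith
  rw [← hloc t ⟨ht, ht1.le⟩] at h1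
  have h2 := h1.congr hloc (hloc t ⟨ht, ht1.le⟩)
  refine h2.mono_of_mem_nhdsWithin ?_
  rw [← Ici_inter_Iic]
  exact inter_mem self_mem_nhdsWithin (mem_nhdsWithin_of_mem_nhds (Iic_mem_nhds ht1))

end IsConservativeField

end Conservative

end BQG

end

/-! ### Liouville's theorem by splitting the flow into shears -/

noncomputable section

namespace BQG

section Liouville

open Filter Topology Function
open scoped NNReal ENNReal

variable {ι : Type*} [DecidableEq ι] {w : ι → ℝ} {F : (ι → ℝ) → ι → ℝ}

/-- The shear which moves the `i`-th coordinate by `h Fᵢ`. -/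
def shear (F : (ι → ℝ) → ι → ℝ) (h : ℝ) (i : ι) (x : ι → ℝ) : ι → ℝ :=
  update x i (x i + h * F x i)

/-- The composition of the shears along a list of coordinates. -/
def splitStep (F : (ι → ℝ) → ι → ℝ) (h : ℝ) : List ι → (ι → ℝ) → ι → ℝ
  | [], x => x
  | i :: l, x => shear F h i (splitStep F h l x)

theorem continuous_shear (hF : Continuous F) (h : ℝ) (i : ι) : Continuous (shear F h i) :=
  continuous_id.update i (by fun_prop)

theorem continuous_splitStep (hF : Continuous F) (h : ℝ) (l : List ι) :
    Continuous (splitStep F h l) := by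
  induction l with
  | nil => exact continuous_id
  | cons i l ih => exact (continuous_shear hF h i).comp ih

variable [Fintype ι]

/-- Along a line in direction `i` the displacement `h Fᵢ` is constant, because `Fᵢ` ignores the
`i`-th coordinate. The shear is therefore a translation on each such line, and Fubini reduces the
claim to translation invariance. No Jacobian determinant is needed. -/
theorem lintegral_shear (hF : Continuous F) {i : ι}
    (hi : ∀ x t, F (update x i t) i = F x i) (h : ℝ) {f : (ι → ℝ) → ℝ≥0∞} (hf : Measurable f) :
    ∫⁻ x, f (shear F h i x) = ∫⁻ x, f x := by
  have hm : Measurable (shear F h i) := (continuous_shear hF h i).measurable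
  refine lintegral_eq_of_lmarginal_eq (μ := fun _ => volume) {i} (hf.comp hm) hf ?_
  rw [lmarginal_singleton, lmarginal_singleton]
  funext x
  have : ∀ t, f (shear F h i (update x i t)) = f (update x i (t + h * F x i)) := fun t => by
    simp [shear, hi]
  refine (lintegral_congr this).trans ?_
  exact lintegral_add_right_eq_self (fun t => f (update x i t)) _

theorem lintegral_splitStep (hF : Continuous F) (hu : ∀ x i t, F (update x i t) i = F x i)
    (h : ℝ) (l : List ι) {f : (ι → ℝ) → ℝ≥0∞} (hf : Measurable f) :
    ∫⁻ x, f (splitStep F h l x) = ∫⁻ x, f x := by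
  induction l generalizing f with
  | nil => rfl
  | cons i l ih =>
    rw [← lintegral_shear hF (fun x t => hu x i t) h hf]
    exact ih (hf.comp (continuous_shear hF h i).measurable)

/-- A sweep of shears is a first-order scheme. Each shear evaluates the field at a point already
displaced by `O(h)`, and the Lipschitz bound turns this into an `O(h²)` error. The count of `k` in
the list makes the induction possible; for a full sweep it is `1`. -/
theorem exists_splitStep_sub_le (hF : ContDiff ℝ 1 F) (l : List ι) (ρ : ℝ) :
    ∃ C : ℝ, 0 ≤ C ∧ ∀ h ∈ Icc (0 : ℝ) 1, ∀ x : ι → ℝ, ‖x‖ ≤ ρ → ∀ k,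
      |splitStep F h l x k - x k - h * (l.count k * F x k)| ≤ C * h ^ 2 := by
  induction l with
  | nil => exact ⟨0, le_rfl, fun h _ x _ k => by simp [splitStep]⟩
  | cons i l ih =>
    obtain ⟨C, hC0, hC⟩ := ih
    obtain ⟨M, hM⟩ := (isCompact_closedBall (0 : ι → ℝ) ρ).exists_bound_of_continuousOn
      hF.continuous.continuousOn
    -- For `h ≤ 1` the earlier shears move the point by at most `A h`, hence everything stays in the
    -- ball of radius `ρ + A`.
    set A : ℝ := C + l.length * |M| with hA
    have hA0 : 0 ≤ A := by positivity
    obtain ⟨K, hK⟩ := exists_lipschitzOnWith_closedBall hF (ρ + A)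
    refine ⟨C + K * A, by positivity, fun h hh x hx k => ?_⟩
    set y := splitStep F h l x with hy
    have hMx : ∀ k, |F x k| ≤ |M| := fun k =>
      ((norm_le_pi_norm (F x) k).trans (hM x (mem_closedBall_zero_iff.2 hx))).trans (le_abs_self M)
    have hyx : ‖y - x‖ ≤ A * h := by
      refine (pi_norm_le_iff_of_nonneg (mul_nonneg hA0 hh.1)).2 fun k => ?_
      have h1 := hC h hh x hx k
      have h2 : |h * (l.count k * F x k)| ≤ h * (l.length * |M|) := by
        rw [abs_mul, abs_mul, abs_of_nonneg hh.1, Nat.abs_cast]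
        have : (l.count k : ℝ) ≤ l.length := by exact_mod_cast List.count_le_length
        have := hMx k
        have := hh.1
        gcongr
      have h3 : C * h ^ 2 ≤ C * h := by nlinarith [mul_nonneg hC0 hh.1, hh.2]
      calc ‖(y - x) k‖ = |(y k - x k - h * (l.count k * F x k)) + h * (l.count k * F x k)| := by
            rw [Pi.sub_apply, Real.norm_eq_abs]; congr 1; ring
        _ ≤ C * h + h * (l.length * |M|) := (abs_add_le _ _).trans (by linarith)
        _ = A * h := by rw [hA]; ring
    have hFy : |F y i - F x i| ≤ K * (A * h) := by
      have hx' : x ∈ Metric.closedBall (0 : ι → ℝ) (ρ + A) := by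
        rw [mem_closedBall_zero_iff]; linarith
      have hy' : y ∈ Metric.closedBall (0 : ι → ℝ) (ρ + A) := by
        rw [mem_closedBall_zero_iff]
        have : ‖y‖ ≤ ‖x‖ + ‖y - x‖ := by
          calc ‖y‖ = ‖x + (y - x)‖ := by congr 1; abel
            _ ≤ _ := norm_add_le _ _
        nlinarith [hh.2]
      have h1 := hK.dist_le_mul y hy' x hx'
      rw [dist_eq_norm, dist_eq_norm] at h1
      calc |F y i - F x i| ≤ ‖F y - F x‖ := norm_le_pi_norm (F y - F x) i
        _ ≤ K * ‖y - x‖ := h1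
        _ ≤ _ := by gcongr
    have hCk := hC h hh x hx k
    by_cases hk : k = i
    · subst hk
      have : splitStep F h (k :: l) x k - x k - h * ((k :: l).count k * F x k)
          = (y k - x k - h * (l.count k * F x k)) + h * (F y k - F x k) := by
        simp only [splitStep, shear, update_self, List.count_cons_self, ← hy]
        push_cast; ring
      rw [this]
      refine (abs_add_le _ _).trans ?_
      rw [abs_mul, abs_of_nonneg hh.1]
      have := mul_le_mul_of_nonneg_left hFy hh.1
      nlinarith
    · have : splitStep F h (i :: l) x k - x k - h * ((i :: l).count k * F x k)
          = y k - x k - h * (l.count k * F x k) := by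
        simp only [splitStep, shear, update_of_ne hk, ← hy]
        rw [List.count_cons_of_ne (Ne.symm hk)]
      rw [this]
      have : 0 ≤ K * A * h ^ 2 := by positivity
      linarith

namespace IsConservativeField

variable {Φ : (ι → ℝ) → ℝ → ι → ℝ}

/-- Continuity in time for each datum and a Lipschitz bound in the datum, uniform on bounded times
and energies, give joint continuity. -/
theorem continuousOn_flow (hF : IsConservativeField w F) (hΦ : ∀ x, IsTrajectory F x (Φ x)) :
    ContinuousOn (uncurry Φ) (univ ×ˢ Ici 0) := by
  rintro ⟨x, t⟩ ⟨-, ht⟩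
  obtain ⟨K, hK⟩ := hF.exists_dist_le (quadEnergy w x + 1)
  have h1 : ContinuousOn (uncurry Φ)
      ({y | quadEnergy w y < quadEnergy w x + 1} ×ˢ Ico 0 (t + 1)) := by
    refine continuousOn_prod_of_continuousOn_lipschitzOnWith _ (Real.exp (K * (t + 1))).toNNReal
      (fun y _ => (hΦ y).continuousOn.mono Ico_subset_Ici_self) fun s hs => ?_
    refine LipschitzOnWith.of_dist_le_mul fun y hy z hz => ?_
    refine (hK y z (Φ y) (Φ z) (le_of_lt hy) (le_of_lt hz) (hΦ y) (hΦ z) s hs.1).trans ?_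
    rw [Real.coe_toNNReal _ (Real.exp_nonneg _), mul_comm]
    have := hs.2.le
    gcongr
  refine (h1 (x, t) ⟨by simp, ht, by simp⟩).mono_of_mem_nhdsWithin ?_
  rw [nhdsWithin_prod_eq, nhdsWithin_univ]
  refine prod_mem_prod ((isOpen_lt (continuous_quadEnergy w) continuous_const).mem_nhds
    (by simp)) ?_
  rw [← Ici_inter_Iio]
  exact inter_mem self_mem_nhdsWithin (mem_nhdsWithin_of_mem_nhds (Iio_mem_nhds (by linarith)))

theorem continuous_flow (hF : IsConservativeField w F) (hΦ : ∀ x, IsTrajectory F x (Φ x))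
    {t : ℝ} (ht : 0 ≤ t) : Continuous fun x => Φ x t :=
  (hF.continuousOn_flow hΦ).comp_continuous (f := fun x => (x, t)) (by fun_prop)
    fun x => ⟨mem_univ _, ht⟩

theorem flow_add (hF : IsConservativeField w F) (hΦ : ∀ x, IsTrajectory F x (Φ x))
    (x : ι → ℝ) {s t : ℝ} (hs : 0 ≤ s) (ht : 0 ≤ t) : Φ x (s + t) = Φ (Φ x s) t :=
  hF.trajectory_unique ((hΦ x).shift hs) (hΦ (Φ x s)) ht

/-- The mean value inequality is applied twice: first to bound the displacement by `|M| s`, then to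
the difference between the trajectory and its tangent. A `C¹` field suffices. -/
theorem exists_flow_sub_le (hF : IsConservativeField w F) (R : ℝ) :
    ∃ C : ℝ, 0 ≤ C ∧ ∀ x v, quadEnergy w x ≤ R → IsTrajectory F x v → ∀ h, 0 ≤ h →
      ‖v h - x - h • F x‖ ≤ C * h ^ 2 := by
  obtain ⟨ρ, -, hρ⟩ := exists_norm_le_of_quadEnergy_le hF.weight_pos R
  obtain ⟨K, hK⟩ := exists_lipschitzOnWith_closedBall hF.contDiff ρ
  obtain ⟨M, hM⟩ := (isCompact_closedBall (0 : ι → ℝ) ρ).exists_bound_of_continuousOn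
      hF.contDiff.continuous.continuousOn
  refine ⟨K * |M|, by positivity, fun x v hx hv h hh => ?_⟩
  have hmem : ∀ s, 0 ≤ s → v s ∈ Metric.closedBall (0 : ι → ℝ) ρ := fun s hs => by
    rw [mem_closedBall_zero_iff]
    exact hρ _ ((hF.quadEnergy_trajectory hv hs).le.trans hx)
  have h1 : ∀ s ∈ Icc 0 h, ‖v s - v 0‖ ≤ |M| * (s - 0) :=
    norm_image_sub_le_of_norm_deriv_right_le_segment (f' := fun s => F (v s))
      (hv.continuousOn.mono Icc_subset_Ici_self) (fun s hs => hv.hasDerivWithinAt_Ici hs.1)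
      fun s hs => (hM _ (hmem s hs.1)).trans (le_abs_self M)
  have h2 : ∀ s ∈ Icc 0 h, ‖(v s - s • F x) - (v 0 - (0 : ℝ) • F x)‖ ≤ K * |M| * h * (s - 0) := by
    refine norm_image_sub_le_of_norm_deriv_right_le_segment (f := fun s => v s - s • F x)
      (f' := fun s => F (v s) - F x) ?_ (fun s hs => ?_) fun s hs => ?_
    · exact (hv.continuousOn.mono Icc_subset_Ici_self).sub (by fun_prop)
    · have h3 := (hasDerivWithinAt_id s (Ici s)).smul_const (F x)
      rw [one_smul] at h3
      exact (hv.hasDerivWithinAt_Ici hs.1).sub h3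
    · have h3 := hK.dist_le_mul _ (hmem s hs.1) _ (hmem 0 le_rfl)
      have h4 := h1 s ⟨hs.1, hs.2.le⟩
      rw [dist_eq_norm, dist_eq_norm, hv.1] at h3
      rw [hv.1, sub_zero] at h4
      refine h3.trans ?_
      have : |M| * s ≤ |M| * h := by have := hs.2.le; gcongr
      calc (K : ℝ) * ‖v s - x‖ ≤ K * (|M| * h) := by gcongr; exact h4.trans this
        _ = _ := by ring
  have h3 := h2 h ⟨hh, le_rfl⟩
  rw [hv.1, zero_smul, sub_zero, sub_zero] at h3
  calc ‖v h - x - h • F x‖ = ‖v h - h • F x - x‖ := by congr 1; abel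
    _ ≤ _ := h3.trans (le_of_eq (by ring))

/-- One time step changes the integral of a Lipschitz observable, transported by the flow up to
time `t`, by at most a quadratic error. -/
theorem exists_lintegral_flow_add_le (hF : IsConservativeField w F)
    (hΦ : ∀ x, IsTrajectory F x (Φ x)) {f : (ι → ℝ) → ℝ≥0} {L : ℝ≥0} (hf : LipschitzWith L f)
    {R : ℝ} (hR : ∀ x, R < quadEnergy w x → f x = 0) (t : ℝ) :
    ∃ C : ℝ≥0, ∀ s ∈ Icc 0 t, ∀ h ∈ Icc (0 : ℝ) 1,
      ∫⁻ x, f (Φ x (s + h)) ≤ (∫⁻ x, f (Φ x s)) + C * ENNReal.ofReal (h ^ 2) := by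
  obtain ⟨ρ, hρ0, hρ⟩ := exists_norm_le_of_quadEnergy_le hF.weight_pos R
  let l : List ι := Finset.univ.toList
  have hl : ∀ k, l.count k = 1 := fun k =>
    List.count_eq_one_of_mem (Finset.nodup_toList _) (by simp [l])
  obtain ⟨C₁, hC₁0, hC₁⟩ := exists_splitStep_sub_le hF.contDiff l ρ
  obtain ⟨C₂, hC₂0, hC₂⟩ := hF.exists_flow_sub_le R
  have hstep : ∀ x, quadEnergy w x ≤ R → ∀ h ∈ Icc (0 : ℝ) 1,
      dist (Φ x h) (splitStep F h l x) ≤ (C₁ + C₂) * h ^ 2 := fun x hx h hh => by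
    have h1 : ‖splitStep F h l x - x - h • F x‖ ≤ C₁ * h ^ 2 := by
      refine (pi_norm_le_iff_of_nonneg (by positivity)).2 fun k => ?_
      have := hC₁ h hh x (hρ x hx) k
      rw [hl k] at this
      simpa using this
    have h2 := hC₂ x _ hx (hΦ x) h hh.1
    rw [dist_eq_norm]
    calc ‖Φ x h - splitStep F h l x‖
        = ‖(Φ x h - x - h • F x) - (splitStep F h l x - x - h • F x)‖ := by congr 1; abel
      _ ≤ _ := norm_sub_le _ _
      _ ≤ _ := by linarith
  have hcK : IsCompact {x : ι → ℝ | quadEnergy w x ≤ R} :=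
    (isCompact_closedBall (0 : ι → ℝ) ρ).of_isClosed_subset
      (isClosed_le (continuous_quadEnergy w) continuous_const)
      fun x hx => mem_closedBall_zero_iff.2 (hρ x hx)
  have hcont : Continuous fun p : ℝ × (ι → ℝ) => splitStep F p.1 l p.2 := by
    have : ∀ l : List ι, Continuous fun p : ℝ × (ι → ℝ) => splitStep F p.1 l p.2 := fun l => by
      induction l with
      | nil => exact continuous_snd
      | cons i l ih =>
        have hFc := hF.contDiff.continuous
        exact ih.update i (by fun_prop)
    exact this l
  -- Shears do not conserve the energy. Compactness bounds the energy after one sweep by `R'`, so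
  -- that one Lipschitz constant of the flow serves both the exact and the split step.
  obtain ⟨R', hR'⟩ := ((isCompact_Icc (a := (0 : ℝ)) (b := 1)).prod hcK).exists_bound_of_continuousOn
    ((continuous_quadEnergy w).comp hcont).continuousOn
  have hE : ∀ x, quadEnergy w x ≤ R → ∀ h ∈ Icc (0 : ℝ) 1,
      quadEnergy w (splitStep F h l x) ≤ max R R' := fun x hx h hh =>
    ((le_abs_self _).trans (hR' (h, x) ⟨hh, hx⟩)).trans (le_max_right _ _)
  obtain ⟨K, hK⟩ := hF.exists_dist_le (max R R')
  -- The one-step error `(C₁ + C₂) h²` is amplified by at most `exp (K t)` under the flow up to time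
  -- `s ≤ t`, and by `L` under the observable.
  let c : ℝ≥0 := (L * (((C₁ + C₂)) * Real.exp (K * t))).toNNReal
  have hvol : volume {x : ι → ℝ | quadEnergy w x ≤ R} ≠ ∞ := hcK.measure_ne_top
  refine ⟨c * (volume {x : ι → ℝ | quadEnergy w x ≤ R}).toNNReal, fun s hs h hh => ?_⟩
  have hfc : Measurable fun x => (f (Φ x s) : ℝ≥0∞) :=
    (ENNReal.continuous_coe.comp (hf.continuous.comp (hF.continuous_flow hΦ hs.1))).measurable
  -- The first step of length `h` is replaced by a sweep of shears, which disappears under the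
  -- integral by `lintegral_splitStep`. Where the energy exceeds `R` the left side is zero by
  -- conservation, so the error is paid only on a set of finite volume.
  have hpt : ∀ x, (f (Φ x (s + h)) : ℝ≥0∞) ≤ f (Φ (splitStep F h l x) s)
      + {x : ι → ℝ | quadEnergy w x ≤ R}.indicator
        (fun _ => (c : ℝ≥0∞) * ENNReal.ofReal (h ^ 2)) x := fun x => by
    by_cases hx : quadEnergy w x ≤ R
    · rw [indicator_of_mem (show x ∈ {x : ι → ℝ | quadEnergy w x ≤ R} from hx), add_comm s h,
        hF.flow_add hΦ x hh.1 hs.1]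
      have h1 := hK (Φ x h) (splitStep F h l x) _ _
        (((hF.quadEnergy_trajectory (hΦ x) hh.1).le.trans hx).trans (le_max_left _ _))
        (hE x hx h hh) (hΦ _) (hΦ _) s hs.1
      have h2 := hf.dist_le_mul (Φ (Φ x h) s) (Φ (splitStep F h l x) s)
      have h3 := hstep x hx h hh
      have h4 : (f (Φ (Φ x h) s) : ℝ) - f (Φ (splitStep F h l x) s) ≤ c * h ^ 2 := by
        rw [NNReal.dist_eq] at h2
        refine (le_abs_self _).trans (h2.trans ?_)
        rw [Real.coe_toNNReal _ (by positivity)]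
        calc (L : ℝ) * dist (Φ (Φ x h) s) (Φ (splitStep F h l x) s)
            ≤ L * ((((C₁ + C₂)) * h ^ 2) * Real.exp (K * t)) := by
              gcongr
              refine h1.trans ?_
              have := hs.2
              gcongr
          _ = _ := by ring
      have h5 : f (Φ (Φ x h) s) ≤ f (Φ (splitStep F h l x) s) + c * (h ^ 2).toNNReal := by
        rw [← NNReal.coe_le_coe]
        rw [NNReal.coe_add, NNReal.coe_mul, Real.coe_toNNReal (h ^ 2) (by positivity)]
        linarith
      rw [ENNReal.ofReal, ← ENNReal.coe_mul, ← ENNReal.coe_add]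
      exact ENNReal.coe_le_coe.2 h5
    · have : f (Φ x (s + h)) = 0 := hR _ (by
        rw [hF.quadEnergy_trajectory (hΦ x) (add_nonneg hs.1 hh.1)]
        exact not_le.1 hx)
      rw [this]
      simp
  refine (lintegral_mono hpt).trans ?_
  have hsplit : Measurable fun x => (f (Φ (splitStep F h l x) s) : ℝ≥0∞) :=
    hfc.comp (continuous_splitStep hF.contDiff.continuous h l).measurable
  rw [lintegral_add_left hsplit,
    lintegral_splitStep hF.contDiff.continuous hF.update h l hfc,
    lintegral_indicator_const hcK.measurableSet]
  refine add_le_add_right ?_ _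
  rw [ENNReal.coe_mul, ENNReal.coe_toNNReal hvol]
  exact le_of_eq (by ring)

/-- Dividing `[0, t]` into `n` steps costs at most `n · C (t/n)² = C t²/n`, which tends to zero. -/
theorem lintegral_flow_le (hF : IsConservativeField w F)
    (hΦ : ∀ x, IsTrajectory F x (Φ x)) {f : (ι → ℝ) → ℝ≥0} {L : ℝ≥0} (hf : LipschitzWith L f)
    {R : ℝ} (hR : ∀ x, R < quadEnergy w x → f x = 0) {t : ℝ} (ht : 0 ≤ t) :
    ∫⁻ x, f (Φ x t) ≤ ∫⁻ x, f x := by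
  obtain ⟨C, hC⟩ := hF.exists_lintegral_flow_add_le hΦ hf hR t
  have hn : ∀ n : ℕ, t ≤ n → ∀ k : ℕ, k ≤ n → ∫⁻ x, f (Φ x (k * (t / n))) ≤
      (∫⁻ x, f x) + k * (C * ENNReal.ofReal ((t / n) ^ 2)) := by
    intro n htn k
    induction k with
    | zero =>
      intro _
      simp [(hΦ _).1]
    | succ k ih =>
      intro hk
      have hn0 : (0 : ℝ) < n := by exact_mod_cast (Nat.succ_pos k).trans_le hk
      have hkn : (k : ℝ) ≤ n := by exact_mod_cast (Nat.le_succ k).trans hk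
      have h1 := hC (k * (t / n)) ⟨by positivity, ?_⟩ (t / n)
        ⟨by positivity, (div_le_one hn0).2 htn⟩
      · have h2 : ((k + 1 : ℕ) : ℝ) * (t / n) = k * (t / n) + t / n := by push_cast; ring
        rw [h2]
        refine h1.trans ((add_le_add_left (ih ((Nat.le_succ k).trans hk)) _).trans ?_)
        push_cast
        exact le_of_eq (by ring)
      · calc (k : ℝ) * (t / n) ≤ n * (t / n) := by gcongr
          _ = t := by field_simp
  have hev : ∀ᶠ n : ℕ in atTop, ∫⁻ x, f (Φ x t) ≤
      (∫⁻ x, f x) + C * ENNReal.ofReal (t ^ 2 / n) := by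
    filter_upwards [eventually_ge_atTop (⌈t⌉₊ + 1)] with n hn'
    have htn : t ≤ n := (Nat.le_ceil t).trans (by exact_mod_cast (Nat.le_succ _).trans hn')
    have hn0 : (0 : ℝ) < n := by exact_mod_cast (Nat.succ_pos _).trans_le hn'
    have h1 := hn n htn n le_rfl
    rw [mul_div_cancel₀ t hn0.ne'] at h1
    refine h1.trans (le_of_eq ?_)
    congr 1
    rw [mul_left_comm, ← ENNReal.ofReal_natCast, ← ENNReal.ofReal_mul hn0.le]
    congr 2
    field_simp
  refine ge_of_tendsto ?_ hev
  have h1 : Tendsto (fun n : ℕ => ENNReal.ofReal (t ^ 2 / n)) atTop (𝓝 0) := by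
    rw [← ENNReal.ofReal_zero]
    exact (ENNReal.continuous_ofReal.tendsto _).comp (tendsto_const_div_atTop_nhds_zero_nat _)
  have h2 := (ENNReal.Tendsto.const_mul h1 (Or.inr (ENNReal.coe_ne_top (r := C)))).const_add
    (∫⁻ x, (f x : ℝ≥0∞))
  simpa using h2

/-- Thickened indicators are Lipschitz observables squeezed between a compact set and an open
neighbourhood. Open sets are exhausted by compact ones, and outer regularity passes to all
measurable sets. Only an inequality is obtained, which is enough for probability measures. -/
theorem map_flow_volume_le (hF : IsConservativeField w F)
    (hΦ : ∀ x, IsTrajectory F x (Φ x)) {t : ℝ} (ht : 0 ≤ t) :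
    (volume : Measure (ι → ℝ)).map (fun x => Φ x t) ≤ volume := by
  have hm := (hF.continuous_flow hΦ ht).measurable
  have hcomp : ∀ A U : Set (ι → ℝ), IsCompact A → IsOpen U → A ⊆ U →
      (volume : Measure (ι → ℝ)).map (fun x => Φ x t) A ≤ volume U := fun A U hA hU hAU => by
    obtain ⟨δ, hδ, hδU⟩ := hA.exists_thickening_subset_open hU hAU
    obtain ⟨R, hR⟩ := (hA.isBounded.cthickening (δ := δ)).isCompact_closure
      |>.exists_bound_of_continuousOn (continuous_quadEnergy w).continuousOn
    have h1 := hF.lintegral_flow_le hΦ (f := thickenedIndicator hδ A)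
      (lipschitzWith_thickenedIndicator hδ A) (R := R) (fun x hx => ?_) ht
    · rw [Measure.map_apply hm hA.measurableSet]
      calc volume ((fun x => Φ x t) ⁻¹' A)
          = ∫⁻ x, ((fun x => Φ x t) ⁻¹' A).indicator 1 x := by
            rw [lintegral_indicator_one (hm hA.measurableSet)]
        _ ≤ ∫⁻ x, (thickenedIndicator hδ A (Φ x t) : ℝ≥0∞) := by
            refine lintegral_mono fun x => ?_
            by_cases hx : Φ x t ∈ A
            · rw [indicator_of_mem (show x ∈ (fun x => Φ x t) ⁻¹' A from hx),
                thickenedIndicator_one hδ A hx]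
              simp
            · rw [indicator_of_notMem (show x ∉ (fun x => Φ x t) ⁻¹' A from hx)]
              simp
        _ ≤ ∫⁻ x, (thickenedIndicator hδ A x : ℝ≥0∞) := h1
        _ ≤ ∫⁻ x, U.indicator 1 x := by
            refine lintegral_mono fun x => ?_
            by_cases hx : x ∈ U
            · rw [indicator_of_mem hx]
              exact ENNReal.coe_le_one_iff.2 (thickenedIndicator_le_one hδ A x)
            · rw [thickenedIndicator_zero hδ A fun h => hx (hδU h)]
              simp
        _ = volume U := lintegral_indicator_one hU.measurableSet
    · refine thickenedIndicator_zero hδ A fun h => ?_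
      have := hR x (subset_closure (Metric.thickening_subset_cthickening _ _ h))
      exact absurd ((le_abs_self _).trans this) (not_le.2 hx)
  have hopen : ∀ U : Set (ι → ℝ), IsOpen U →
      (volume : Measure (ι → ℝ)).map (fun x => Φ x t) U ≤ volume U := fun U hU => by
    obtain ⟨A, hA, hAU, hUn, hmono⟩ := hU.exists_iUnion_isClosed
    have hU' : U = ⋃ n : ℕ, A n ∩ Metric.closedBall 0 n := by
      refine Subset.antisymm (fun x hx => ?_)
        (iUnion_subset fun n => inter_subset_left.trans (hAU n))
      rw [← hUn] at hx
      obtain ⟨n, hn⟩ := mem_iUnion.1 hx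
      obtain ⟨m, hm⟩ := exists_nat_ge ‖x‖
      refine mem_iUnion.2 ⟨max n m, hmono (le_max_left _ _) hn, ?_⟩
      rw [mem_closedBall_zero_iff]
      exact hm.trans (by exact_mod_cast le_max_right n m)
    have hmono' : Monotone fun n : ℕ => A n ∩ Metric.closedBall (0 : ι → ℝ) n := fun n m hnm =>
      inter_subset_inter (hmono hnm) (Metric.closedBall_subset_closedBall (by exact_mod_cast hnm))
    conv_lhs => rw [hU', hmono'.measure_iUnion]
    refine iSup_le fun n => hcomp _ _ ?_ hU (inter_subset_left.trans (hAU n))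
    exact (isCompact_closedBall (0 : ι → ℝ) n).inter_left (hA n)
  refine Measure.le_iff.2 fun B _ => ?_
  rw [B.measure_eq_iInf_isOpen volume]
  exact le_iInf₂ fun U hBU => le_iInf fun hU => (measure_mono hBU).trans (hopen U hU)

/-- The flow preserves every probability measure whose density is a function of the energy. -/
theorem measurePreserving_flow (hF : IsConservativeField w F)
    (hΦ : ∀ x, IsTrajectory F x (Φ x)) {g : ℝ → ℝ≥0∞} (hg : Measurable g)
    [IsProbabilityMeasure ((volume : Measure (ι → ℝ)).withDensity fun x => g (quadEnergy w x))]
    {t : ℝ} (ht : 0 ≤ t) :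
    MeasurePreserving (fun x => Φ x t)
      ((volume : Measure (ι → ℝ)).withDensity fun x => g (quadEnergy w x))
      ((volume : Measure (ι → ℝ)).withDensity fun x => g (quadEnergy w x)) := by
  have hm := (hF.continuous_flow hΦ ht).measurable
  have hgm : Measurable fun x : ι → ℝ => g (quadEnergy w x) :=
    hg.comp (continuous_quadEnergy w).measurable
  refine ⟨hm, ?_⟩
  have := Measure.isProbabilityMeasure_map
    (μ := (volume : Measure (ι → ℝ)).withDensity fun x => g (quadEnergy w x)) hm.aemeasurable
  -- Two probability measures, one below the other, coincide; this upgrades the inequality for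
  -- Lebesgue measure to invariance.
  refine Measure.eq_of_le_of_isProbabilityMeasure ?_
  refine Measure.le_iff.2 fun B hB => ?_
  rw [Measure.map_apply hm hB, withDensity_apply _ (hm hB), withDensity_apply _ hB,
    ← lintegral_indicator (hm hB), ← lintegral_indicator hB]
  have h1 : ∀ x, ((fun x => Φ x t) ⁻¹' B).indicator (fun x => g (quadEnergy w x)) x
      = B.indicator (fun x => g (quadEnergy w x)) (Φ x t) := fun x => by
    simp only [indicator, hF.quadEnergy_trajectory (hΦ x) ht]
    rfl
  simp_rw [h1]
  rw [← lintegral_map (μ := volume) (hgm.indicator hB) hm]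
  exact lintegral_mono' (hF.map_flow_volume_le hΦ ht) le_rfl

end IsConservativeField

end Liouville

end BQG

end

noncomputable section

namespace BQG

/-! ### Smooth functions on the torus -/

section Torus

open Function
open scoped ContDiff

/-- The algebra of smooth real functions on the plane which are `2π`-periodic in each variable. -/
def smoothPeriodicSubalgebra : Subalgebra ℝ (ℝ → ℝ → ℝ) where
  carrier := {f | ContDiff ℝ ∞ (uncurry f) ∧
    ∀ x y, f (x + 2 * Real.pi) y = f x y ∧ f x (y + 2 * Real.pi) = f x y}
  mul_mem' := by
    rintro f g ⟨hf, hf'⟩ ⟨hg, hg'⟩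
    exact ⟨hf.mul hg, fun x y => by simp [hf' x y, hg' x y]⟩
  add_mem' := by
    rintro f g ⟨hf, hf'⟩ ⟨hg, hg'⟩
    exact ⟨hf.add hg, fun x y => by simp [hf' x y, hg' x y]⟩
  algebraMap_mem' := fun r => ⟨contDiff_const (c := r), fun x y => ⟨rfl, rfl⟩⟩

/-- Smooth real functions on the plane, `2π`-periodic in each variable. -/
abbrev SmoothPeriodic : Type := smoothPeriodicSubalgebra

namespace SmoothPeriodic

theorem contDiff (f : SmoothPeriodic) : ContDiff ℝ ∞ (uncurry f.1) := f.2.1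

theorem continuous (f : SmoothPeriodic) : Continuous (uncurry f.1) := f.contDiff.continuous

theorem hasDerivAt_fst (f : SmoothPeriodic) (x y : ℝ) :
    HasDerivAt (fun x' => f.1 x' y) (fderiv ℝ (uncurry f.1) (x, y) (1, 0)) x := by
  have h1 : HasFDerivAt (uncurry f.1) (fderiv ℝ (uncurry f.1) (x, y)) (x, y) :=
    (f.contDiff.differentiable (by simp) (x, y)).hasFDerivAt
  exact h1.comp_hasDerivAt x ((hasDerivAt_id x).prodMk (hasDerivAt_const x y))

theorem hasDerivAt_snd (f : SmoothPeriodic) (x y : ℝ) :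
    HasDerivAt (fun y' => f.1 x y') (fderiv ℝ (uncurry f.1) (x, y) (0, 1)) y := by
  have h1 : HasFDerivAt (uncurry f.1) (fderiv ℝ (uncurry f.1) (x, y)) (x, y) :=
    (f.contDiff.differentiable (by simp) (x, y)).hasFDerivAt
  exact h1.comp_hasDerivAt y ((hasDerivAt_const y x).prodMk (hasDerivAt_id y))

theorem contDiff_fderiv_apply (f : SmoothPeriodic) (v : ℝ × ℝ) :
    ContDiff ℝ ∞ fun p => fderiv ℝ (uncurry f.1) p v :=
  (f.contDiff.fderiv_right (m := ∞) (by simp)).clm_apply contDiff_const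

theorem fderiv_periodic (f : SmoothPeriodic) (x y : ℝ) :
    fderiv ℝ (uncurry f.1) (x + 2 * Real.pi, y) = fderiv ℝ (uncurry f.1) (x, y) ∧
    fderiv ℝ (uncurry f.1) (x, y + 2 * Real.pi) = fderiv ℝ (uncurry f.1) (x, y) := by
  constructor
  · have h1 := fderiv_comp_add_right (𝕜 := ℝ) (f := uncurry f.1) (x := (x, y)) (2 * Real.pi, 0)
    have h2 : (fun p : ℝ × ℝ => uncurry f.1 (p + (2 * Real.pi, 0))) = uncurry f.1 := by
      funext p
      simpa [uncurry] using (f.2.2 p.1 p.2).1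
    rw [h2] at h1
    simpa using h1.symm
  · have h1 := fderiv_comp_add_right (𝕜 := ℝ) (f := uncurry f.1) (x := (x, y)) (0, 2 * Real.pi)
    have h2 : (fun p : ℝ × ℝ => uncurry f.1 (p + (0, 2 * Real.pi))) = uncurry f.1 := by
      funext p
      simpa [uncurry] using (f.2.2 p.1 p.2).2
    rw [h2] at h1
    simpa using h1.symm

/-- The derivation `∂_x`. -/
def Dx : Derivation ℝ SmoothPeriodic SmoothPeriodic :=
  Derivation.mk'
    { toFun := fun f => ⟨fun x y => deriv (fun x' => f.1 x' y) x, by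
        have h : (fun x y => deriv (fun x' => f.1 x' y) x)
            = fun x y => fderiv ℝ (uncurry f.1) (x, y) (1, 0) := by
          funext x y; exact (f.hasDerivAt_fst x y).deriv
        rw [h]
        exact ⟨f.contDiff_fderiv_apply (1, 0), fun x y => by
          beta_reduce
          rw [(f.fderiv_periodic x y).1, (f.fderiv_periodic x y).2]; exact ⟨rfl, rfl⟩⟩⟩
      map_add' := fun f g => Subtype.ext <| by
        funext x y
        exact ((f.hasDerivAt_fst x y).differentiableAt.hasDerivAt.add
          (g.hasDerivAt_fst x y).differentiableAt.hasDerivAt).deriv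
      map_smul' := fun c f => Subtype.ext <| by
        funext x y
        exact ((f.hasDerivAt_fst x y).differentiableAt.hasDerivAt.const_mul c).deriv }
    fun f g => Subtype.ext <| by
      funext x y
      refine ((f.hasDerivAt_fst x y).differentiableAt.hasDerivAt.mul
        (g.hasDerivAt_fst x y).differentiableAt.hasDerivAt).deriv.trans ?_
      change _ = f.1 x y * deriv (fun x' => g.1 x' y) x + g.1 x y * deriv (fun x' => f.1 x' y) x
      ring

/-- The derivation `∂_y`. -/
def Dy : Derivation ℝ SmoothPeriodic SmoothPeriodic :=
  Derivation.mk'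
    { toFun := fun f => ⟨fun x y => deriv (fun y' => f.1 x y') y, by
        have h : (fun x y => deriv (fun y' => f.1 x y') y)
            = fun x y => fderiv ℝ (uncurry f.1) (x, y) (0, 1) := by
          funext x y; exact (f.hasDerivAt_snd x y).deriv
        rw [h]
        exact ⟨f.contDiff_fderiv_apply (0, 1), fun x y => by
          beta_reduce
          rw [(f.fderiv_periodic x y).1, (f.fderiv_periodic x y).2]; exact ⟨rfl, rfl⟩⟩⟩
      map_add' := fun f g => Subtype.ext <| by
        funext x y
        exact ((f.hasDerivAt_snd x y).differentiableAt.hasDerivAt.add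
          (g.hasDerivAt_snd x y).differentiableAt.hasDerivAt).deriv
      map_smul' := fun c f => Subtype.ext <| by
        funext x y
        exact ((f.hasDerivAt_snd x y).differentiableAt.hasDerivAt.const_mul c).deriv }
    fun f g => Subtype.ext <| by
      funext x y
      refine ((f.hasDerivAt_snd x y).differentiableAt.hasDerivAt.mul
        (g.hasDerivAt_snd x y).differentiableAt.hasDerivAt).deriv.trans ?_
      change _ = f.1 x y * deriv (fun y' => g.1 x y') y + g.1 x y * deriv (fun y' => f.1 x y') y
      ring

theorem Dx_apply (f : SmoothPeriodic) (x y : ℝ) :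
    (Dx f).1 x y = deriv (fun x' => f.1 x' y) x := rfl

theorem Dy_apply (f : SmoothPeriodic) (x y : ℝ) :
    (Dy f).1 x y = deriv (fun y' => f.1 x y') y := rfl

theorem uncurry_Dx (f : SmoothPeriodic) :
    uncurry (Dx f).1 = fun p => fderiv ℝ (uncurry f.1) p (1, 0) := by
  funext ⟨x, y⟩; exact (f.hasDerivAt_fst x y).deriv

theorem uncurry_Dy (f : SmoothPeriodic) :
    uncurry (Dy f).1 = fun p => fderiv ℝ (uncurry f.1) p (0, 1) := by
  funext ⟨x, y⟩; exact (f.hasDerivAt_snd x y).deriv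

theorem Dx_Dy (f : SmoothPeriodic) : Dx (Dy f) = Dy (Dx f) := by
  have hd : Differentiable ℝ (fderiv ℝ (uncurry f.1)) :=
    (f.contDiff.fderiv_right (m := ∞) (by simp)).differentiable (by simp)
  have key : ∀ (u v p : ℝ × ℝ), fderiv ℝ (fun p => fderiv ℝ (uncurry f.1) p u) p v
      = fderiv ℝ (fderiv ℝ (uncurry f.1)) p v u := fun u v p => by
    have := ((hd p).hasFDerivAt.clm_apply (hasFDerivAt_const u p)).fderiv
    rw [this]
    simp
  refine Subtype.ext (funext fun x => funext fun y => ?_)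
  change uncurry (Dx (Dy f)).1 (x, y) = uncurry (Dy (Dx f)).1 (x, y)
  rw [uncurry_Dx, uncurry_Dy, uncurry_Dy, uncurry_Dx]
  beta_reduce
  rw [key, key]
  exact (f.contDiff.contDiffAt.isSymmSndFDerivAt (by
    simpa using (by exact_mod_cast le_top : ((2 : ℕ∞) : WithTop ℕ∞) ≤ ∞))) _ _

end SmoothPeriodic

/-- The normalised Lebesgue measure on the fundamental domain. -/
def torusMeasure : Measure (ℝ × ℝ) :=
  ENNReal.ofReal (4 * Real.pi ^ 2)⁻¹ •
    (volume.restrict (Ioc (-Real.pi) Real.pi ×ˢ Ioc (-Real.pi) Real.pi))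

theorem torusMean_eq_integral {E : Type*} [NormedAddCommGroup E] [NormedSpace ℝ E]
    {f : ℝ → ℝ → E} (hf : Integrable (uncurry f) torusMeasure) :
    torusMean f = ∫ p, uncurry f p ∂torusMeasure := by
  have hpi := Real.pi_pos
  have hc : ENNReal.ofReal (4 * Real.pi ^ 2)⁻¹ ≠ 0 := by
    rw [Ne, ENNReal.ofReal_eq_zero, not_le]; positivity
  have hf' : IntegrableOn (uncurry f) (Ioc (-Real.pi) Real.pi ×ˢ Ioc (-Real.pi) Real.pi) :=
    (integrable_smul_measure hc ENNReal.ofReal_ne_top).1 hf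
  rw [torusMean, torusMeasure, integral_smul_measure, ENNReal.toReal_ofReal (by positivity),
    Measure.volume_eq_prod, setIntegral_prod _ hf']
  congr 1
  rw [intervalIntegral.integral_of_le (by linarith)]
  refine setIntegral_congr_fun measurableSet_Ioc fun x _ => ?_
  exact intervalIntegral.integral_of_le (by linarith)

instance : IsProbabilityMeasure torusMeasure := by
  constructor
  have hpi := Real.pi_pos
  rw [torusMeasure, Measure.smul_apply, Measure.restrict_apply_univ, Measure.volume_eq_prod,
    Measure.prod_prod, Real.volume_Ioc, ← ENNReal.ofReal_mul (by linarith), smul_eq_mul,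
    ← ENNReal.ofReal_mul (by positivity), ← ENNReal.ofReal_one]
  congr 1
  field_simp
  ring

theorem ae_mem_torusMeasure :
    ∀ᵐ p ∂torusMeasure, p ∈ Ioc (-Real.pi) Real.pi ×ˢ Ioc (-Real.pi) Real.pi :=
  Measure.ae_smul_measure (ae_restrict_mem (measurableSet_Ioc.prod measurableSet_Ioc)) _

theorem memLp_torusMeasure_of_continuous {g : ℝ × ℝ → ℝ} (hg : Continuous g) (p : ENNReal) :
    MemLp g p torusMeasure := by
  obtain ⟨C, hC⟩ := ((isCompact_Icc (a := -Real.pi) (b := Real.pi)).prod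
    (isCompact_Icc (a := -Real.pi) (b := Real.pi))).exists_bound_of_continuousOn hg.continuousOn
  refine MemLp.of_bound hg.aestronglyMeasurable C ?_
  filter_upwards [ae_mem_torusMeasure] with q hq
  exact hC q ⟨Ioc_subset_Icc_self hq.1, Ioc_subset_Icc_self hq.2⟩

namespace SmoothPeriodic

theorem memLp (f : SmoothPeriodic) (p : ENNReal) : MemLp (uncurry f.1) p torusMeasure :=
  memLp_torusMeasure_of_continuous f.continuous p

theorem integrable (f : SmoothPeriodic) : Integrable (uncurry f.1) torusMeasure :=
  memLp_one_iff_integrable.1 (f.memLp 1)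

/-- The mean over the torus. -/
def mean : SmoothPeriodic →ₗ[ℝ] ℝ where
  toFun f := torusMean f.1
  map_add' f g := by
    rw [torusMean_eq_integral f.integrable, torusMean_eq_integral g.integrable,
      torusMean_eq_integral (f + g).integrable]
    exact integral_add f.integrable g.integrable
  map_smul' c f := by
    rw [torusMean_eq_integral f.integrable, torusMean_eq_integral (c • f).integrable]
    exact integral_const_mul c _

theorem mean_eq_integral (f : SmoothPeriodic) : mean f = ∫ p, uncurry f.1 p ∂torusMeasure :=
  torusMean_eq_integral f.integrable

theorem mean_Dy (f : SmoothPeriodic) : mean (Dy f) = 0 := by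
  change torusMean _ = 0
  have h : ∀ x, ∫ y in (-Real.pi)..Real.pi, (Dy f).1 x y = 0 := fun x => by
    rw [intervalIntegral.integral_eq_sub_of_hasDerivAt (f := fun y => f.1 x y)
      (f' := fun y => (Dy f).1 x y)
      (fun y _ => (f.hasDerivAt_snd x y).differentiableAt.hasDerivAt)]
    · have := (f.2.2 x (-Real.pi)).2
      rw [sub_eq_zero, ← this]
      ring_nf
    · exact (((Dy f).continuous.comp (by fun_prop : Continuous fun y => (x, y)))).intervalIntegrable
        _ _
  simp_rw [torusMean, h]
  simp

theorem mean_Dx (f : SmoothPeriodic) : mean (Dx f) = 0 := by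
  have hpi := Real.pi_pos
  change torusMean _ = 0
  have h : ∀ y, ∫ x in (-Real.pi)..Real.pi, (Dx f).1 x y = 0 := fun y => by
    rw [intervalIntegral.integral_eq_sub_of_hasDerivAt (f := fun x => f.1 x y)
      (f' := fun x => (Dx f).1 x y) (fun x _ => (f.hasDerivAt_fst x y).differentiableAt.hasDerivAt)]
    · have := (f.2.2 (-Real.pi) y).1
      rw [sub_eq_zero, ← this]
      ring_nf
    · exact (((Dx f).continuous.comp (by fun_prop : Continuous fun x => (x, y)))).intervalIntegrable
        _ _
  rw [torusMean, intervalIntegral_intervalIntegral_swap]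
  · simp [h]
  · refine ((Dx f).continuous.continuousOn.integrableOn_compact
      ((isCompact_uIcc (a := -Real.pi) (b := Real.pi)).prod
        (isCompact_uIcc (a := -Real.pi) (b := Real.pi)))).mono_set ?_
    exact prod_mono uIoc_subset_uIcc uIoc_subset_uIcc

theorem mean_Dx_mul (f g : SmoothPeriodic) : mean (Dx f * g) = -mean (f * Dx g) := by
  have h := mean_Dx (f * g)
  rw [Derivation.leibniz, smul_eq_mul, smul_eq_mul, map_add, mul_comm g] at h
  linarith

theorem mean_Dy_mul (f g : SmoothPeriodic) : mean (Dy f * g) = -mean (f * Dy g) := by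
  have h := mean_Dy (f * g)
  rw [Derivation.leibniz, smul_eq_mul, smul_eq_mul, map_add, mul_comm g] at h
  linarith

theorem mean_one : mean 1 = 1 := by
  rw [mean_eq_integral]
  have : uncurry (1 : SmoothPeriodic).1 = fun _ => 1 := rfl
  rw [this]
  simp

theorem mean_mul_self_le {f : SmoothPeriodic} {C : ℝ} (h : ∀ x y, |f.1 x y| ≤ C) :
    mean (f * f) ≤ C ^ 2 := by
  rw [mean_eq_integral]
  refine (integral_mono (f * f).integrable (integrable_const (C ^ 2)) fun p => ?_).trans (by simp)
  change f.1 p.1 p.2 * f.1 p.1 p.2 ≤ C ^ 2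
  rw [← sq, ← sq_abs]
  exact pow_le_pow_left₀ (abs_nonneg _) (h _ _) 2

/-- The Jacobian `∇^⊥ f · ∇ g`. -/
def jacobian (f g : SmoothPeriodic) : SmoothPeriodic := -(Dy f * Dx g) + Dx f * Dy g

theorem coe_jacobian (f g : SmoothPeriodic) : (jacobian f g).1 = advection f.1 g.1 := by
  funext x y
  change -(deriv (fun y' => f.1 x y') y * deriv (fun x' => g.1 x' y) x) + _ = _
  rw [advection, neg_mul]
  rfl

theorem jacobian_add_left (f g k : SmoothPeriodic) :
    jacobian (f + g) k = jacobian f k + jacobian g k := by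
  simp only [jacobian, map_add]; ring

theorem jacobian_add_right (f g k : SmoothPeriodic) :
    jacobian k (f + g) = jacobian k f + jacobian k g := by
  simp only [jacobian, map_add]; ring

theorem jacobian_smul_left (c : ℝ) (f g : SmoothPeriodic) :
    jacobian (c • f) g = c • jacobian f g := by
  simp only [jacobian, Derivation.map_smul, smul_mul_assoc, smul_add, smul_neg]

theorem jacobian_smul_right (c : ℝ) (f g : SmoothPeriodic) :
    jacobian f (c • g) = c • jacobian f g := by
  simp only [jacobian, Derivation.map_smul, mul_smul_comm, smul_add, smul_neg]

theorem jacobian_swap (f g : SmoothPeriodic) : jacobian f g = -jacobian g f := by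
  simp only [jacobian]; ring

theorem jacobian_self (f : SmoothPeriodic) : jacobian f f = 0 := by
  simp only [jacobian]; ring

/-- The trilinear form `(f, g, k) ↦ ⨍ (∇^⊥ f · ∇ g) k`, which is totally antisymmetric. -/
def tri (f g k : SmoothPeriodic) : ℝ := mean (jacobian f g * k)

theorem tri_swap_left (f g k : SmoothPeriodic) : tri f g k = -tri g f k := by
  have h : jacobian f g * k = -(jacobian g f * k) := by rw [jacobian_swap]; ring
  rw [tri, h, map_neg, tri]

/-- The sum of the two integrands is `J(f, gk)`, which is the divergence `∂_x(f ∂_y(gk)) - ∂_y(f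
∂_x(gk))` and has mean zero. -/
theorem tri_swap_right (f g k : SmoothPeriodic) : tri f g k = -tri f k g := by
  have h1 := mean_Dx (f * Dy (g * k))
  have h2 := mean_Dy (f * Dx (g * k))
  have h3 : jacobian f g * k + jacobian f k * g = Dx (f * Dy (g * k)) - Dy (f * Dx (g * k)) := by
    simp only [jacobian, Derivation.leibniz, smul_eq_mul, map_add, Dx_Dy]
    ring
  have h4 := congrArg mean h3
  rw [map_add, map_sub, h1, h2, sub_zero] at h4
  rw [tri, tri]
  linarith

theorem tri_cycl (f g k : SmoothPeriodic) : tri f g k = tri k f g := by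
  rw [tri_swap_right, tri_swap_left, neg_neg]

theorem tri_self_left (f k : SmoothPeriodic) : tri f f k = 0 := by
  rw [tri, jacobian_self, zero_mul, map_zero]

theorem tri_self_right (f k : SmoothPeriodic) : tri k f f = 0 := by
  rw [← tri_cycl, tri_self_left]

theorem tri_self_outer (f k : SmoothPeriodic) : tri f k f = 0 := by
  rw [tri_cycl, tri_self_left]

theorem tri_add_left (f g k r : SmoothPeriodic) : tri (f + g) k r = tri f k r + tri g k r := by
  simp only [tri, jacobian_add_left, add_mul, map_add]

theorem tri_smul_left (c : ℝ) (f k r : SmoothPeriodic) : tri (c • f) k r = c * tri f k r := by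
  simp only [tri, jacobian_smul_left, smul_mul_assoc, map_smul, smul_eq_mul]

theorem tri_add_mid (f g k r : SmoothPeriodic) : tri k (f + g) r = tri k f r + tri k g r := by
  simp only [tri, jacobian_add_right, add_mul, map_add]

theorem tri_smul_mid (c : ℝ) (f k r : SmoothPeriodic) : tri k (c • f) r = c * tri k f r := by
  simp only [tri, jacobian_smul_right, smul_mul_assoc, map_smul, smul_eq_mul]

theorem tri_add_right (f g k r : SmoothPeriodic) : tri k r (f + g) = tri k r f + tri k r g := by
  simp only [tri, mul_add, map_add]

theorem tri_smul_right (c : ℝ) (f k r : SmoothPeriodic) : tri k r (c • f) = c * tri k r f := by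
  simp only [tri, mul_smul_comm, map_smul, smul_eq_mul]

/-- The Laplacian. -/
def laplacian (f : SmoothPeriodic) : SmoothPeriodic := Dx (Dx f) + Dy (Dy f)

theorem mean_laplacian_mul (f g : SmoothPeriodic) :
    mean (laplacian f * g) = mean (f * laplacian g) := by
  simp only [laplacian, add_mul, mul_add, map_add, mean_Dx_mul, mean_Dy_mul]
  ring

theorem laplacian_jacobian (f g : SmoothPeriodic) :
    laplacian (jacobian f g) = jacobian (laplacian f) g + jacobian f (laplacian g)
      + 2 • (jacobian (Dx f) (Dx g) + jacobian (Dy f) (Dy g)) := by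
  simp only [laplacian, jacobian, Derivation.leibniz, smul_eq_mul, map_add, map_neg, Dx_Dy]
  ring

/-- The functions `√2 sin(ky) (cos(jx) - sin(jx))`. -/
def casBasis (l : Mode) : SmoothPeriodic :=
  ⟨fun x y => Real.sqrt 2 * Real.sin (l.2 * y) * (Real.cos (l.1 * x) - Real.sin (l.1 * x)), by
    constructor
    · simp only [uncurry_def]
      fun_prop
    · intro x y
      have h1 : (l.1 : ℝ) * (x + 2 * Real.pi) = l.1 * x + l.1 * (2 * Real.pi) := by ring
      have h2 : (l.2 : ℝ) * (y + 2 * Real.pi) = l.2 * y + (l.2 : ℕ) * (2 * Real.pi) := by ring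
      beta_reduce
      rw [h1, h2, Real.sin_add_nat_mul_two_pi, Real.sin_add_int_mul_two_pi,
        Real.cos_add_int_mul_two_pi]
      exact ⟨rfl, rfl⟩⟩

/-- The functions `√2 cos(ky) (cos(jx) - sin(jx))`. -/
def casCobasis (l : Mode) : SmoothPeriodic :=
  ⟨fun x y => Real.sqrt 2 * Real.cos (l.2 * y) * (Real.cos (l.1 * x) - Real.sin (l.1 * x)), by
    constructor
    · simp only [uncurry_def]
      fun_prop
    · intro x y
      have h1 : (l.1 : ℝ) * (x + 2 * Real.pi) = l.1 * x + l.1 * (2 * Real.pi) := by ring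
      have h2 : (l.2 : ℝ) * (y + 2 * Real.pi) = l.2 * y + (l.2 : ℕ) * (2 * Real.pi) := by ring
      beta_reduce
      rw [h1, h2, Real.cos_add_nat_mul_two_pi, Real.sin_add_int_mul_two_pi,
        Real.cos_add_int_mul_two_pi]
      exact ⟨rfl, rfl⟩⟩

theorem casBasis_apply (l : Mode) (x y : ℝ) : (casBasis l).1 x y =
    Real.sqrt 2 * Real.sin (l.2 * y) * (Real.cos (l.1 * x) - Real.sin (l.1 * x)) := rfl

theorem casCobasis_apply (l : Mode) (x y : ℝ) : (casCobasis l).1 x y =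
    Real.sqrt 2 * Real.cos (l.2 * y) * (Real.cos (l.1 * x) - Real.sin (l.1 * x)) := rfl

theorem hasDerivAt_cas (j x : ℝ) : HasDerivAt (fun x => Real.cos (j * x) - Real.sin (j * x))
    (-j * (Real.cos (-j * x) - Real.sin (-j * x))) x := by
  have h := (((hasDerivAt_id x).const_mul j).cos).sub (((hasDerivAt_id x).const_mul j).sin)
  refine h.congr_deriv ?_
  rw [neg_mul j x, Real.cos_neg, Real.sin_neg]
  simp only [id]
  ring

theorem Dx_casBasis (l : Mode) : Dx (casBasis l) = (-l.1 : ℝ) • casBasis l.flip := by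
  refine Subtype.ext (funext fun x => funext fun y => ?_)
  rw [Dx_apply]
  refine ((hasDerivAt_cas l.1 x).const_mul (Real.sqrt 2 * Real.sin (l.2 * y))).deriv.trans ?_
  change _ = (-l.1 : ℝ) * _
  simp only [casBasis_apply, Mode.flip]
  push_cast
  ring

theorem Dx_casCobasis (l : Mode) : Dx (casCobasis l) = (-l.1 : ℝ) • casCobasis l.flip := by
  refine Subtype.ext (funext fun x => funext fun y => ?_)
  rw [Dx_apply]
  refine ((hasDerivAt_cas l.1 x).const_mul (Real.sqrt 2 * Real.cos (l.2 * y))).deriv.trans ?_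
  change _ = (-l.1 : ℝ) * _
  simp only [casCobasis_apply, Mode.flip]
  push_cast
  ring

theorem Dy_casBasis (l : Mode) : Dy (casBasis l) = (l.2 : ℝ) • casCobasis l := by
  refine Subtype.ext (funext fun x => funext fun y => ?_)
  rw [Dy_apply]
  have h := ((((hasDerivAt_id y).const_mul (l.2 : ℝ)).sin).const_mul (Real.sqrt 2)).mul_const
    (Real.cos (l.1 * x) - Real.sin (l.1 * x))
  refine h.deriv.trans ?_
  change _ = (l.2 : ℝ) * _
  simp only [casCobasis_apply, id]
  ring

theorem Dy_casCobasis (l : Mode) : Dy (casCobasis l) = (-l.2 : ℝ) • casBasis l := by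
  refine Subtype.ext (funext fun x => funext fun y => ?_)
  rw [Dy_apply]
  have h := ((((hasDerivAt_id y).const_mul (l.2 : ℝ)).cos).const_mul (Real.sqrt 2)).mul_const
    (Real.cos (l.1 * x) - Real.sin (l.1 * x))
  refine h.deriv.trans ?_
  change _ = (-l.2 : ℝ) * _
  simp only [casBasis_apply, id]
  ring

theorem flip_flip (l : Mode) : l.flip.flip = l := by simp [Mode.flip]

theorem Dx_Dx_casBasis (l : Mode) : Dx (Dx (casBasis l)) = (-(l.1 : ℝ) ^ 2) • casBasis l := by
  rw [Dx_casBasis, Derivation.map_smul, Dx_casBasis, flip_flip, smul_smul]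
  congr 1
  simp only [Mode.flip]; push_cast; ring

theorem Dy_Dy_casBasis (l : Mode) : Dy (Dy (casBasis l)) = (-(l.2 : ℝ) ^ 2) • casBasis l := by
  rw [Dy_casBasis, Derivation.map_smul, Dy_casCobasis, smul_smul]
  congr 1
  ring

theorem laplacian_casBasis (l : Mode) :
    laplacian (casBasis l) = (-l.normSq) • casBasis l := by
  rw [laplacian, Dx_Dx_casBasis, Dy_Dy_casBasis, ← add_smul, Mode.normSq]
  congr 1
  ring

theorem mean_casBasis_mul_flip {l : Mode} (hl : l.1 ≠ 0) :
    mean (casBasis l * casBasis l.flip) = 0 := by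
  have h := mean_Dx_mul (casBasis l) (casBasis l)
  rw [Dx_casBasis, smul_mul_assoc, mul_smul_comm, map_smul, map_smul, mul_comm, smul_eq_mul] at h
  have hl' : (l.1 : ℝ) ≠ 0 := by exact_mod_cast hl
  have h2 : (l.1 : ℝ) * mean (casBasis l * casBasis l.flip) = 0 := by linarith
  exact (mul_eq_zero.1 h2).resolve_left hl'

/-- The functions are eigenvectors of the symmetric operators `∂_x²` and `∂_y²`, so they are
orthogonal unless `p` is `l` or its flip. The flip is excluded by antisymmetry of `∂_x`, which maps
`casBasis l` to a multiple of `casBasis l.flip`. -/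
theorem mean_casBasis_mul_of_ne {l p : Mode} (h : l ≠ p) :
    mean (casBasis l * casBasis p) = 0 := by
  have hx : (l.1 : ℝ) ^ 2 * mean (casBasis l * casBasis p)
      = (p.1 : ℝ) ^ 2 * mean (casBasis l * casBasis p) := by
    have h1 : mean (Dx (Dx (casBasis l)) * casBasis p)
        = mean (casBasis l * Dx (Dx (casBasis p))) := by
      rw [mean_Dx_mul, mean_Dx_mul, neg_neg]
    rw [Dx_Dx_casBasis, Dx_Dx_casBasis, smul_mul_assoc, mul_smul_comm, map_smul, map_smul,
      smul_eq_mul, smul_eq_mul] at h1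
    linarith
  have hy : (l.2 : ℝ) ^ 2 * mean (casBasis l * casBasis p)
      = (p.2 : ℝ) ^ 2 * mean (casBasis l * casBasis p) := by
    have h1 : mean (Dy (Dy (casBasis l)) * casBasis p)
        = mean (casBasis l * Dy (Dy (casBasis p))) := by
      rw [mean_Dy_mul, mean_Dy_mul, neg_neg]
    rw [Dy_Dy_casBasis, Dy_Dy_casBasis, smul_mul_assoc, mul_smul_comm, map_smul, map_smul,
      smul_eq_mul, smul_eq_mul] at h1
    linarith
  by_contra hne
  have hx' := mul_right_cancel₀ hne hx
  have hy' := mul_right_cancel₀ hne hy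
  have h2 : l.2 = p.2 := by
    rw [sq_eq_sq₀ (by positivity) (by positivity)] at hy'
    exact PNat.coe_injective (by exact_mod_cast hy')
  have h1 : l.1 = p.1 ∨ l.1 = -p.1 := by
    have : l.1 ^ 2 = p.1 ^ 2 := by exact_mod_cast hx'
    exact sq_eq_sq_iff_eq_or_eq_neg.1 this
  rcases h1 with h1 | h1
  · exact h (Prod.ext h1 h2)
  · have hp : p = l.flip := Prod.ext (by simp [Mode.flip, h1]) h2.symm
    by_cases h0 : l.1 = 0
    · refine h (Prod.ext ?_ h2)
      rw [h0] at h1 ⊢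
      omega
    · exact hne (by rw [hp]; exact mean_casBasis_mul_flip h0)

theorem mean_casCobasis_mul_self (l : Mode) :
    mean (casCobasis l * casCobasis l) = mean (casBasis l * casBasis l) := by
  have h := mean_Dy_mul (casBasis l) (casCobasis l)
  have hk : (l.2 : ℝ) ≠ 0 := by exact_mod_cast l.2.ne_zero
  rw [Dy_casBasis, Dy_casCobasis, smul_mul_assoc, mul_smul_comm, map_smul, map_smul,
    smul_eq_mul, smul_eq_mul] at h
  exact mul_left_cancel₀ hk (by linarith)

theorem mean_casBasis_flip_mul_self (l : Mode) :
    mean (casBasis l.flip * casBasis l.flip) = mean (casBasis l * casBasis l) := by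
  by_cases h0 : l.1 = 0
  · have : l.flip = l := Prod.ext (by simp [Mode.flip, h0]) rfl
    rw [this]
  have h := mean_Dx_mul (casBasis l) (casBasis l.flip)
  rw [Dx_casBasis, Dx_casBasis, flip_flip, smul_mul_assoc, mul_smul_comm, map_smul, map_smul,
    smul_eq_mul, smul_eq_mul] at h
  have hl' : (l.1 : ℝ) ≠ 0 := by exact_mod_cast h0
  simp only [Mode.flip] at h ⊢
  push_cast at h
  exact mul_left_cancel₀ hl' (by linarith)

/-- Integration by parts shows that the sine and cosine versions and their flips have the same norm,
while the four squares add up to the constant `4`. No trigonometric integral is computed. -/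
theorem mean_casBasis_mul_self (l : Mode) : mean (casBasis l * casBasis l) = 1 := by
  have h : casBasis l * casBasis l + casCobasis l * casCobasis l
      + (casBasis l.flip * casBasis l.flip + casCobasis l.flip * casCobasis l.flip)
      = (4 : ℝ) • (1 : SmoothPeriodic) := by
    refine Subtype.ext (funext fun x => funext fun y => ?_)
    change (casBasis l).1 x y * (casBasis l).1 x y + (casCobasis l).1 x y * (casCobasis l).1 x y
      + ((casBasis l.flip).1 x y * (casBasis l.flip).1 x y
      + (casCobasis l.flip).1 x y * (casCobasis l.flip).1 x y) = 4 * 1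
    simp only [casBasis_apply, casCobasis_apply, Mode.flip]
    push_cast
    rw [neg_mul, Real.cos_neg, Real.sin_neg]
    have h2 : Real.sqrt 2 * Real.sqrt 2 = 2 := Real.mul_self_sqrt (by norm_num)
    have h3 := Real.sin_sq_add_cos_sq ((l.1 : ℝ) * x)
    have h4 := Real.sin_sq_add_cos_sq ((l.2 : ℝ) * y)
    set a := Real.sin ((l.1 : ℝ) * x)
    set b := Real.cos ((l.1 : ℝ) * x)
    set c := Real.sin ((l.2 : ℝ) * y)
    set d := Real.cos ((l.2 : ℝ) * y)
    linear_combination ((c ^ 2 + d ^ 2) * (2 * a ^ 2 + 2 * b ^ 2)) * h2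
      + 4 * (c ^ 2 + d ^ 2) * h3 + 4 * h4
  have h' := congrArg mean h
  simp only [map_add, map_smul, mean_casCobasis_mul_self, mean_casBasis_flip_mul_self, mean_one,
    smul_eq_mul] at h'
  linarith

theorem mean_casBasis_mul (l p : Mode) :
    mean (casBasis l * casBasis p) = if l = p then 1 else 0 := by
  split_ifs with h
  · rw [h, mean_casBasis_mul_self]
  · exact mean_casBasis_mul_of_ne h

theorem abs_cas_le (a b c : ℝ) (hc : |c| ≤ 1) :
    |Real.sqrt 2 * c * (Real.cos a - Real.sin b)| ≤ 3 := by
  have h1 : |Real.cos a - Real.sin b| ≤ 2 := by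
    have h2 := Real.abs_cos_le_one a
    have h3 := Real.abs_sin_le_one b
    exact (abs_sub _ _).trans (by linarith)
  have h2 : Real.sqrt 2 ≤ 1.5 := by
    rw [Real.sqrt_le_left (by norm_num)]; norm_num
  rw [abs_mul, abs_mul, abs_of_nonneg (Real.sqrt_nonneg 2)]
  calc Real.sqrt 2 * |c| * |Real.cos a - Real.sin b| ≤ 1.5 * 1 * 2 := by gcongr
    _ = 3 := by norm_num

theorem abs_casBasis_le (l : Mode) (x y : ℝ) : |(casBasis l).1 x y| ≤ 3 :=
  abs_cas_le _ _ _ (Real.abs_sin_le_one _)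

theorem abs_casCobasis_le (l : Mode) (x y : ℝ) : |(casCobasis l).1 x y| ≤ 3 :=
  abs_cas_le _ _ _ (Real.abs_cos_le_one _)

theorem mean_sum_smul_mul_self (c : Mode → ℝ) (s : Finset Mode) :
    mean ((∑ l ∈ s, c l • casBasis l) * ∑ l ∈ s, c l • casBasis l) = ∑ l ∈ s, c l ^ 2 := by
  simp only [Finset.sum_mul, Finset.mul_sum, map_sum, smul_mul_assoc, mul_smul_comm, map_smul,
    mean_casBasis_mul, smul_eq_mul]
  refine Finset.sum_congr rfl fun l hl => ?_
  simp [hl, sq]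

/-- Bessel's inequality. -/
theorem sum_integral_mul_casBasis_sq_le {g : ℝ × ℝ → ℝ} (hg : MemLp g 2 torusMeasure)
    (s : Finset Mode) :
    ∑ l ∈ s, (∫ p, g p * uncurry (casBasis l).1 p ∂torusMeasure) ^ 2
      ≤ ∫ p, g p ^ 2 ∂torusMeasure := by
  set c : Mode → ℝ := fun l => ∫ p, g p * uncurry (casBasis l).1 p ∂torusMeasure with hc
  set P : SmoothPeriodic := ∑ l ∈ s, c l • casBasis l with hP
  have hi : ∀ f : SmoothPeriodic, Integrable (fun p => g p * uncurry f.1 p) torusMeasure :=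
    fun f => hg.integrable_mul (f.memLp 2)
  have h1 : ∫ p, g p * uncurry P.1 p ∂torusMeasure = ∑ l ∈ s, c l ^ 2 := by
    have : ∀ p, g p * uncurry P.1 p
        = ∑ l ∈ s, c l * (g p * uncurry (casBasis l).1 p) := fun p => by
      have h2 : uncurry P.1 p = ∑ l ∈ s, c l * uncurry (casBasis l).1 p := by
        rw [hP]
        simp only [uncurry_def]
        rw [AddSubmonoidClass.coe_finsetSum]
        simp
      rw [h2, Finset.mul_sum]
      exact Finset.sum_congr rfl fun l _ => by ring
    simp_rw [this]
    rw [integral_finsetSum _ fun l _ => (hi (casBasis l)).const_mul (c l)]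
    refine Finset.sum_congr rfl fun l _ => ?_
    rw [integral_const_mul, sq]
  have h2 : ∫ p, uncurry (P * P).1 p ∂torusMeasure = ∑ l ∈ s, c l ^ 2 := by
    rw [← mean_eq_integral, hP, mean_sum_smul_mul_self]
  have h3 : 0 ≤ ∫ p, (g p ^ 2 - 2 * (g p * uncurry P.1 p) + uncurry (P * P).1 p) ∂torusMeasure := by
    refine integral_nonneg fun p => ?_
    change 0 ≤ g p ^ 2 - 2 * (g p * uncurry P.1 p) + uncurry P.1 p * uncurry P.1 p
    nlinarith [sq_nonneg (g p - uncurry P.1 p)]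
  have hgs : Integrable (fun p => g p ^ 2) torusMeasure := hg.integrable_sq
  have hgp := (hi P).const_mul 2
  have h4 := integral_add (hgs.sub hgp) (P * P).integrable
  simp only [Pi.sub_apply] at h4
  rw [h4, integral_sub hgs hgp, integral_const_mul, h1, h2] at h3
  linarith

theorem sum_mean_mul_casBasis_sq_le (f : SmoothPeriodic) (s : Finset Mode) :
    ∑ l ∈ s, mean (f * casBasis l) ^ 2 ≤ mean (f * f) := by
  have h := sum_integral_mul_casBasis_sq_le (f.memLp 2) s
  simp only [mean_eq_integral]
  refine h.trans (le_of_eq (integral_congr_ae (Filter.Eventually.of_forall fun p => ?_)))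
  exact sq _

end SmoothPeriodic

end Torus

end BQG

end

noncomputable section

namespace BQG

/-! ### The truncated equations in real coordinates -/

section Coordinates

open Function SmoothPeriodic

variable {N : ℕ}

theorem ModeN.flip_flip (l : ModeN N) : l.flip.flip = l := Subtype.ext (SmoothPeriodic.flip_flip l.1)

theorem ModeN.sum_flip {M : Type*} [AddCommMonoid M] (f : ModeN N → M) :
    ∑ l : ModeN N, f l.flip = ∑ l, f l :=
  Equiv.sum_comp (Function.Involutive.toPerm ModeN.flip ModeN.flip_flip) f

/-- The real (Hartley) coordinates `Re ξ_l + Im ξ_l` of an element of `ℋ_N`. -/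
def hartley (ξ : HN N) (l : ModeN N) : ℝ := (ξ.1 l).re + (ξ.1 l).im

/-- The function with the given real coordinates. -/
def synth : (ModeN N → ℝ) →ₗ[ℝ] SmoothPeriodic :=
  Fintype.linearCombination ℝ fun l => casBasis l.1

theorem synth_apply (c : ModeN N → ℝ) : synth c = ∑ l, c l • casBasis l.1 :=
  Fintype.linearCombination_apply ..

theorem synth_coe_apply (c : ModeN N → ℝ) (x y : ℝ) :
    (synth c).1 x y = ∑ l, c l * (casBasis l.1).1 x y := by
  rw [synth_apply, AddSubmonoidClass.coe_finsetSum]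
  simp

/-- Mode `l` contributes `Re ξ cos - Im ξ sin` in `x`. The sum of the terms `Im ξ cos - Re ξ sin`
vanishes, since flipping `j` changes their sign; adding it factors the total as `(Re ξ + Im ξ)(cos -
sin)`. This gives real orthonormal coordinates without choosing half of the modes. -/
theorem toFun_eq_synth (ξ : HN N) : HN.toFun ξ = (synth (hartley ξ)).1 := by
  funext x y
  rw [synth_coe_apply, HN.toFun, Complex.re_sum]
  have h1 : ∀ l : ModeN N, (ξ.1 l * basisFun l.1 x y).re = Real.sqrt 2 * Real.sin (l.1.2 * y) *
      ((ξ.1 l).re * Real.cos (l.1.1 * x) - (ξ.1 l).im * Real.sin (l.1.1 * x)) := fun l => by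
    have h2 : Complex.exp (Complex.I * l.1.1 * x)
        = Real.cos (l.1.1 * x) + Real.sin (l.1.1 * x) * Complex.I := by
      rw [mul_assoc, mul_comm, Complex.exp_mul_I]
      push_cast
      rfl
    rw [basisFun, h2, ← mul_assoc, Complex.re_mul_ofReal, Complex.mul_re]
    simp only [Complex.add_re, Complex.add_im, Complex.ofReal_re, Complex.ofReal_im,
      Complex.re_ofReal_mul, Complex.im_ofReal_mul, Complex.I_re, Complex.I_im]
    ring
  have h2 : ∑ l : ModeN N, Real.sqrt 2 * Real.sin (l.1.2 * y) *
      ((ξ.1 l).im * Real.cos (l.1.1 * x) - (ξ.1 l).re * Real.sin (l.1.1 * x)) = 0 := by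
    have h3 := ModeN.sum_flip (N := N) fun l => Real.sqrt 2 * Real.sin (l.1.2 * y) *
      ((ξ.1 l).im * Real.cos (l.1.1 * x) - (ξ.1 l).re * Real.sin (l.1.1 * x))
    have h4 : ∀ l : ModeN N, Real.sqrt 2 * Real.sin (l.flip.1.2 * y) *
        ((ξ.1 l.flip).im * Real.cos (l.flip.1.1 * x) - (ξ.1 l.flip).re * Real.sin (l.flip.1.1 * x))
        = -(Real.sqrt 2 * Real.sin (l.1.2 * y) *
        ((ξ.1 l).im * Real.cos (l.1.1 * x) - (ξ.1 l).re * Real.sin (l.1.1 * x))) := fun l => by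
      rw [ξ.2 l, Complex.conj_re, Complex.conj_im]
      simp only [ModeN.flip, Mode.flip]
      push_cast
      rw [neg_mul (l.1.1 : ℝ) x, Real.cos_neg, Real.sin_neg]
      ring
    simp_rw [h4] at h3
    rw [Finset.sum_neg_distrib] at h3
    linarith
  rw [← add_zero (∑ l : ModeN N, _), ← h2, ← Finset.sum_add_distrib]
  refine Finset.sum_congr rfl fun l _ => ?_
  rw [h1, casBasis_apply, hartley]
  ring

/-- Integrability alone is assumed because the odd extension of the topography may jump. -/
theorem hartley_proj {f : ℝ → ℝ → ℝ} (hf : Integrable (uncurry f) torusMeasure) (l : ModeN N) :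
    hartley (HN.proj N f) l = ∫ p, uncurry f p * uncurry (casBasis l.1).1 p ∂torusMeasure := by
  set F : ℝ → ℝ → ℂ := fun x y => (f x y : ℂ) * basisFun l.1.flip x y with hF
  have hb : Continuous (uncurry (basisFun l.1.flip)) := by
    simp only [uncurry_def, basisFun]
    fun_prop
  have hFi : Integrable (uncurry F) torusMeasure := by
    have h1 : Integrable (fun p => ((uncurry f p : ℝ) : ℂ)) torusMeasure := hf.ofReal
    refine h1.mul_bdd (c := 3) hb.aestronglyMeasurable (Filter.Eventually.of_forall fun p => ?_)
    have h2 : Complex.I * (l.1.flip.1 : ℂ) * (p.1 : ℂ)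
        = ((l.1.flip.1 * p.1 : ℝ) : ℂ) * Complex.I := by push_cast; ring
    simp only [basisFun]
    rw [h2, norm_mul, Complex.norm_exp_ofReal_mul_I, Complex.norm_real, one_mul, Real.norm_eq_abs]
    simpa using abs_cas_le 0 0 _ (Real.abs_sin_le_one (l.1.flip.2 * p.2))
  have h1 : fourierCoeff f l.1 = ∫ p, uncurry F p ∂torusMeasure := torusMean_eq_integral hFi
  rw [hartley]
  change (fourierCoeff f l.1).re + (fourierCoeff f l.1).im = _
  rw [h1, ← RCLike.re_eq_complex_re, ← RCLike.im_eq_complex_im, ← integral_re hFi, ← integral_im hFi,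
    ← integral_add hFi.re hFi.im]
  refine integral_congr_ae (Filter.Eventually.of_forall fun p => ?_)
  have h2 : Complex.exp (Complex.I * l.1.flip.1 * p.1)
        = Real.cos (l.1.1 * p.1) - Real.sin (l.1.1 * p.1) * Complex.I := by
    rw [mul_assoc, mul_comm, Complex.exp_mul_I]
    simp only [Mode.flip]
    push_cast
    rw [neg_mul, Complex.cos_neg, Complex.sin_neg]
    ring
  have h3 : l.1.flip.2 = l.1.2 := rfl
  simp only [uncurry_def, hF, basisFun, h2, RCLike.re_eq_complex_re, RCLike.im_eq_complex_im,
    Complex.re_ofReal_mul, Complex.im_ofReal_mul, Complex.re_mul_ofReal, Complex.im_mul_ofReal,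
    casBasis_apply, Complex.sub_re, Complex.sub_im, Complex.ofReal_re, Complex.ofReal_im,
    Complex.I_re, Complex.I_im, h3]
  ring

theorem hartley_proj_smooth (f : SmoothPeriodic) (l : ModeN N) :
    hartley (HN.proj N f.1) l = mean (f * casBasis l.1) := by
  rw [hartley_proj f.integrable, mean_eq_integral]
  rfl

theorem hartley_dx (ξ : HN N) : hartley (HN.dx ξ) = fun l : ModeN N => l.1.1 * hartley ξ l.flip := by
  funext l
  simp only [hartley, HN.dx, ξ.2 l, Complex.mul_re, Complex.mul_im, Complex.I_re, Complex.I_im,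
    Complex.intCast_re, Complex.intCast_im, Complex.conj_re, Complex.conj_im]
  ring

theorem hartley_invLaplacian (ξ : HN N) :
    hartley (HN.invLaplacian ξ) = fun l : ModeN N => -(l.1.normSq)⁻¹ * hartley ξ l := by
  funext l
  simp only [hartley, HN.invLaplacian, neg_mul, Complex.neg_re, Complex.neg_im,
    Complex.re_ofReal_mul, Complex.im_ofReal_mul]
  ring

theorem hartley_resolvent (μ : ℝ) (ξ : HN N) :
    hartley (HN.resolvent μ ξ) = fun l : ModeN N => (μ + l.1.normSq)⁻¹ * hartley ξ l := by
  funext l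
  simp only [hartley, HN.resolvent, Complex.re_ofReal_mul, Complex.im_ofReal_mul]
  ring

theorem hartley_add (ξ ζ : HN N) : hartley (ξ + ζ) = hartley ξ + hartley ζ := by
  funext l
  change (ξ.1 l + ζ.1 l).re + (ξ.1 l + ζ.1 l).im = _
  simp only [hartley, Pi.add_apply, Complex.add_re, Complex.add_im]
  ring

theorem hartley_smul (c : ℝ) (ξ : HN N) : hartley (c • ξ) = c • hartley ξ := by
  funext l
  change (c • ξ.1 l).re + (c • ξ.1 l).im = c * ((ξ.1 l).re + (ξ.1 l).im)
  simp only [Complex.smul_re, Complex.smul_im, smul_eq_mul]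
  ring

theorem Dx_synth (c : ModeN N → ℝ) : Dx (synth c) = synth fun l => l.1.1 * c l.flip := by
  rw [synth_apply, synth_apply, map_sum, ← ModeN.sum_flip]
  refine Finset.sum_congr rfl fun l _ => ?_
  rw [Derivation.map_smul, Dx_casBasis, smul_smul]
  simp only [ModeN.flip, SmoothPeriodic.flip_flip]
  congr 1
  simp only [Mode.flip]
  push_cast
  ring

theorem laplacian_synth (c : ModeN N → ℝ) :
    laplacian (synth c) = synth fun l => -l.1.normSq * c l := by
  rw [synth_apply, synth_apply, laplacian]
  simp only [map_sum, Derivation.map_smul]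
  rw [← Finset.sum_add_distrib]
  refine Finset.sum_congr rfl fun l _ => ?_
  rw [← smul_add, ← laplacian, laplacian_casBasis, smul_smul, mul_comm]

theorem mean_synth_mul (c : ModeN N → ℝ) (l : ModeN N) :
    mean (synth c * casBasis l.1) = c l := by
  rw [synth_apply, Finset.sum_mul, map_sum, Finset.sum_eq_single l]
  · rw [smul_mul_assoc, map_smul, mean_casBasis_mul_self, smul_eq_mul, mul_one]
  · intro p _ hp
    rw [smul_mul_assoc, map_smul, mean_casBasis_mul_of_ne fun h => hp (Subtype.ext h), smul_zero]
  · simp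

theorem mean_synth_mul_synth (c d : ModeN N → ℝ) :
    mean (synth c * synth d) = ∑ l, d l * c l := by
  rw [synth_apply d, Finset.mul_sum, map_sum]
  refine Finset.sum_congr rfl fun l _ => ?_
  rw [mul_smul_comm, map_smul, mean_synth_mul, smul_eq_mul]

/-- The form `f ↦ ⨍ (∂_t ω) f` given by the truncated equations, with `ψ = Δ⁻¹ω` and
`g = (μ - Δ)⁻¹ h`. -/
def fieldForm (μ β U : ℝ) (ω ψ g : SmoothPeriodic) : SmoothPeriodic →ₗ[ℝ] ℝ where
  toFun f := -tri ψ ω f - ((U - β / μ) * mean (Dx ω * f) + U * μ * mean (Dx g * f)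
    + tri g ω f + μ * tri ψ g f + β * mean (Dx ψ * f))
  map_add' f k := by
    simp only [tri_add_right, mul_add, map_add]; ring
  map_smul' c f := by
    simp only [tri_smul_right, mul_smul_comm, map_smul, smul_eq_mul, RingHom.id_apply]; ring

/-- The truncated vector field in the real coordinates; `d` are the coordinates of `h^N`. -/
def coordField (μ β : ℝ) (d : ModeN N → ℝ) (x : Option (ModeN N) → ℝ) : Option (ModeN N) → ℝ
  | none => mean (synth d * Dx (synth fun l => -(l.1.normSq)⁻¹ * x (some l)))
  | some l => fieldForm μ β (x none) (synth fun l => x (some l))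
      (synth fun l => -(l.1.normSq)⁻¹ * x (some l)) (synth fun l => (μ + l.1.normSq)⁻¹ * d l)
      (casBasis l.1)

/-- Real coordinates on `ℝ × ℋ_N`. -/
def coords (N : ℕ) : (ℝ × HN N) ≃L[ℝ] (Option (ModeN N) → ℝ) :=
  LinearEquiv.toContinuousLinearEquiv
    { toFun := fun u i => i.elim u.1 (hartley u.2)
      -- Conjugate symmetry gives the coordinates `Re ξ_l ± Im ξ_l` at `l` and its flip, so half the
      -- sum and half the difference recover `ξ_l`.
      invFun := fun x => (x none, ⟨fun l => ⟨(x (some l) + x (some l.flip)) / 2,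
        (x (some l) - x (some l.flip)) / 2⟩, fun l => by
          beta_reduce
          rw [ModeN.flip_flip]
          apply Complex.ext
          · simp only [Complex.conj_re]; ring
          · simp only [Complex.conj_im]; ring⟩)
      map_add' := fun u v => by
        funext i
        cases i with
        | none => rfl
        | some l => exact congrFun (hartley_add u.2 v.2) l
      map_smul' := fun c u => by
        funext i
        cases i with
        | none => rfl
        | some l => exact congrFun (hartley_smul c u.2) l
      left_inv := fun u => by
        refine Prod.ext rfl (Subtype.ext (funext fun l => ?_))
        have h := u.2.2 l
        simp only [Option.elim, hartley, h, Complex.conj_re, Complex.conj_im]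
        apply Complex.ext <;> simp only <;> ring
      right_inv := fun x => by
        funext i
        cases i with
        | none => rfl
        | some l =>
          simp only [Option.elim, hartley]
          ring }

theorem coords_none (u : ℝ × HN N) : coords N u none = u.1 := rfl

theorem coords_some (u : ℝ × HN N) (l : ModeN N) : coords N u (some l) = hartley u.2 l := rfl

/-- Taking the coordinate of a projection is pairing with a basis function, so `Π_N` disappears and
each component becomes a trilinear or bilinear mean of smooth functions. -/
theorem coords_galerkinField (μ β : ℝ) (h : ℝ → ℝ → ℝ) (u : ℝ × HN N) :
    coords N (galerkinField μ β h N u)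
      = coordField μ β (hartley (topographyN h N)) (coords N u) := by
  have hinv : hartley (HN.invLaplacian u.2)
      = fun l : ModeN N => -(l.1.normSq)⁻¹ * coords N u (some l) := hartley_invLaplacian u.2
  have hres : hartley (HN.resolvent μ (topographyN h N))
      = fun l : ModeN N => (μ + l.1.normSq)⁻¹ * hartley (topographyN h N) l := hartley_resolvent μ _
  have hω : hartley u.2 = fun l => coords N u (some l) := rfl
  funext i
  cases i with
  | none =>
    rw [coords_none, galerkinField, coordField]
    simp only [toFun_eq_synth]
    rw [hartley_dx, ← Dx_synth, hinv]
    rfl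
  | some l =>
    rw [coords_some, galerkinField, coordField]
    have hneg : ∀ ξ ζ : HN N, hartley (-ξ - ζ) = -hartley ξ - hartley ζ := fun ξ ζ => by
      funext l
      change (-ξ.1 l - ζ.1 l).re + (-ξ.1 l - ζ.1 l).im
        = -((ξ.1 l).re + (ξ.1 l).im) - ((ζ.1 l).re + (ζ.1 l).im)
      simp only [Complex.sub_re, Complex.sub_im, Complex.neg_re, Complex.neg_im]
      ring
    have hadv : ∀ ξ ζ : HN N, hartley (HN.proj N (advection (HN.toFun ξ) (HN.toFun ζ))) l
        = tri (synth (hartley ξ)) (synth (hartley ζ)) (casBasis l.1) := fun ξ ζ => by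
      rw [toFun_eq_synth, toFun_eq_synth, ← coe_jacobian, hartley_proj_smooth, tri]
    have hdx : ∀ ξ : HN N, hartley (HN.dx ξ) l = mean (Dx (synth (hartley ξ)) * casBasis l.1) :=
      fun ξ => by rw [hartley_dx, Dx_synth, mean_synth_mul]
    rw [hneg, affineTerm]
    simp only [hartley_add, hartley_smul, Pi.sub_apply, Pi.neg_apply, Pi.add_apply,
      Pi.smul_apply, smul_eq_mul, hadv, hdx, hinv, hres, hω, map_smul, tri_smul_mid]
    rfl

end Coordinates

end BQG

end

/-! ### The coordinate field is conservative and divergence free -/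

noncomputable section

namespace BQG

section Field

open Function SmoothPeriodic

variable {N : ℕ}

theorem tri_synth_left (c : ModeN N → ℝ) (f g : SmoothPeriodic) :
    tri (synth c) f g = ∑ l, c l * tri (casBasis l.1) f g := by
  let L : SmoothPeriodic →ₗ[ℝ] ℝ :=
    { toFun := fun k => tri k f g
      map_add' := fun _ _ => tri_add_left _ _ _ _
      map_smul' := fun _ _ => tri_smul_left _ _ _ _ }
  change L (synth c) = ∑ l, c l * L (casBasis l.1)
  rw [synth_apply, map_sum]
  exact Finset.sum_congr rfl fun l _ => by rw [map_smul, smul_eq_mul]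

theorem tri_synth_mid (c : ModeN N → ℝ) (f g : SmoothPeriodic) :
    tri f (synth c) g = ∑ l, c l * tri f (casBasis l.1) g := by
  simp_rw [← tri_cycl _ g f, tri_synth_left]

theorem mean_mul_Dx_synth (c : ModeN N → ℝ) (f : SmoothPeriodic) :
    mean (f * Dx (synth c)) = ∑ l, c l * mean (f * Dx (casBasis l.1)) := by
  rw [synth_apply, map_sum, Finset.mul_sum, map_sum]
  exact Finset.sum_congr rfl fun l _ => by
    rw [Derivation.map_smul, mul_smul_comm, map_smul, smul_eq_mul]

theorem mean_Dx_synth_mul (c : ModeN N → ℝ) (l : ModeN N) :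
    mean (Dx (synth c) * casBasis l.1) = l.1.1 * c l.flip := by
  rw [Dx_synth, mean_synth_mul]

theorem coordField_none (μ β : ℝ) (d : ModeN N → ℝ) (x : Option (ModeN N) → ℝ) :
    coordField μ β d x none
      = ∑ q, x (some q) * (-(q.1.normSq)⁻¹ * mean (synth d * Dx (casBasis q.1))) := by
  rw [coordField, mean_mul_Dx_synth]
  exact Finset.sum_congr rfl fun q _ => by ring

/-- The expansion shows that the field is polynomial and separates the six terms whose moments are
bounded one by one. -/
theorem coordField_some (μ β : ℝ) (d : ModeN N → ℝ) (x : Option (ModeN N) → ℝ) (l : ModeN N) :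
    coordField μ β d x (some l)
      = (∑ p, ∑ q, x (some p) * x (some q) *
          ((p.1.normSq)⁻¹ * tri (casBasis p.1) (casBasis q.1) (casBasis l.1)))
        - (x none - β / μ) * (l.1.1 * x (some l.flip))
        - x none * (μ * (l.1.1 * ((μ + l.flip.1.normSq)⁻¹ * d l.flip)))
        - (∑ q, x (some q) *
          tri (synth fun l => (μ + l.1.normSq)⁻¹ * d l) (casBasis q.1) (casBasis l.1))
        + (∑ q, x (some q) * (μ * (q.1.normSq)⁻¹ *
          tri (casBasis q.1) (synth fun l => (μ + l.1.normSq)⁻¹ * d l) (casBasis l.1)))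
        + β * (l.1.1 * ((l.flip.1.normSq)⁻¹ * x (some l.flip))) := by
  rw [coordField]
  change -tri _ _ _ - (_ + _ + tri _ _ _ + _ * tri _ _ _ + _) = _
  have h1 : tri (synth fun l : ModeN N => -(l.1.normSq)⁻¹ * x (some l))
      (synth fun l => x (some l)) (casBasis l.1) = -∑ p, ∑ q, x (some p) * x (some q) *
          ((p.1.normSq)⁻¹ * tri (casBasis p.1) (casBasis q.1) (casBasis l.1)) := by
    rw [tri_synth_left, ← Finset.sum_neg_distrib]
    refine Finset.sum_congr rfl fun p _ => ?_
    rw [tri_synth_mid, Finset.mul_sum, ← Finset.sum_neg_distrib]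
    exact Finset.sum_congr rfl fun q _ => by ring
  have h2 : μ * tri (synth fun l : ModeN N => -(l.1.normSq)⁻¹ * x (some l))
      (synth fun l => (μ + l.1.normSq)⁻¹ * d l) (casBasis l.1)
      = -∑ q, x (some q) * (μ * (q.1.normSq)⁻¹ *
          tri (casBasis q.1) (synth fun l => (μ + l.1.normSq)⁻¹ * d l) (casBasis l.1)) := by
    rw [tri_synth_left, Finset.mul_sum, ← Finset.sum_neg_distrib]
    exact Finset.sum_congr rfl fun q _ => by ring
  rw [h1, h2, mean_Dx_synth_mul, mean_Dx_synth_mul, mean_Dx_synth_mul, tri_synth_mid]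
  ring

theorem contDiff_coordField (μ β : ℝ) (d : ModeN N → ℝ) :
    ContDiff ℝ 1 (coordField μ β d) := by
  refine contDiff_pi.2 fun i => ?_
  cases i with
  | none =>
    simp_rw [coordField_none]
    fun_prop
  | some l =>
    simp_rw [coordField_some]
    fun_prop

/-- The weights of the pseudoenergy. -/
def energyWeight (μ : ℝ) : Option (ModeN N) → ℝ
  | none => μ
  | some l => 1 + μ / l.1.normSq

/-- The equation is tested against `ω - μψ`, the gradient of the pseudoenergy. Antisymmetry kills
the nonlinearity and the transport terms; the two topographic Jacobians cancel each other by cyclic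
invariance; the remaining forcing proportional to `U` cancels the energy change of the mean flow. -/
theorem fieldForm_energy {μ : ℝ} (β U : ℝ) {ω ψ g k : SmoothPeriodic} (hψ : laplacian ψ = ω)
    (hg : μ • g - laplacian g = k) :
    fieldForm μ β U ω ψ g (ω - μ • ψ) + μ * U * mean (k * Dx ψ) = 0 := by
  have hanti : ∀ f : SmoothPeriodic, mean (Dx f * f) = 0 := fun f => by
    have := mean_Dx_mul f f
    rw [mul_comm f] at this
    linarith
  have hsub : ω - μ • ψ = ω + (-μ) • ψ := by rw [neg_smul, sub_eq_add_neg]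
  have h1 : mean (Dx ω * ψ) = 0 := by
    have e1 : mean (Dx ω * ψ) = -mean (Dx ψ * ω) := by rw [mean_Dx_mul, mul_comm]
    have e2 : Dx ω = laplacian (Dx ψ) := by
      rw [← hψ]; simp only [laplacian, map_add, Dx_Dy]
    have e3 : mean (Dx ω * ψ) = mean (Dx ψ * ω) := by rw [e2, mean_laplacian_mul, hψ]
    linarith
  have h2 : mean (Dx ψ * ω) = 0 := by rw [mean_Dx_mul, mul_comm, h1, neg_zero]
  have h3 : mean (Dx g * ω) - μ * mean (Dx g * ψ) = mean (k * Dx ψ) := by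
    have e1 : Dx k = μ • Dx g - laplacian (Dx g) := by
      rw [← hg]; simp only [laplacian, map_sub, Derivation.map_smul, map_add, Dx_Dy]
    have e2 : mean (k * Dx ψ) = -mean (Dx k * ψ) := by rw [mean_Dx_mul, neg_neg]
    rw [e2, e1, sub_mul, smul_mul_assoc, map_sub, map_smul, mean_laplacian_mul, hψ, smul_eq_mul]
    ring
  have h4 : tri ψ g ω = tri g ω ψ := by rw [tri_cycl g ω ψ]
  rw [hsub]
  change -tri _ _ _ - (_ * mean _ + _ * mean _ + tri _ _ _ + _ * tri _ _ _ + _ * mean _) + _ = 0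
  simp only [tri_add_right, tri_smul_right, mul_add, mul_smul_comm, map_add, map_smul, smul_eq_mul,
    tri_self_right, tri_self_outer, hanti, h1, h2, h4, ← h3]
  ring

/-- The test function `ω - μψ` lies in the span of the retained modes, so the energy identity
survives truncation. -/
theorem coordField_energy {μ : ℝ} (hμ : 0 < μ) (β : ℝ) (d : ModeN N → ℝ)
    (x : Option (ModeN N) → ℝ) :
    ∑ i, energyWeight μ i * x i * coordField μ β d x i = 0 := by
  set ω : SmoothPeriodic := synth fun l : ModeN N => x (some l) with hω
  set ψ : SmoothPeriodic := synth fun l : ModeN N => -(l.1.normSq)⁻¹ * x (some l) with hψ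
  set g : SmoothPeriodic := synth fun l : ModeN N => (μ + l.1.normSq)⁻¹ * d l with hg
  have hψω : laplacian ψ = ω := by
    rw [hψ, laplacian_synth]
    congr 1
    funext l
    have := l.1.normSq_pos.ne'
    field_simp
  have hgk : μ • g - laplacian g = synth d := by
    rw [hg, laplacian_synth, ← map_smul, ← map_sub]
    congr 1
    funext l
    have := (add_pos hμ l.1.normSq_pos).ne'
    simp only [Pi.sub_apply, Pi.smul_apply, smul_eq_mul]
    field_simp
    ring
  have hq : ω - μ • ψ = synth fun l : ModeN N => (1 + μ / l.1.normSq) * x (some l) := by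
    rw [hω, hψ, ← map_smul, ← map_sub]
    congr 1
    funext l
    simp only [Pi.sub_apply, Pi.smul_apply, smul_eq_mul]
    ring
  have key := fieldForm_energy β (x none) hψω hgk
  rw [hq, synth_apply, map_sum] at key
  rw [Fintype.sum_option, ← key, add_comm]
  congr 1
  refine Finset.sum_congr rfl fun l _ => ?_
  rw [map_smul, smul_eq_mul]
  rfl

theorem mean_Dx_casBasis_mul_self (l : Mode) : mean (Dx (casBasis l) * casBasis l) = 0 := by
  have := mean_Dx_mul (casBasis l) (casBasis l)
  rw [mul_comm (casBasis l)] at this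
  linarith

/-- Changing `x_l` adds multiples of `φ_l` to `ω` and `ψ`. The `l`-th component is tested against
`φ_l` itself, and `tri` vanishes when two arguments agree, as does `⨍ (∂_x φ_l) φ_l`. -/
theorem coordField_update (μ β : ℝ) (d : ModeN N → ℝ) (x : Option (ModeN N) → ℝ)
    (i : Option (ModeN N)) (t : ℝ) :
    coordField μ β d (update x i t) i = coordField μ β d x i := by
  cases i with
  | none =>
    rw [coordField_none, coordField_none]
    exact Finset.sum_congr rfl fun q _ => by rw [update_of_ne (by simp)]
  | some l =>
    have hω : (synth fun p : ModeN N => update x (some l) t (some p))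
        = (synth fun p => x (some p)) + (t - x (some l)) • casBasis l.1 := by
      have h1 : (fun p : ModeN N => update x (some l) t (some p))
          = (fun p => x (some p)) + (t - x (some l)) • Pi.single l 1 := by
        funext p
        by_cases hp : p = l
        · subst hp; simp
        · simp [hp]
      rw [h1, map_add, map_smul, synth, Fintype.linearCombination_apply_single, one_smul]
    have hψ : (synth fun p : ModeN N => -(p.1.normSq)⁻¹ * update x (some l) t (some p))
        = (synth fun p => -(p.1.normSq)⁻¹ * x (some p))
          + (-(l.1.normSq)⁻¹ * (t - x (some l))) • casBasis l.1 := by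
      have h1 : (fun p : ModeN N => -(p.1.normSq)⁻¹ * update x (some l) t (some p))
          = (fun p => -(p.1.normSq)⁻¹ * x (some p))
            + (-(l.1.normSq)⁻¹ * (t - x (some l))) • Pi.single l 1 := by
        funext p
        by_cases hp : p = l
        · subst hp; simp; ring
        · simp [hp]
      rw [h1, map_add, map_smul, synth, Fintype.linearCombination_apply_single, one_smul]
    rw [coordField, coordField, hω, hψ, update_of_ne (by simp)]
    change -tri _ _ _ - (_ * mean _ + _ * mean _ + tri _ _ _ + _ * tri _ _ _ + _ * mean _) =
      -tri _ _ _ - (_ * mean _ + _ * mean _ + tri _ _ _ + _ * tri _ _ _ + _ * mean _)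
    simp only [tri_add_left, tri_add_mid, tri_smul_left, tri_smul_mid, tri_self_right,
      tri_self_outer, map_add, Derivation.map_smul, add_mul, smul_mul_assoc,
      map_smul, mean_Dx_casBasis_mul_self, smul_eq_mul]
    ring

theorem isConservativeField_coordField {μ : ℝ} (hμ : 0 < μ) (β : ℝ) (d : ModeN N → ℝ)
    [DecidableEq (Option (ModeN N))] :
    IsConservativeField (energyWeight μ) (coordField μ β d) where
  contDiff := contDiff_coordField μ β d
  weight_pos i := by
    cases i with
    | none => exact hμ
    | some l =>
      have := l.1.normSq_pos
      simp only [energyWeight]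
      positivity
  energy := coordField_energy hμ β d
  update x i t := by convert coordField_update μ β d x i t

end Field

end BQG

end

noncomputable section

namespace BQG

/-! ### Gaussian measures -/

section Gauss

open Function ProbabilityTheory
open scoped NNReal ENNReal

variable {ι : Type*} [Fintype ι]

/-- The centred Gaussian measure with independent coordinates of variances `v`. -/
def gaussPi (v : ι → ℝ≥0) : Measure (ι → ℝ) := Measure.pi fun i => gaussianReal 0 (v i)

instance (v : ι → ℝ≥0) : IsProbabilityMeasure (gaussPi v) := by
  unfold gaussPi; infer_instance

theorem gaussPi_eq_withDensity {v : ι → ℝ≥0} (hv : ∀ i, v i ≠ 0) :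
    gaussPi v = volume.withDensity fun x => ENNReal.ofReal (∏ i, gaussianPDFReal 0 (v i) (x i)) := by
  refine Measure.pi_eq fun s hs => ?_
  have hsm : MeasurableSet (univ.pi s) := MeasurableSet.univ_pi hs
  rw [withDensity_apply _ hsm, ← lintegral_indicator hsm]
  have h1 : ∀ x : ι → ℝ, (univ.pi s).indicator
      (fun x => ENNReal.ofReal (∏ i, gaussianPDFReal 0 (v i) (x i))) x
      = ENNReal.ofReal (∏ i, (s i).indicator (gaussianPDFReal 0 (v i)) (x i)) := fun x => by
    by_cases hx : x ∈ univ.pi s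
    · rw [indicator_of_mem hx]
      congr 1
      exact Finset.prod_congr rfl fun i _ => (indicator_of_mem (hx i (mem_univ i)) _).symm
    · rw [indicator_of_notMem hx]
      simp only [mem_univ_pi, not_forall] at hx
      obtain ⟨i, hi⟩ := hx
      rw [Finset.prod_eq_zero (Finset.mem_univ i) (indicator_of_notMem hi _), ENNReal.ofReal_zero]
  have h2 : ∀ i, Integrable ((s i).indicator (gaussianPDFReal 0 (v i))) :=
    fun i => (integrable_gaussianPDFReal 0 (v i)).indicator (hs i)
  have h3 : ∀ i x, 0 ≤ (s i).indicator (gaussianPDFReal 0 (v i)) x := fun i x =>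
    indicator_nonneg (fun y _ => gaussianPDFReal_nonneg 0 (v i) y) x
  simp_rw [h1]
  have h4 : Integrable fun x : ι → ℝ => ∏ i, (s i).indicator (gaussianPDFReal 0 (v i)) (x i) :=
    Integrable.fintype_prod h2
  rw [← ofReal_integral_eq_lintegral_ofReal h4
    (Filter.Eventually.of_forall fun x => Finset.prod_nonneg fun i _ => h3 i (x i)),
    integral_fintype_prod_volume_eq_prod (fun i => (s i).indicator (gaussianPDFReal 0 (v i))),
    ENNReal.ofReal_prod_of_nonneg fun i _ => integral_nonneg (h3 i)]
  refine Finset.prod_congr rfl fun i _ => ?_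
  rw [integral_indicator (hs i), gaussianReal_apply_eq_integral 0 (hv i)]

theorem gaussPi_eq_smul_withDensity {w : ι → ℝ} (hw : ∀ i, 0 < w i) {α : ℝ} (hα : 0 < α) :
    gaussPi (fun i => (α * w i)⁻¹.toNNReal)
      = ENNReal.ofReal (∏ i, (Real.sqrt (2 * Real.pi * (α * w i)⁻¹))⁻¹) •
        volume.withDensity fun x => ENNReal.ofReal (Real.exp (-(α / 2) * quadEnergy w x)) := by
  have hpos : ∀ i, 0 < (α * w i)⁻¹ := fun i => by have := hw i; positivity
  rw [gaussPi_eq_withDensity fun i => (Real.toNNReal_pos.2 (hpos i)).ne',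
    ← withDensity_smul' _ _ ENNReal.ofReal_ne_top]
  congr 1
  funext x
  rw [Pi.smul_apply, smul_eq_mul, ← ENNReal.ofReal_mul
    (Finset.prod_nonneg fun i _ => inv_nonneg.2 (Real.sqrt_nonneg _))]
  congr 1
  simp only [gaussianPDFReal]
  rw [Finset.prod_mul_distrib, ← Real.exp_sum, quadEnergy, Finset.mul_sum]
  congr 1
  · exact Finset.prod_congr rfl fun i _ => by rw [Real.coe_toNNReal _ (hpos i).le]
  · congr 1
    refine Finset.sum_congr rfl fun i _ => ?_
    rw [Real.coe_toNNReal _ (hpos i).le]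
    have := (hw i).ne'
    field_simp
    ring

variable {v : ι → ℝ≥0}

theorem memLp_eval_gaussPi (i : ι) {p : ℝ≥0∞} (hp : p ≠ ∞) :
    MemLp (fun x : ι → ℝ => x i) p (gaussPi v) :=
  (memLp_id_gaussianReal' p hp).comp_measurePreserving
    (measurePreserving_eval (fun i => gaussianReal 0 (v i)) i)

theorem integrable_eval_pow_gaussPi (i : ι) (n : ℕ) :
    Integrable (fun x : ι → ℝ => x i ^ n) (gaussPi v) := by
  have := (memLp_eval_gaussPi (v := v) i (p := n) (by simp)).integrable_norm_pow'
  refine (integrable_norm_iff ?_).1 (by simpa using this)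
  exact ((continuous_apply i).pow n).aestronglyMeasurable

/-- The even moments of the standard Gaussian distribution. -/
def gaussMoment (n : ℕ) : ℝ := ∫ x, x ^ (2 * n) ∂gaussianReal 0 1

theorem gaussMoment_nonneg (n : ℕ) : 0 ≤ gaussMoment n :=
  integral_nonneg fun x => by simp only [pow_mul]; positivity

theorem integral_eval_pow_le {V : ℝ≥0} (hV : ∀ i, v i ≤ V) (i : ι) (n : ℕ) :
    ∫ x, x i ^ (2 * n) ∂gaussPi v ≤ V ^ n * gaussMoment n := by
  have h1 : ∫ x, x i ^ (2 * n) ∂gaussPi v = ∫ y, y ^ (2 * n) ∂gaussianReal 0 (v i) := by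
    rw [← (measurePreserving_eval (fun i => gaussianReal 0 (v i)) i).map_eq,
      integral_map (measurable_pi_apply i).aemeasurable (by fun_prop)]
    rfl
  have h2 : gaussianReal 0 (v i) = (gaussianReal 0 1).map (Real.sqrt (v i) * ·) := by
    rw [gaussianReal_map_const_mul, mul_zero, mul_one]
    congr 1
    apply NNReal.coe_injective
    simp
  rw [h1, h2, integral_map (by fun_prop) (by fun_prop)]
  have h3 : ∀ y : ℝ, (Real.sqrt (v i) * y) ^ (2 * n) = (v i : ℝ) ^ n * y ^ (2 * n) := fun y => by
    rw [mul_pow, pow_mul, Real.sq_sqrt (v i).coe_nonneg]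
  simp_rw [h3]
  rw [integral_const_mul]
  have := gaussMoment_nonneg n
  have := hV i
  change (v i : ℝ) ^ n * gaussMoment n ≤ _
  gcongr

theorem lintegral_eval_pow_le {V : ℝ≥0} (hV : ∀ i, v i ≤ V) (i : ι) (n : ℕ) :
    ∫⁻ x, ENNReal.ofReal (x i ^ (2 * n)) ∂gaussPi v ≤ ENNReal.ofReal (V ^ n * gaussMoment n) := by
  rw [← ofReal_integral_eq_lintegral_ofReal (integrable_eval_pow_gaussPi i _)
    (Filter.Eventually.of_forall fun x => by simp only [pow_mul]; positivity)]
  exact ENNReal.ofReal_le_ofReal (integral_eval_pow_le hV i n)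

theorem integrable_mul_eval (p q : ι) :
    Integrable (fun x : ι → ℝ => x p * x q) (gaussPi v) := by
  refine ((integrable_eval_pow_gaussPi p 2).add (integrable_eval_pow_gaussPi q 2)).mono'
    (by fun_prop) (Filter.Eventually.of_forall fun x => ?_)
  rw [Real.norm_eq_abs, abs_mul, Pi.add_apply, ← sq_abs (x p), ← sq_abs (x q)]
  nlinarith [sq_nonneg (|x p| - |x q|), abs_nonneg (x p), abs_nonneg (x q)]

theorem abs_mul_mul_le (a b c d : ℝ) : |a * b * (c * d)| ≤ a ^ 4 + b ^ 4 + (c ^ 4 + d ^ 4) := by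
  rw [abs_mul]
  have h1 : |a * b| ≤ a ^ 2 + b ^ 2 := by
    rw [abs_le]; constructor <;> nlinarith [sq_nonneg (a + b), sq_nonneg (a - b)]
  have h2 : |c * d| ≤ c ^ 2 + d ^ 2 := by
    rw [abs_le]; constructor <;> nlinarith [sq_nonneg (c + d), sq_nonneg (c - d)]
  have h3 : |a * b| ^ 2 ≤ (a ^ 4 + b ^ 4) / 2 := by
    rw [sq_abs]; nlinarith [sq_nonneg (a ^ 2 - b ^ 2)]
  have h4 : |c * d| ^ 2 ≤ (c ^ 4 + d ^ 4) / 2 := by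
    rw [sq_abs]; nlinarith [sq_nonneg (c ^ 2 - d ^ 2)]
  have : 0 ≤ a ^ 4 + b ^ 4 + (c ^ 4 + d ^ 4) := by positivity
  nlinarith [sq_nonneg (|a * b| - |c * d|)]

theorem integrable_mul_mul_eval (p q r s : ι) :
    Integrable (fun x : ι → ℝ => x p * x q * (x r * x s)) (gaussPi v) := by
  refine (((integrable_eval_pow_gaussPi p 4).add (integrable_eval_pow_gaussPi q 4)).add
    ((integrable_eval_pow_gaussPi r 4).add (integrable_eval_pow_gaussPi s 4))).mono'
    (by fun_prop) (Filter.Eventually.of_forall fun x => ?_)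
  exact abs_mul_mul_le _ _ _ _

variable [DecidableEq ι]

/-- The Gaussian measure is invariant under a change of sign of one coordinate. -/
theorem measurePreserving_update_neg (i : ι) :
    MeasurePreserving (fun x : ι → ℝ => update x i (-x i)) (gaussPi v) (gaussPi v) := by
  have h := measurePreserving_pi (fun i => gaussianReal 0 (v i)) (fun i => gaussianReal 0 (v i))
    (f := fun j y => if j = i then -y else y) fun j => by
      by_cases hj : j = i
      · simp only [hj, if_true]
        exact ⟨measurable_neg, by rw [gaussianReal_map_neg, neg_zero]⟩
      · simp only [hj, if_false]
        exact MeasurePreserving.id _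
  have h' : (fun x : ι → ℝ => update x i (-x i)) = fun x j => if j = i then -x j else x j := by
    funext x j
    by_cases hj : j = i
    · subst hj; simp
    · simp [hj]
  rw [h']
  exact h

/-- This sign symmetry takes the place of Wick's formula: it removes all unpaired products, and
crude moment bounds handle the rest. -/
theorem integral_eq_zero_of_odd {f : (ι → ℝ) → ℝ} (hf : Continuous f) (i : ι)
    (hodd : ∀ x, f (update x i (-x i)) = -f x) : ∫ x, f x ∂gaussPi v = 0 := by
  have h1 : ∫ x, f x ∂gaussPi v = ∫ x, f (update x i (-x i)) ∂gaussPi v := by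
    conv_lhs => rw [← (measurePreserving_update_neg (v := v) i).map_eq]
    rw [integral_map (measurePreserving_update_neg (v := v) i).measurable.aemeasurable
      hf.aestronglyMeasurable]
  simp_rw [hodd] at h1
  rw [integral_neg] at h1
  linarith

theorem integral_mul_eval_of_ne {p q : ι} (h : p ≠ q) :
    ∫ x, x p * x q ∂gaussPi v = 0 :=
  integral_eq_zero_of_odd (by fun_prop) p fun x => by
    rw [update_self, update_of_ne h.symm]; ring

theorem lintegral_linear_sq_le {V : ℝ≥0} (hV : ∀ i, v i ≤ V) (a : ι → ℝ) :
    ∫⁻ x, ENNReal.ofReal ((∑ q, x q * a q) ^ 2) ∂gaussPi v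
      ≤ ENNReal.ofReal (V * gaussMoment 1 * ∑ q, a q ^ 2) := by
  have hexp : ∀ x : ι → ℝ, (∑ q, x q * a q) ^ 2 = ∑ p, ∑ q, a p * a q * (x p * x q) := fun x => by
    rw [sq, Finset.sum_mul_sum]
    exact Finset.sum_congr rfl fun p _ => Finset.sum_congr rfl fun q _ => by ring
  have hInteg : ∀ p q, Integrable (fun x : ι → ℝ => a p * a q * (x p * x q)) (gaussPi v) :=
    fun p q => (integrable_mul_eval p q).const_mul _
  have hInteg' : Integrable (fun x : ι → ℝ => (∑ q, x q * a q) ^ 2) (gaussPi v) := by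
    simp_rw [hexp]
    exact integrable_finsetSum _ fun p _ => integrable_finsetSum _ fun q _ => hInteg p q
  rw [← ofReal_integral_eq_lintegral_ofReal hInteg'
    (Filter.Eventually.of_forall fun x => sq_nonneg _)]
  refine ENNReal.ofReal_le_ofReal ?_
  simp_rw [hexp]
  rw [integral_finsetSum _ fun p _ => integrable_finsetSum _ fun q _ => hInteg p q, Finset.mul_sum]
  refine Finset.sum_le_sum fun p _ => ?_
  rw [integral_finsetSum _ fun q _ => hInteg p q, Finset.sum_eq_single p]
  · rw [integral_const_mul]
    have h1 := integral_eval_pow_le (v := v) hV p 1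
    have h2 : ∀ x : ι → ℝ, x p * x p = x p ^ (2 * 1) := fun x => by ring
    rw [← sq, integral_congr_ae (Filter.Eventually.of_forall h2), mul_comm]
    rw [pow_one] at h1
    exact mul_le_mul_of_nonneg_right h1 (sq_nonneg _)
  · intro q _ hq
    rw [integral_const_mul, integral_mul_eval_of_ne hq.symm, mul_zero]
  · simp

theorem integral_mul_mul_eval_eq_zero {p q r s : ι} (hpq : p ≠ q)
    (h : p ≠ r ∧ p ≠ s ∨ q ≠ r ∧ q ≠ s) :
    ∫ x, x p * x q * (x r * x s) ∂gaussPi v = 0 := by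
  rcases h with h | h
  · exact integral_eq_zero_of_odd (by fun_prop) p fun x => by
      rw [update_self, update_of_ne hpq.symm, update_of_ne h.1.symm, update_of_ne h.2.symm]; ring
  · exact integral_eq_zero_of_odd (by fun_prop) q fun x => by
      rw [update_self, update_of_ne hpq, update_of_ne h.1.symm, update_of_ne h.2.symm]; ring

/-- With a zero diagonal the square expands into products over pairs `a`, `b` of distinct indices,
and by parity only `b = a` and `b = a.swap` contribute. Each expectation is at most `4 V²
gaussMoment 2`, whence the constant `8`. -/
theorem lintegral_quadratic_sq_le {V : ℝ≥0} (hV : ∀ i, v i ≤ V) (c : ι → ι → ℝ)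
    (hsymm : ∀ p q, c p q = c q p) (hdiag : ∀ p, c p p = 0) :
    ∫⁻ x, ENNReal.ofReal ((∑ p, ∑ q, x p * x q * c p q) ^ 2) ∂gaussPi v
      ≤ ENNReal.ofReal (8 * (V ^ 2 * gaussMoment 2) * ∑ p, ∑ q, c p q ^ 2) := by
  have hexp : ∀ x : ι → ℝ, (∑ p, ∑ q, x p * x q * c p q) ^ 2
      = ∑ a : ι × ι, ∑ b : ι × ι,
        c a.1 a.2 * c b.1 b.2 * (x a.1 * x a.2 * (x b.1 * x b.2)) := fun x => by
    rw [← Fintype.sum_prod_type' fun p q => x p * x q * c p q, sq, Finset.sum_mul_sum]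
    exact Finset.sum_congr rfl fun p _ => Finset.sum_congr rfl fun q _ => by ring
  have hInteg : ∀ a b : ι × ι, Integrable (fun x : ι → ℝ =>
      c a.1 a.2 * c b.1 b.2 * (x a.1 * x a.2 * (x b.1 * x b.2))) (gaussPi v) :=
    fun a b => (integrable_mul_mul_eval _ _ _ _).const_mul _
  have hInteg' : Integrable (fun x : ι → ℝ => (∑ p, ∑ q, x p * x q * c p q) ^ 2) (gaussPi v) := by
    simp_rw [hexp]
    exact integrable_finsetSum _ fun p _ => integrable_finsetSum _ fun q _ => hInteg p q
  rw [← ofReal_integral_eq_lintegral_ofReal hInteg'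
    (Filter.Eventually.of_forall fun x => sq_nonneg _)]
  refine ENNReal.ofReal_le_ofReal ?_
  simp_rw [hexp]
  rw [integral_finsetSum _ fun p _ => integrable_finsetSum _ fun q _ => hInteg p q, Finset.mul_sum]
  simp_rw [Finset.mul_sum]
  rw [← Fintype.sum_prod_type' fun p q => 8 * (V ^ 2 * gaussMoment 2 : ℝ) * c p q ^ 2]
  refine Finset.sum_le_sum fun a _ => ?_
  rw [integral_finsetSum _ fun q _ => hInteg a q]
  set M : ℝ := V ^ 2 * gaussMoment 2 with hM
  have hM0 : 0 ≤ M := mul_nonneg (by positivity) (gaussMoment_nonneg 2)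
  by_cases ha : a.1 = a.2
  · have : c a.1 a.2 = 0 := by rw [← ha, hdiag]
    simp [this]
  have h4 : ∀ i, ∫ x, x i ^ 4 ∂gaussPi v ≤ M := fun i => integral_eval_pow_le hV i 2
  have hbound : ∀ b : ι × ι, ∫ x, x a.1 * x a.2 * (x b.1 * x b.2) ∂gaussPi v ≤ 4 * M := fun b => by
    calc ∫ x, x a.1 * x a.2 * (x b.1 * x b.2) ∂gaussPi v
        ≤ ∫ x, (x a.1 ^ 4 + x a.2 ^ 4 + (x b.1 ^ 4 + x b.2 ^ 4)) ∂gaussPi v :=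
          integral_mono (integrable_mul_mul_eval _ _ _ _)
            (((integrable_eval_pow_gaussPi _ 4).add (integrable_eval_pow_gaussPi _ 4)).add
            ((integrable_eval_pow_gaussPi _ 4).add (integrable_eval_pow_gaussPi _ 4)))
            fun x => (le_abs_self _).trans (abs_mul_mul_le _ _ _ _)
      _ ≤ 4 * M := by
          have hI : ∀ i j, Integrable (fun x : ι → ℝ => x i ^ 4 + x j ^ 4) (gaussPi v) := fun i j =>
            (integrable_eval_pow_gaussPi i 4).add (integrable_eval_pow_gaussPi j 4)
          rw [integral_add (hI _ _) (hI _ _),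
            integral_add (integrable_eval_pow_gaussPi _ 4) (integrable_eval_pow_gaussPi _ 4),
            integral_add (integrable_eval_pow_gaussPi _ 4) (integrable_eval_pow_gaussPi _ 4)]
          linarith [h4 a.1, h4 a.2, h4 b.1, h4 b.2]
  have hne : a ≠ a.swap := fun h => ha (congrArg Prod.fst h)
  rw [← Finset.sum_subset (Finset.subset_univ {a, a.swap}), Finset.sum_pair hne,
    integral_const_mul, integral_const_mul]
  · have e1 : c a.1 a.2 * c a.swap.1 a.swap.2 = c a.1 a.2 ^ 2 := by
      rw [Prod.fst_swap, Prod.snd_swap, hsymm a.2 a.1, sq]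
    rw [e1, ← sq]
    nlinarith [hbound a, hbound a.swap, sq_nonneg (c a.1 a.2)]
  · intro b _ hb
    rw [Finset.mem_insert, Finset.mem_singleton, not_or] at hb
    by_cases hb' : b.1 = b.2
    · have : c b.1 b.2 = 0 := by rw [← hb', hdiag]
      simp [this]
    rw [integral_const_mul, integral_mul_mul_eval_eq_zero ha, mul_zero]
    by_contra hcon
    simp only [not_or, not_and_or, not_not] at hcon
    obtain ⟨h1, h2⟩ := hcon
    rcases h1 with h1 | h1 <;> rcases h2 with h2 | h2
    · exact ha (h1.trans h2.symm)
    · exact hb.1 (Prod.ext h1.symm h2.symm)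
    · exact hb.2 (Prod.ext h2.symm h1.symm)
    · exact ha (h1.trans h2.symm)

end Gauss

end BQG

end

/-! ### Deterministic bounds on the interaction coefficients and the topography -/

noncomputable section

namespace BQG

section Bounds

open Function SmoothPeriodic

theorem Mode.one_le_normSq (l : Mode) : 1 ≤ l.normSq := by
  have h : (1 : ℝ) ≤ (l.2 : ℝ) := by exact_mod_cast one_le (a := l.2)
  unfold Mode.normSq
  nlinarith [sq_nonneg (l.1 : ℝ)]

/-- The modes embed in `ℤ²` with the sup norm, which is dominated by the Euclidean one; there the
sum is the majorant of an Eisenstein series of exponent `2s > 2`. -/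
theorem Mode.summable_normSq_rpow {s : ℝ} (hs : 1 < s) :
    Summable fun l : Mode => l.normSq ^ (-s) := by
  have hinj : Injective fun l : Mode => (![l.1, (l.2 : ℤ)] : Fin 2 → ℤ) := fun a b h => by
    have h1 : a.1 = b.1 := congrFun h 0
    have h2 : (a.2 : ℤ) = b.2 := congrFun h 1
    exact Prod.ext h1 (PNat.coe_injective (by exact_mod_cast h2))
  have h := (EisensteinSeries.summable_one_div_norm_rpow (k := 2 * s) (by linarith)).comp_injective
    hinj
  refine Summable.of_nonneg_of_le (fun l => Real.rpow_nonneg l.normSq_pos.le _) (fun l => ?_) h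
  have hpos : 0 < ‖(![l.1, (l.2 : ℤ)] : Fin 2 → ℤ)‖ := norm_pos_iff.2 fun h => by
    have h2 : (l.2 : ℤ) = 0 := congrFun h 1
    exact l.2.ne_zero (by exact_mod_cast h2)
  have hle : ‖(![l.1, (l.2 : ℤ)] : Fin 2 → ℤ)‖ ≤ Real.sqrt l.normSq := by
    refine (pi_norm_le_iff_of_nonneg (Real.sqrt_nonneg _)).2 fun i => ?_
    refine Real.le_sqrt_of_sq_le ?_
    fin_cases i
    · simp only [Fin.zero_eta, Matrix.cons_val_zero, Int.norm_eq_abs, sq_abs, Mode.normSq]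
      nlinarith [sq_nonneg (l.2 : ℝ)]
    · simp only [Fin.mk_one, Matrix.cons_val_one, Matrix.cons_val_zero, Int.norm_eq_abs, sq_abs,
        Mode.normSq, Int.cast_natCast]
      nlinarith [sq_nonneg (l.1 : ℝ)]
  have hsq : ‖(![l.1, (l.2 : ℤ)] : Fin 2 → ℤ)‖ ^ 2 ≤ l.normSq := by
    have := pow_le_pow_left₀ hpos.le hle 2
    rwa [Real.sq_sqrt l.normSq_pos.le] at this
  calc l.normSq ^ (-s) ≤ (‖(![l.1, (l.2 : ℤ)] : Fin 2 → ℤ)‖ ^ 2) ^ (-s) :=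
        Real.rpow_le_rpow_of_nonpos (by positivity) hsq (by linarith)
    _ = _ := by
        rw [← Real.rpow_natCast, ← Real.rpow_mul hpos.le]
        simp

theorem Mode.summable_inv_normSq_sq : Summable fun l : Mode => (l.normSq ^ 2)⁻¹ := by
  refine (Mode.summable_normSq_rpow one_lt_two).congr fun l => ?_
  rw [Real.rpow_neg l.normSq_pos.le, Real.rpow_two]

variable {N : ℕ}

theorem sum_modeN_le {f : Mode → ℝ} {C : ℝ} (h : ∀ s : Finset Mode, ∑ l ∈ s, f l ≤ C) :
    ∑ l : ModeN N, f l.1 ≤ C := by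
  have := h (Finset.univ.map (Embedding.subtype fun l : Mode => l.1 ^ 2 + (l.2 : ℤ) ^ 2 ≤ N))
  rwa [Finset.sum_map] at this

namespace SmoothPeriodic

theorem mean_mono {f g : SmoothPeriodic} (h : ∀ x y, f.1 x y ≤ g.1 x y) : mean f ≤ mean g := by
  rw [mean_eq_integral, mean_eq_integral]
  exact integral_mono f.integrable g.integrable fun p => h p.1 p.2

theorem abs_fst_le (l : Mode) : |(l.1 : ℝ)| ≤ Real.sqrt l.normSq := by
  refine Real.abs_le_sqrt ?_
  unfold Mode.normSq
  nlinarith [sq_nonneg (l.2 : ℝ)]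

theorem snd_le (l : Mode) : (l.2 : ℝ) ≤ Real.sqrt l.normSq := by
  refine Real.le_sqrt_of_sq_le ?_
  unfold Mode.normSq
  nlinarith [sq_nonneg (l.1 : ℝ)]

theorem abs_smul_apply_le {f : SmoothPeriodic} {c a b : ℝ} (hc : |c| ≤ a)
    (hf : ∀ x y, |f.1 x y| ≤ b) (x y : ℝ) : |(c • f).1 x y| ≤ a * b := by
  change |c * f.1 x y| ≤ _
  rw [abs_mul]
  exact mul_le_mul hc (hf x y) (abs_nonneg _) ((abs_nonneg _).trans hc)

theorem abs_jacobian_le {f g : SmoothPeriodic} {a b : ℝ} (hfx : ∀ x y, |(Dx f).1 x y| ≤ a)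
    (hfy : ∀ x y, |(Dy f).1 x y| ≤ a) (hgx : ∀ x y, |(Dx g).1 x y| ≤ b)
    (hgy : ∀ x y, |(Dy g).1 x y| ≤ b) (x y : ℝ) : |(jacobian f g).1 x y| ≤ 2 * (a * b) := by
  change |-((Dy f).1 x y * (Dx g).1 x y) + (Dx f).1 x y * (Dy g).1 x y| ≤ _
  have ha : 0 ≤ a := (abs_nonneg _).trans (hfx x y)
  refine (abs_add_le _ _).trans ?_
  rw [abs_neg, abs_mul, abs_mul, two_mul]
  exact add_le_add (mul_le_mul (hfy x y) (hgx x y) (abs_nonneg _) ha)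
    (mul_le_mul (hfx x y) (hgy x y) (abs_nonneg _) ha)

theorem abs_Dx_casBasis_le (l : Mode) (x y : ℝ) :
    |(Dx (casBasis l)).1 x y| ≤ Real.sqrt l.normSq * 3 := by
  rw [Dx_casBasis]
  exact abs_smul_apply_le (by rw [abs_neg]; exact abs_fst_le l) (abs_casBasis_le _) x y

theorem abs_Dy_casBasis_le (l : Mode) (x y : ℝ) :
    |(Dy (casBasis l)).1 x y| ≤ Real.sqrt l.normSq * 3 := by
  rw [Dy_casBasis]
  exact abs_smul_apply_le (by rw [abs_of_nonneg (by positivity)]; exact snd_le l)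
    (abs_casCobasis_le _) x y

theorem abs_Dx_casCobasis_le (l : Mode) (x y : ℝ) :
    |(Dx (casCobasis l)).1 x y| ≤ Real.sqrt l.normSq * 3 := by
  rw [Dx_casCobasis]
  exact abs_smul_apply_le (by rw [abs_neg]; exact abs_fst_le l) (abs_casCobasis_le _) x y

theorem abs_Dy_casCobasis_le (l : Mode) (x y : ℝ) :
    |(Dy (casCobasis l)).1 x y| ≤ Real.sqrt l.normSq * 3 := by
  rw [Dy_casCobasis]
  exact abs_smul_apply_le (by rw [abs_neg, abs_of_nonneg (by positivity)]; exact snd_le l)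
    (abs_casBasis_le _) x y

theorem abs_jacobian_casBasis_le (l p : Mode) (x y : ℝ) :
    |(jacobian (casBasis l) (casBasis p)).1 x y|
      ≤ 18 * (Real.sqrt l.normSq * Real.sqrt p.normSq) :=
  (abs_jacobian_le (abs_Dx_casBasis_le l) (abs_Dy_casBasis_le l) (abs_Dx_casBasis_le p)
    (abs_Dy_casBasis_le p) x y).trans_eq (by ring)

theorem abs_jacobian_casCobasis_le (l p : Mode) (x y : ℝ) :
    |(jacobian (casCobasis l) (casCobasis p)).1 x y|
      ≤ 18 * (Real.sqrt l.normSq * Real.sqrt p.normSq) :=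
  (abs_jacobian_le (abs_Dx_casCobasis_le l) (abs_Dy_casCobasis_le l) (abs_Dx_casCobasis_le p)
    (abs_Dy_casCobasis_le p) x y).trans_eq (by ring)

/-- `½ (Δ J(f,g) - J(Δf,g) - J(f,Δg))`. -/
def jacobianGrad (f g : SmoothPeriodic) : SmoothPeriodic :=
  jacobian (Dx f) (Dx g) + jacobian (Dy f) (Dy g)

theorem abs_jacobianGrad_casBasis_le (l p : Mode) (x y : ℝ) :
    |(jacobianGrad (casBasis l) (casBasis p)).1 x y| ≤ 36 * (l.normSq * p.normSq) := by
  have h0 : ∀ a b : Mode, ∀ c d : ℝ, |c| ≤ Real.sqrt a.normSq → |d| ≤ Real.sqrt b.normSq →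
      |c * d| ≤ Real.sqrt a.normSq * Real.sqrt b.normSq := fun a b c d hc hd => by
    rw [abs_mul]
    exact mul_le_mul hc hd (abs_nonneg _) (Real.sqrt_nonneg _)
  have hl := Real.mul_self_sqrt l.normSq_pos.le
  have hp := Real.mul_self_sqrt p.normSq_pos.le
  have h1 := abs_smul_apply_le (f := jacobian (casBasis l.flip) (casBasis p.flip))
    (h0 l p (-l.1) (-p.1) (by rw [abs_neg]; exact abs_fst_le l)
      (by rw [abs_neg]; exact abs_fst_le p)) (abs_jacobian_casBasis_le _ _) x y
  have h2 := abs_smul_apply_le (f := jacobian (casCobasis l) (casCobasis p))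
    (h0 l p l.2 p.2 (by rw [abs_of_nonneg (by positivity)]; exact snd_le l)
      (by rw [abs_of_nonneg (by positivity)]; exact snd_le p)) (abs_jacobian_casCobasis_le _ _) x y
  rw [Mode.normSq_flip, Mode.normSq_flip] at h1
  rw [jacobianGrad, Dx_casBasis, Dx_casBasis, Dy_casBasis, Dy_casBasis, jacobian_smul_left,
    jacobian_smul_right, jacobian_smul_left, jacobian_smul_right, smul_smul, smul_smul]
  refine (abs_add_le _ _).trans ((add_le_add h1 h2).trans_eq ?_)
  calc _ = 36 * ((Real.sqrt l.normSq * Real.sqrt l.normSq)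
        * (Real.sqrt p.normSq * Real.sqrt p.normSq)) := by ring
    _ = _ := by rw [hl, hp]

/-- The Laplacian of `J(φ_l, φ_p)` is `-(|l|² + |p|²) J` plus the gradient term, and moving the
Laplacian onto `φ_q` gives the factor `-|q|²`. -/
theorem normSq_mul_tri (l p q : Mode) :
    (l.normSq + p.normSq - q.normSq) * tri (casBasis l) (casBasis p) (casBasis q)
      = mean ((2 : ℝ) • jacobianGrad (casBasis l) (casBasis p) * casBasis q) := by
  have h := mean_laplacian_mul (jacobian (casBasis l) (casBasis p)) (casBasis q)
  rw [laplacian_jacobian, laplacian_casBasis, laplacian_casBasis, laplacian_casBasis,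
    jacobian_smul_left, jacobian_smul_right, ← jacobianGrad, two_nsmul, ← two_smul ℝ] at h
  simp only [add_mul, smul_mul_assoc, mul_smul_comm, map_add, map_smul, smul_eq_mul] at h ⊢
  rw [← tri] at h
  linarith

/-- The commutator structure of the nonlinearity: in the difference of `|p|²` and `|q|²` one gains
derivatives, which are put on the fixed mode `l`. -/
theorem sum_normSq_sub_mul_tri_sq_le (l p : Mode) (s : Finset Mode) :
    ∑ q ∈ s, ((p.normSq - q.normSq) * tri (casBasis l) (casBasis p) (casBasis q)) ^ 2
      ≤ 11016 * l.normSq ^ 3 * p.normSq ^ 2 := by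
  set K := (2 : ℝ) • jacobianGrad (casBasis l) (casBasis p) with hK
  set J := jacobian (casBasis l) (casBasis p) with hJ
  have hl := l.one_le_normSq
  have hp := p.one_le_normSq
  have h1 : ∀ q, ((p.normSq - q.normSq) * tri (casBasis l) (casBasis p) (casBasis q)) ^ 2
      ≤ 2 * (mean (K * casBasis q) ^ 2 + l.normSq ^ 2 * mean (J * casBasis q) ^ 2) := fun q => by
    have h2 := normSq_mul_tri l p q
    have h3 : (p.normSq - q.normSq) * tri (casBasis l) (casBasis p) (casBasis q)
        = mean (K * casBasis q) - l.normSq * mean (J * casBasis q) := by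
      rw [hK, ← h2, hJ, ← tri]; ring
    rw [h3]
    nlinarith [sq_nonneg (mean (K * casBasis q) + l.normSq * mean (J * casBasis q))]
  have h2 : mean (K * K) ≤ (2 * (36 * (l.normSq * p.normSq))) ^ 2 :=
    mean_mul_self_le fun x y => abs_smul_apply_le (by norm_num) (abs_jacobianGrad_casBasis_le l p) x y
  have h3 : mean (J * J) ≤ (18 * (Real.sqrt l.normSq * Real.sqrt p.normSq)) ^ 2 :=
    mean_mul_self_le (abs_jacobian_casBasis_le l p)
  rw [mul_pow, mul_pow, Real.sq_sqrt l.normSq_pos.le, Real.sq_sqrt p.normSq_pos.le] at h3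
  have h4 := sum_mean_mul_casBasis_sq_le K s
  have h5 := sum_mean_mul_casBasis_sq_le J s
  -- Bessel applied to `K` and `J` gives the constant `2 (72² + 18²) = 11016`, after rounding both
  -- terms up to `|l|⁶ |p|⁴`.
  refine (Finset.sum_le_sum fun q _ => h1 q).trans ?_
  rw [← Finset.mul_sum, Finset.sum_add_distrib, ← Finset.mul_sum]
  have h6 : l.normSq ^ 2 * p.normSq ^ 2 ≤ l.normSq ^ 3 * p.normSq ^ 2 := by
    gcongr
    norm_num
  have h7 : l.normSq ^ 3 * p.normSq ≤ l.normSq ^ 3 * p.normSq ^ 2 := by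
    gcongr; nlinarith
  have h8 : l.normSq ^ 2 * ∑ q ∈ s, mean (J * casBasis q) ^ 2
      ≤ l.normSq ^ 2 * (18 ^ 2 * (l.normSq * p.normSq)) := by
    gcongr; exact h5.trans h3
  nlinarith [h4.trans h2]

/-- Cyclic invariance puts `φ_q` in the last slot, so Bessel bounds the sum by the norm of `J(φ_l,
g)`. Pointwise this is at most `18 |l|² |∇g|²`, and the mean of `|∇g|²` is the Dirichlet form of
`g`. -/
theorem sum_tri_sq_le (g : SmoothPeriodic) (l : Mode) (s : Finset Mode) :
    ∑ q ∈ s, tri g (casBasis q) (casBasis l) ^ 2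
      ≤ 18 * l.normSq * -mean (laplacian g * g) := by
  have h1 : ∀ q, tri g (casBasis q) (casBasis l) = mean (jacobian (casBasis l) g * casBasis q) :=
    fun q => by rw [tri_cycl, tri]
  simp_rw [h1]
  refine (sum_mean_mul_casBasis_sq_le _ s).trans ?_
  have h2 : -mean (laplacian g * g) = mean (Dx g * Dx g + Dy g * Dy g) := by
    rw [laplacian, add_mul, map_add, mean_Dx_mul (Dx g) g, mean_Dy_mul (Dy g) g, map_add]
    ring
  rw [h2, ← smul_eq_mul (18 * l.normSq), ← map_smul]
  refine mean_mono fun x y => ?_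
  change (-((Dy (casBasis l)).1 x y * (Dx g).1 x y) + (Dx (casBasis l)).1 x y * (Dy g).1 x y) *
    (-((Dy (casBasis l)).1 x y * (Dx g).1 x y) + (Dx (casBasis l)).1 x y * (Dy g).1 x y)
    ≤ 18 * l.normSq * ((Dx g).1 x y * (Dx g).1 x y + (Dy g).1 x y * (Dy g).1 x y)
  have h3 : ∀ z : ℝ, |z| ≤ Real.sqrt l.normSq * 3 → z ^ 2 ≤ 9 * l.normSq := fun z hz => by
    have h4 := pow_le_pow_left₀ (abs_nonneg z) hz 2
    rw [sq_abs, mul_pow, Real.sq_sqrt l.normSq_pos.le] at h4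
    linarith
  have h4 := h3 _ (abs_Dx_casBasis_le l x y)
  have h5 := h3 _ (abs_Dy_casBasis_le l x y)
  set a := (Dx (casBasis l)).1 x y
  set b := (Dy (casBasis l)).1 x y
  set u := (Dx g).1 x y
  set v := (Dy g).1 x y
  nlinarith [sq_nonneg (b * u + a * v), mul_le_mul_of_nonneg_right h4 (sq_nonneg v),
    mul_le_mul_of_nonneg_right h5 (sq_nonneg u)]

end SmoothPeriodic

/-- The coefficients of the nonlinearity in mode `l`, symmetrised in the two input modes. -/
def interaction (l p q : Mode) : ℝ :=
  ((p.normSq)⁻¹ - (q.normSq)⁻¹) * tri (casBasis p) (casBasis q) (casBasis l) / 2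

theorem interaction_symm (l p q : Mode) : interaction l p q = interaction l q p := by
  rw [interaction, interaction, tri_swap_left]; ring

theorem interaction_self (l p : Mode) : interaction l p p = 0 := by
  rw [interaction, sub_self, zero_mul, zero_div]

/-- The squared coefficient is `|p|⁻⁴ |q|⁻⁴ S / 4` with `S` symmetric. Splitting `|p|⁻⁴ |q|⁻⁴ ≤
|p|⁻⁸ + |q|⁻⁸` and using symmetry leaves the weight `|p|⁻⁸`. The sum of `S` over `q` is at most a
constant times `|l|⁶ |p|⁴`, so the convergent series of `|p|⁻⁴` remains. -/
theorem sum_interaction_sq_le (l : Mode) :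
    ∑ p : ModeN N, ∑ q : ModeN N, interaction l p.1 q.1 ^ 2
      ≤ 5508 * (∑' p : Mode, (p.normSq ^ 2)⁻¹) * l.normSq ^ 3 := by
  set S : Mode → Mode → ℝ := fun p q =>
    ((p.normSq - q.normSq) * tri (casBasis l) (casBasis p) (casBasis q)) ^ 2 with hS
  have hSsymm : ∀ p q, S p q = S q p := fun p q => by
    simp only [hS]
    rw [tri_swap_right]; ring
  have h1 : ∀ p q, interaction l p q ^ 2 ≤ (p.normSq ^ 4)⁻¹ * S p q / 4
      + (q.normSq ^ 4)⁻¹ * S p q / 4 := fun p q => by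
    have hp := p.normSq_pos
    have hq := q.normSq_pos
    have h2 : interaction l p q ^ 2 = ((p.normSq ^ 2)⁻¹ * (q.normSq ^ 2)⁻¹) * S p q / 4 := by
      simp only [interaction, hS]
      rw [tri_cycl]
      field_simp
      ring
    have h3 : (p.normSq ^ 2)⁻¹ * (q.normSq ^ 2)⁻¹ ≤ (p.normSq ^ 4)⁻¹ + (q.normSq ^ 4)⁻¹ := by
      have e : ∀ a : ℝ, (a ^ 4)⁻¹ = (a ^ 2)⁻¹ ^ 2 := fun a => by rw [inv_pow, ← pow_mul]
      rw [e, e]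
      nlinarith [sq_nonneg ((p.normSq ^ 2)⁻¹ - (q.normSq ^ 2)⁻¹), sq_nonneg ((p.normSq ^ 2)⁻¹),
        sq_nonneg ((q.normSq ^ 2)⁻¹)]
    rw [h2]
    have h4 := mul_le_mul_of_nonneg_right h3 (sq_nonneg
      ((p.normSq - q.normSq) * tri (casBasis l) (casBasis p) (casBasis q)))
    change _ * S p q ≤ _ * S p q at h4
    linarith
  have h2 : ∑ p : ModeN N, ∑ q : ModeN N, interaction l p.1 q.1 ^ 2
      ≤ ∑ p : ModeN N, ∑ q : ModeN N, (p.1.normSq ^ 4)⁻¹ * S p.1 q.1 / 2 := by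
    refine (Finset.sum_le_sum fun p _ => Finset.sum_le_sum fun q _ => h1 p.1 q.1).trans_eq ?_
    simp only [Finset.sum_add_distrib]
    conv_lhs => arg 2; rw [Finset.sum_comm]
    simp only [← Finset.sum_add_distrib]
    exact Finset.sum_congr rfl fun p _ => Finset.sum_congr rfl fun q _ => by
      rw [hSsymm q.1 p.1]; ring
  refine h2.trans ?_
  have h3 : ∀ p : ModeN N, ∑ q : ModeN N, (p.1.normSq ^ 4)⁻¹ * S p.1 q.1 / 2
      ≤ 5508 * l.normSq ^ 3 * (p.1.normSq ^ 2)⁻¹ := fun p => by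
    have hp := p.1.normSq_pos
    have h4 : ∑ q : ModeN N, S p.1 q.1 ≤ 11016 * l.normSq ^ 3 * p.1.normSq ^ 2 :=
      sum_modeN_le fun s => sum_normSq_sub_mul_tri_sq_le l p.1 s
    rw [← Finset.sum_div, ← Finset.mul_sum]
    calc (p.1.normSq ^ 4)⁻¹ * (∑ q : ModeN N, S p.1 q.1) / 2
        ≤ (p.1.normSq ^ 4)⁻¹ * (11016 * l.normSq ^ 3 * p.1.normSq ^ 2) / 2 := by gcongr
      _ = 5508 * l.normSq ^ 3 * (p.1.normSq ^ 2)⁻¹ := by field_simp; ring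
  refine (Finset.sum_le_sum fun p _ => h3 p).trans ?_
  rw [← Finset.mul_sum]
  have h5 : ∑ p : ModeN N, (p.1.normSq ^ 2)⁻¹ ≤ ∑' p : Mode, (p.normSq ^ 2)⁻¹ :=
    sum_modeN_le fun s => Mode.summable_inv_normSq_sq.sum_le_tsum s fun p _ => by positivity
  have hl := l.normSq_pos
  calc _ ≤ 5508 * l.normSq ^ 3 * ∑' p : Mode, (p.normSq ^ 2)⁻¹ := by gcongr
    _ = _ := by ring

/-- The resolvent gains two derivatives while the Dirichlet form spends one: `|p|² / (μ + |p|²)² ≤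
1`. Only the `L²` norm of the topography enters. -/
theorem sum_tri_resolvent_sq_le {μ : ℝ} (hμ : 0 < μ) (d : ModeN N → ℝ) (l : Mode) :
    ∑ q : ModeN N, tri (synth fun l : ModeN N => (μ + l.1.normSq)⁻¹ * d l)
        (casBasis q.1) (casBasis l) ^ 2
      ≤ 18 * l.normSq * ∑ p, d p ^ 2 := by
  have hl := l.normSq_pos
  refine (sum_modeN_le fun s => sum_tri_sq_le _ l s).trans ?_
  gcongr
  rw [laplacian_synth, mean_synth_mul_synth, ← Finset.sum_neg_distrib]
  refine Finset.sum_le_sum fun p _ => ?_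
  have hp := p.1.one_le_normSq
  have h1 : p.1.normSq ≤ (μ + p.1.normSq) ^ 2 := by nlinarith
  have h2 : 0 < μ + p.1.normSq := by linarith
  calc _ = p.1.normSq / (μ + p.1.normSq) ^ 2 * d p ^ 2 := by field_simp
    _ ≤ 1 * d p ^ 2 := by
      gcongr
      exact (div_le_one (by positivity)).2 h1
    _ = _ := one_mul _

/-- Boundedness on the closed channel suffices; the extension need not be continuous across `y = 0`.
The indicators serve measurability, because nothing is known about `h` outside the channel. -/
theorem memLp_oddExtension {h : ℝ → ℝ → ℝ}
    (hh : ContinuousOn (uncurry h) (Icc (-Real.pi) Real.pi ×ˢ Icc 0 Real.pi)) (p : ENNReal) :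
    MemLp (uncurry (oddExtension h)) p torusMeasure := by
  obtain ⟨C, hC⟩ := ((isCompact_Icc (a := -Real.pi) (b := Real.pi)).prod
    (isCompact_Icc (a := 0) (b := Real.pi))).exists_bound_of_continuousOn hh
  set R : Set (ℝ × ℝ) := Icc (-Real.pi) Real.pi ×ˢ Icc 0 Real.pi with hR
  have hRm : MeasurableSet R := measurableSet_Icc.prod measurableSet_Icc
  have hm : Measurable (R.indicator (uncurry h)) := by
    have := hh.measurable_piecewise (g := 0) continuousOn_const hRm
    rwa [piecewise_eq_indicator] at this
  have hm2 : Measurable fun p : ℝ × ℝ => if 0 ≤ p.2 then R.indicator (uncurry h) p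
      else -R.indicator (uncurry h) (p.1, -p.2) :=
    Measurable.ite (measurableSet_le measurable_const measurable_snd) hm
      (hm.comp (measurable_fst.prodMk measurable_snd.neg)).neg
  have hae : uncurry (oddExtension h) =ᵐ[torusMeasure]
      fun p : ℝ × ℝ => if 0 ≤ p.2 then R.indicator (uncurry h) p
      else -R.indicator (uncurry h) (p.1, -p.2) := by
    filter_upwards [ae_mem_torusMeasure] with p hp
    change (if 0 ≤ p.2 then h p.1 p.2 else -h p.1 (-p.2)) = _
    split_ifs with h0
    · rw [indicator_of_mem]
      · rfl
      · exact ⟨⟨hp.1.1.le, hp.1.2⟩, h0, hp.2.2⟩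
    · rw [indicator_of_mem]
      · rfl
      · exact ⟨⟨hp.1.1.le, hp.1.2⟩, by linarith, by linarith [hp.2.1]⟩
  refine MemLp.of_bound (hm2.aestronglyMeasurable.congr hae.symm) C ?_
  filter_upwards [ae_mem_torusMeasure] with p hp
  change ‖if 0 ≤ p.2 then h p.1 p.2 else -h p.1 (-p.2)‖ ≤ C
  split_ifs with h0
  · exact hC p ⟨⟨hp.1.1.le, hp.1.2⟩, h0, hp.2.2⟩
  · rw [norm_neg]
    exact hC (p.1, -p.2) ⟨⟨hp.1.1.le, hp.1.2⟩, by linarith, by linarith [hp.2.1]⟩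

theorem sum_hartley_topographyN_sq_le {h : ℝ → ℝ → ℝ}
    (hh : ContinuousOn (uncurry h) (Icc (-Real.pi) Real.pi ×ˢ Icc 0 Real.pi)) :
    ∑ l, hartley (topographyN h N) l ^ 2 ≤ ∫ p, uncurry (oddExtension h) p ^ 2 ∂torusMeasure := by
  simp_rw [topographyN, hartley_proj (memLp_one_iff_integrable.1 (memLp_oddExtension hh 1))]
  exact sum_modeN_le (f := fun l => (∫ p, uncurry (oddExtension h) p * uncurry (casBasis l).1 p
    ∂torusMeasure) ^ 2) fun s => sum_integral_mul_casBasis_sq_le (memLp_oddExtension hh 2) s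

end Bounds

end BQG

end

/-! ### Second moments of the field under the Gaussian measure -/

noncomputable section

namespace BQG

section FieldMoments

open Function SmoothPeriodic
open scoped NNReal

/-- The bound `∫ f² ≤ a` for a function that need not be known to be square integrable. -/
def SqBound {Ω : Type*} [MeasurableSpace Ω] (P : Measure Ω) (f : Ω → ℝ) (a : ℝ) : Prop :=
  ∫⁻ x, ENNReal.ofReal (f x ^ 2) ∂P ≤ ENNReal.ofReal a

namespace SqBound

variable {Ω : Type*} [MeasurableSpace Ω] {P : Measure Ω} {f g : Ω → ℝ} {a b : ℝ}

theorem mono (hf : SqBound P f a) (h : a ≤ b) : SqBound P f b :=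
  le_trans hf (ENNReal.ofReal_le_ofReal h)

theorem add (hf : SqBound P f a) (hg : SqBound P g b) (hfm : Measurable f) (ha : 0 ≤ a)
    (hb : 0 ≤ b) : SqBound P (fun x => f x + g x) (2 * (a + b)) := by
  have h1 : ∀ x, ENNReal.ofReal ((f x + g x) ^ 2)
      ≤ 2 * (ENNReal.ofReal (f x ^ 2) + ENNReal.ofReal (g x ^ 2)) := fun x => by
    rw [← ENNReal.ofReal_add (sq_nonneg _) (sq_nonneg _), ← ENNReal.ofReal_ofNat,
      ← ENNReal.ofReal_mul (by norm_num)]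
    exact ENNReal.ofReal_le_ofReal (by nlinarith [sq_nonneg (f x - g x)])
  refine (lintegral_mono h1).trans ?_
  rw [lintegral_const_mul' _ _ (by simp), lintegral_add_left (by fun_prop),
    ENNReal.ofReal_mul (by norm_num), ENNReal.ofReal_add ha hb, ENNReal.ofReal_ofNat]
  gcongr
  · exact hf
  · exact hg

theorem neg (hf : SqBound P f a) : SqBound P (fun x => -f x) a := by
  simpa only [SqBound, neg_sq] using hf

theorem sub (hf : SqBound P f a) (hg : SqBound P g b) (hfm : Measurable f) (ha : 0 ≤ a)
    (hb : 0 ≤ b) : SqBound P (fun x => f x - g x) (2 * (a + b)) := by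
  simpa only [sub_eq_add_neg] using hf.add hg.neg hfm ha hb

theorem const_mul (hf : SqBound P f a) (c : ℝ) : SqBound P (fun x => c * f x) (c ^ 2 * a) := by
  unfold SqBound at hf ⊢
  simp_rw [mul_pow, ENNReal.ofReal_mul (sq_nonneg c)]
  rw [lintegral_const_mul' _ _ ENNReal.ofReal_ne_top]
  gcongr

end SqBound

variable {N : ℕ}

/-- The weight `|l|²` of a coordinate (and `1` for the mean flow). -/
def modeWeight : Option (ModeN N) → ℝ
  | none => 1
  | some l => l.1.normSq

theorem one_le_modeWeight (i : Option (ModeN N)) : 1 ≤ modeWeight i := by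
  cases i with
  | none => exact le_rfl
  | some l => exact l.1.one_le_normSq

variable {v : Option (ModeN N) → ℝ≥0} {V : ℝ≥0}

theorem sqBound_eval (hV : ∀ i, v i ≤ V) (i : Option (ModeN N)) :
    SqBound (gaussPi v) (fun x => x i) (V * gaussMoment 1) := by
  have := lintegral_eval_pow_le hV i 1
  simpa only [SqBound, mul_one, pow_one] using this

theorem sqBound_linear (hV : ∀ i, v i ≤ V) (a : ModeN N → ℝ) :
    SqBound (gaussPi v) (fun x => ∑ q, x (some q) * a q) (V * gaussMoment 1 * ∑ q, a q ^ 2) := by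
  classical
  have := lintegral_linear_sq_le hV fun i => i.elim 0 a
  simpa only [SqBound, Fintype.sum_option, Option.elim, mul_zero, zero_add, ne_eq,
    OfNat.ofNat_ne_zero, not_false_eq_true, zero_pow] using this

theorem sqBound_quadratic (hV : ∀ i, v i ≤ V) {c : ModeN N → ModeN N → ℝ}
    (hsymm : ∀ p q, c p q = c q p) (hdiag : ∀ p, c p p = 0) :
    SqBound (gaussPi v) (fun x => ∑ p, ∑ q, x (some p) * x (some q) * c p q)
      (8 * (V ^ 2 * gaussMoment 2) * ∑ p, ∑ q, c p q ^ 2) := by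
  classical
  have := lintegral_quadratic_sq_le hV (fun i j => i.elim 0 fun p => j.elim 0 fun q => c p q)
    (fun i j => by cases i <;> cases j <;> simp [hsymm])
    (fun i => by cases i <;> simp [hdiag])
  simpa only [SqBound, Fintype.sum_option, Option.elim, mul_zero, zero_add, ne_eq,
    OfNat.ofNat_ne_zero, not_false_eq_true, zero_pow, Finset.sum_const_zero] using this

/-- Since `x_p x_q` is symmetric, only the symmetric part of the coefficient counts; antisymmetry of
`tri` turns it into the difference `|p|⁻² - |q|⁻²`, the source of the cancellation. -/
theorem sum_nonlinearity_eq (x : Option (ModeN N) → ℝ) (l : Mode) :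
    ∑ p : ModeN N, ∑ q : ModeN N, x (some p) * x (some q) *
        ((p.1.normSq)⁻¹ * tri (casBasis p.1) (casBasis q.1) (casBasis l))
      = ∑ p : ModeN N, ∑ q : ModeN N, x (some p) * x (some q) * interaction l p.1 q.1 := by
  set A : ModeN N → ModeN N → ℝ := fun p q => x (some p) * x (some q) *
        ((p.1.normSq)⁻¹ * tri (casBasis p.1) (casBasis q.1) (casBasis l)) with hA
  have h1 : ∀ p q : ModeN N, x (some p) * x (some q) * interaction l p.1 q.1
      = A p q / 2 + A q p / 2 := fun p q => by
    simp only [hA, interaction]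
    rw [tri_swap_left (casBasis q.1)]
    ring
  simp_rw [h1, Finset.sum_add_distrib]
  rw [Finset.sum_comm (f := fun p q => A q p / 2), ← Finset.sum_add_distrib]
  refine Finset.sum_congr rfl fun p _ => ?_
  rw [← Finset.sum_add_distrib]
  exact Finset.sum_congr rfl fun q _ => by ring

/-- The mean-flow component is linear in the vorticity, with coefficients `d` up to a flip and a
factor at most `1` in modulus. -/
theorem sqBound_coordField_none (hV : ∀ i, v i ≤ V) (μ β : ℝ) (d : ModeN N → ℝ) {D : ℝ}
    (hd : ∑ l, d l ^ 2 ≤ D) :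
    SqBound (gaussPi v) (fun x => coordField μ β d x none) (V * gaussMoment 1 * D) := by
  simp_rw [coordField_none]
  refine (sqBound_linear hV _).mono ?_
  have := gaussMoment_nonneg 1
  gcongr
  refine le_trans ?_ hd
  rw [← ModeN.sum_flip fun l => d l ^ 2]
  refine Finset.sum_le_sum fun q _ => ?_
  have hq := q.1.one_le_normSq
  have hj : (q.1.1 : ℝ) ^ 2 ≤ q.1.normSq := by
    unfold Mode.normSq; nlinarith [sq_nonneg (q.1.2 : ℝ)]
  have h1 : mean (synth d * Dx (casBasis q.1)) = -q.1.1 * d q.flip := by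
    rw [Dx_casBasis, mul_smul_comm, map_smul, smul_eq_mul]
    congr 1
    exact mean_synth_mul d q.flip
  rw [h1]
  have h2 : (q.1.1 : ℝ) ^ 2 / q.1.normSq ^ 2 ≤ 1 := by
    rw [div_le_one (by positivity)]; nlinarith
  calc _ = (q.1.1 : ℝ) ^ 2 / q.1.normSq ^ 2 * d q.flip ^ 2 := by
        rw [mul_pow, mul_pow, neg_sq, neg_sq, inv_pow]; ring
    _ ≤ 1 * d q.flip ^ 2 := by gcongr
    _ = _ := one_mul _

/-- A single product needs no cancellation, so the pointwise bound `((U - b) x)² ≤ 4U⁴ + x⁴ + 4b⁴`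
and fourth moments are enough. -/
theorem sqBound_mean_flow_transport (hV : ∀ i, v i ≤ V) (b : ℝ) (i j : Option (ModeN N)) :
    SqBound (gaussPi v) (fun x => (x i - b) * x j)
      (5 * (V ^ 2 * gaussMoment 2) + 4 * b ^ 4) := by
  have h4 : ∀ i, ∫⁻ x, ENNReal.ofReal (x i ^ 4) ∂gaussPi v
      ≤ ENNReal.ofReal (V ^ 2 * gaussMoment 2) := fun i => lintegral_eval_pow_le hV i 2
  have hm := gaussMoment_nonneg 2
  have h1 : ∀ x : Option (ModeN N) → ℝ, ENNReal.ofReal (((x i - b) * x j) ^ 2)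
      ≤ 4 * ENNReal.ofReal (x i ^ 4) + (ENNReal.ofReal (x j ^ 4) + ENNReal.ofReal (4 * b ^ 4)) :=
    fun x => by
    rw [← ENNReal.ofReal_add (by positivity) (by positivity), ← ENNReal.ofReal_ofNat,
      ← ENNReal.ofReal_mul (by norm_num), ← ENNReal.ofReal_add (by positivity) (by positivity)]
    refine ENNReal.ofReal_le_ofReal ?_
    have e1 : ((x i - b) * x j) ^ 2 ≤ ((x i - b) ^ 4 + x j ^ 4) / 2 := by
      nlinarith [sq_nonneg ((x i - b) ^ 2 - x j ^ 2)]
    have e2 : (x i - b) ^ 2 ≤ 2 * (x i ^ 2 + b ^ 2) := by nlinarith [sq_nonneg (x i + b)]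
    have e3 : (x i - b) ^ 4 ≤ 8 * (x i ^ 4 + b ^ 4) := by
      nlinarith [pow_le_pow_left₀ (sq_nonneg _) e2 2, sq_nonneg (x i ^ 2 - b ^ 2)]
    nlinarith [sq_nonneg (x j ^ 2)]
  refine (lintegral_mono h1).trans ?_
  rw [lintegral_add_left (by fun_prop), lintegral_const_mul' _ _ (by simp),
    lintegral_add_left (by fun_prop), lintegral_const, measure_univ, mul_one]
  refine (add_le_add (mul_le_mul_right (h4 i) 4) (add_le_add (h4 j) le_rfl)).trans_eq ?_
  rw [← ENNReal.ofReal_add (by positivity) (by positivity), ← ENNReal.ofReal_ofNat,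
      ← ENNReal.ofReal_mul (by norm_num), ← ENNReal.ofReal_add (by positivity) (by positivity)]
  congr 1
  ring

/-- The constant in the bound on the second moments of the vector field. -/
def fieldConst (μ β V D : ℝ) : ℝ :=
  2 * (2 * (2 * (2 * (2 * (8 * (V ^ 2 * gaussMoment 2) * (5508 * ∑' p : Mode, (p.normSq ^ 2)⁻¹)
    + (5 * (V ^ 2 * gaussMoment 2) + 4 * (β / μ) ^ 4))
    + V * gaussMoment 1 * D) + V * gaussMoment 1 * (18 * D))
    + V * gaussMoment 1 * (μ ^ 2 * (18 * D))) + V * gaussMoment 1 * β ^ 2)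

/-- The power `|l|⁶` is dictated by the nonlinear estimate `t1`; the other five terms grow more
slowly and are rounded up using `|l| ≥ 1`. -/
theorem sqBound_coordField_some (hV : ∀ i, v i ≤ V) {μ : ℝ} (hμ : 0 < μ) (β : ℝ)
    (d : ModeN N → ℝ) {D : ℝ} (hd : ∑ l, d l ^ 2 ≤ D) (l : ModeN N) :
    SqBound (gaussPi v) (fun x => coordField μ β d x (some l))
      (fieldConst μ β V D * l.1.normSq ^ 3) := by
  have hm1 := gaussMoment_nonneg 1
  have hm2 := gaussMoment_nonneg 2
  have hD : 0 ≤ D := le_trans (Finset.sum_nonneg fun l _ => sq_nonneg _) hd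
  have hn := l.1.one_le_normSq
  have hn0 := l.1.normSq_pos
  have hZ : 0 ≤ ∑' p : Mode, (p.normSq ^ 2)⁻¹ := tsum_nonneg fun p => by positivity
  have hn3 : l.1.normSq ≤ l.1.normSq ^ 3 := le_self_pow₀ hn (by norm_num)
  have hj : (l.1.1 : ℝ) ^ 2 ≤ l.1.normSq ^ 3 := le_trans
    (by unfold Mode.normSq; nlinarith [sq_nonneg (l.1.2 : ℝ)]) hn3
  have hfl : l.flip.1.normSq = l.1.normSq := Mode.normSq_flip l.1
  have t1 : SqBound (gaussPi v) (fun x => ∑ p : ModeN N, ∑ q : ModeN N, x (some p) * x (some q) *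
        ((p.1.normSq)⁻¹ * tri (casBasis p.1) (casBasis q.1) (casBasis l.1)))
      (8 * (V ^ 2 * gaussMoment 2) * (5508 * ∑' p : Mode, (p.normSq ^ 2)⁻¹) * l.1.normSq ^ 3) := by
    simp_rw [sum_nonlinearity_eq]
    refine (sqBound_quadratic hV (fun p q => interaction_symm l.1 p.1 q.1)
      fun p => interaction_self l.1 p.1).mono ?_
    rw [mul_assoc (8 * ((V : ℝ) ^ 2 * gaussMoment 2)) _ (l.1.normSq ^ 3)]
    gcongr
    exact sum_interaction_sq_le l.1
  have t2 : SqBound (gaussPi v) (fun x => (x none - β / μ) * (l.1.1 * x (some l.flip)))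
      ((5 * (V ^ 2 * gaussMoment 2) + 4 * (β / μ) ^ 4) * l.1.normSq ^ 3) := by
    have := (sqBound_mean_flow_transport hV (β / μ) none (some l.flip)).const_mul l.1.1
    simp_rw [mul_left_comm _ (l.1.1 : ℝ)]
    refine this.mono ?_
    rw [mul_comm]
    gcongr
  have t3 : SqBound (gaussPi v)
      (fun x => x none * (μ * (l.1.1 * ((μ + l.flip.1.normSq)⁻¹ * d l.flip))))
      (V * gaussMoment 1 * D * l.1.normSq ^ 3) := by
    have := (sqBound_eval hV none).const_mul (μ * (l.1.1 * ((μ + l.flip.1.normSq)⁻¹ * d l.flip)))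
    simp_rw [mul_comm (_ : ℝ) (μ * _)]
    refine this.mono ?_
    have h1 : d l.flip ^ 2 ≤ D :=
      (Finset.single_le_sum (fun l _ => sq_nonneg (d l)) (Finset.mem_univ l.flip)).trans hd
    have h2 : (μ / (μ + l.1.normSq)) ^ 2 ≤ 1 := by
      refine pow_le_one₀ (by positivity) ?_
      rw [div_le_one (by positivity)]; linarith
    calc _ = V * gaussMoment 1 * ((μ / (μ + l.1.normSq)) ^ 2 * d l.flip ^ 2) * l.1.1 ^ 2 := by
          rw [hfl]; ring
      _ ≤ V * gaussMoment 1 * (1 * D) * l.1.normSq ^ 3 := by gcongr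
      _ = _ := by ring
  have hT := sum_tri_resolvent_sq_le hμ d l.1
  have hT' : 18 * l.1.normSq * ∑ p, d p ^ 2 ≤ 18 * D * l.1.normSq ^ 3 := by
    calc _ ≤ 18 * l.1.normSq ^ 3 * D := by gcongr
      _ = _ := by ring
  have t4 : SqBound (gaussPi v) (fun x => ∑ q, x (some q) *
        tri (synth fun l => (μ + l.1.normSq)⁻¹ * d l) (casBasis q.1) (casBasis l.1))
      (V * gaussMoment 1 * (18 * D) * l.1.normSq ^ 3) := by
    refine (sqBound_linear hV _).mono ?_
    rw [mul_assoc _ (18 * D)]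
    gcongr
    exact hT.trans hT'
  have t5 : SqBound (gaussPi v) (fun x => ∑ q, x (some q) * (μ * (q.1.normSq)⁻¹ *
        tri (casBasis q.1) (synth fun l => (μ + l.1.normSq)⁻¹ * d l) (casBasis l.1)))
      (V * gaussMoment 1 * (μ ^ 2 * (18 * D)) * l.1.normSq ^ 3) := by
    refine (sqBound_linear hV _).mono ?_
    rw [mul_assoc _ (μ ^ 2 * _)]
    gcongr
    rw [mul_assoc (μ ^ 2)]
    refine le_trans ?_ (mul_le_mul_of_nonneg_left (hT.trans hT') (sq_nonneg μ))
    rw [Finset.mul_sum]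
    refine Finset.sum_le_sum fun q _ => ?_
    have hq := inv_le_one_of_one_le₀ q.1.one_le_normSq
    have hq0 := q.1.normSq_pos
    rw [tri_swap_left]
    calc _ = μ ^ 2 * ((q.1.normSq)⁻¹ ^ 2 * tri (synth fun l : ModeN N => (μ + l.1.normSq)⁻¹ * d l)
          (casBasis q.1) (casBasis l.1) ^ 2) := by ring
      _ ≤ μ ^ 2 * (1 ^ 2 * tri (synth fun l : ModeN N => (μ + l.1.normSq)⁻¹ * d l)
          (casBasis q.1) (casBasis l.1) ^ 2) := by gcongr
      _ = _ := by ring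
  have t6 : SqBound (gaussPi v)
      (fun x => β * (l.1.1 * ((l.flip.1.normSq)⁻¹ * x (some l.flip))))
      (V * gaussMoment 1 * β ^ 2 * l.1.normSq ^ 3) := by
    have := (((sqBound_eval hV (some l.flip)).const_mul (l.flip.1.normSq)⁻¹).const_mul
      l.1.1).const_mul β
    refine this.mono ?_
    have hq := inv_le_one_of_one_le₀ hn
    rw [hfl]
    calc _ = V * gaussMoment 1 * β ^ 2 * ((l.1.normSq)⁻¹ ^ 2 * l.1.1 ^ 2) := by ring
      _ ≤ V * gaussMoment 1 * β ^ 2 * (1 ^ 2 * l.1.normSq ^ 3) := by gcongr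
      _ = _ := by ring
  simp_rw [coordField_some]
  -- Each addition or subtraction doubles the bound, which accounts for the nested factors in
  -- `fieldConst`.
  refine (((((t1.sub t2 ?_ ?_ ?_).sub t3 ?_ ?_ ?_).sub t4 ?_ ?_ ?_).add t5 ?_ ?_ ?_).add t6
    ?_ ?_ ?_).mono (le_of_eq ?_)
  all_goals first | fun_prop | positivity | skip
  unfold fieldConst
  ring

theorem exists_sqBound_coordField {μ : ℝ} (hμ : 0 < μ) (β : ℝ) (V : ℝ≥0) {D : ℝ} (hD : 0 ≤ D) :
    ∃ C : ℝ, 0 ≤ C ∧ ∀ (N : ℕ) (v : Option (ModeN N) → ℝ≥0) (d : ModeN N → ℝ), (∀ i, v i ≤ V) →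
      ∑ l, d l ^ 2 ≤ D → ∀ i,
      SqBound (gaussPi v) (fun x => coordField μ β d x i) (C * modeWeight i ^ 3) := by
  have hm1 := gaussMoment_nonneg 1
  have hm2 := gaussMoment_nonneg 2
  have hZ : 0 ≤ ∑' p : Mode, (p.normSq ^ 2)⁻¹ := tsum_nonneg fun p => by positivity
  have hF : 0 ≤ fieldConst μ β V D := by unfold fieldConst; positivity
  refine ⟨V * gaussMoment 1 * D + fieldConst μ β V D, by positivity, fun N v d hV hd i => ?_⟩
  cases i with
  | none =>
    refine (sqBound_coordField_none hV μ β d hd).mono ?_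
    rw [modeWeight]; linarith
  | some l =>
    have := l.1.normSq_pos
    refine (sqBound_coordField_some hV hμ β d hd l).mono ?_
    rw [modeWeight]
    gcongr
    have : 0 ≤ V * gaussMoment 1 * D := by positivity
    linarith

end FieldMoments

end BQG

end

/-! ### The Gibbs measure as a product Gaussian -/

noncomputable section

namespace BQG

section Gibbs

open Function
open scoped ENNReal NNReal

variable {N : ℕ}

theorem energyWeight_pos {μ : ℝ} (hμ : 0 < μ) (i : Option (ModeN N)) : 0 < energyWeight μ i := by
  cases i with
  | none => exact hμ
  | some l =>
    have := l.1.normSq_pos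
    simp only [energyWeight]
    positivity

/-- `(Re ξ + Im ξ)² = |ξ|² + 2 Re ξ Im ξ`, and the cross terms cancel in the sum because conjugation
under the flip changes their sign while the weight is flip invariant. -/
theorem pseudoenergy_eq (μ : ℝ) (u : ℝ × HN N) :
    pseudoenergy μ u = quadEnergy (energyWeight μ) (coords N u) / 2 := by
  set A : ModeN N → ℝ := fun l => (1 + μ / l.1.normSq) * (2 * ((u.2.1 l).re * (u.2.1 l).im))
    with hA
  have h0 : ∑ l, A l = 0 := by
    have h1 := ModeN.sum_flip A
    have h2 : ∀ l : ModeN N, A l.flip = -A l := fun l => by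
      simp only [hA]
      rw [u.2.2 l, Complex.conj_re, Complex.conj_im]
      have : l.flip.1.normSq = l.1.normSq := Mode.normSq_flip l.1
      rw [this]
      ring
    simp_rw [h2] at h1
    rw [Finset.sum_neg_distrib] at h1
    linarith
  have h1 : ∑ l : ModeN N, (1 + μ / l.1.normSq) * hartley u.2 l ^ 2
      = ∑ l : ModeN N, (1 + μ / l.1.normSq) * ‖u.2.1 l‖ ^ 2 := by
    rw [← add_zero (∑ l : ModeN N, (1 + μ / l.1.normSq) * ‖u.2.1 l‖ ^ 2), ← h0,
      ← Finset.sum_add_distrib]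
    refine Finset.sum_congr rfl fun l _ => ?_
    rw [hartley, Complex.sq_norm, Complex.normSq_apply]
    simp only [hA]
    ring
  rw [pseudoenergy, quadEnergy, Fintype.sum_option]
  simp only [coords_none, coords_some, energyWeight]
  rw [h1]
  ring

/-- The Gibbs density in the real coordinates, without its normalisation. -/
def gibbsDensity (α μ : ℝ) (x : Option (ModeN N) → ℝ) : ℝ≥0∞ :=
  ENNReal.ofReal (Real.exp (-(α / 2) * quadEnergy (energyWeight μ) x))

theorem measurable_gibbsDensity (α μ : ℝ) :
    Measurable (gibbsDensity α μ : (Option (ModeN N) → ℝ) → ℝ≥0∞) := by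
  unfold gibbsDensity quadEnergy
  fun_prop

/-- The variances of the real coordinates under the Gibbs measure. -/
def gibbsVar (α μ : ℝ) (i : Option (ModeN N)) : ℝ≥0 := (α * energyWeight μ i)⁻¹.toNNReal

theorem gibbsVar_le {α μ : ℝ} (hα : 0 < α) (hμ : 0 < μ) (i : Option (ModeN N)) :
    gibbsVar α μ i ≤ ((α * μ)⁻¹ + α⁻¹).toNNReal := by
  refine Real.toNNReal_le_toNNReal ?_
  cases i with
  | none =>
    have : 0 < α⁻¹ := by positivity
    simp only [energyWeight]
    linarith
  | some l =>
    have hl := l.1.normSq_pos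
    have h1 : 0 < (α * μ)⁻¹ := by positivity
    have h2 : (α * (1 + μ / l.1.normSq))⁻¹ ≤ α⁻¹ := by
      apply inv_anti₀ hα
      have : 0 < μ / l.1.normSq := by positivity
      nlinarith
    simp only [energyWeight]
    linarith

theorem map_withDensity_comp {X Y : Type*} [MeasurableSpace X] [MeasurableSpace Y]
    {P : Measure X} {f : X → Y} (hf : Measurable f) {g : Y → ℝ≥0∞} (hg : Measurable g) :
    (P.withDensity (g ∘ f)).map f = (P.map f).withDensity g := by
  ext s hs
  rw [Measure.map_apply hf hs, withDensity_apply _ (hf hs), withDensity_apply _ hs,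
    setLIntegral_map hs hg hf]
  rfl

theorem gibbs_normalisation {α μ : ℝ} (hα : 0 < α) (hμ : 0 < μ) :
    ∃ C : ℝ≥0∞, C ≠ 0 ∧ C ≠ ∞ ∧
      gaussPi (gibbsVar α μ : Option (ModeN N) → ℝ≥0) = C • volume.withDensity (gibbsDensity α μ) :=
  ⟨_, (ENNReal.ofReal_pos.2 (Finset.prod_pos fun i _ => by
      have := energyWeight_pos hμ i
      have := Real.pi_pos
      positivity)).ne', ENNReal.ofReal_ne_top,
    gaussPi_eq_smul_withDensity (energyWeight_pos hμ) hα⟩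

/-- The coordinates are a linear isomorphism, so they carry Haar measure to a multiple of Lebesgue
measure. Both sides are then probability measures proportional to the same density, and no
normalising constant has to be computed. -/
theorem map_gibbsMeasure {α μ : ℝ} (hα : 0 < α) (hμ : 0 < μ) :
    IsProbabilityMeasure (gibbsMeasure α μ N) ∧
      (gibbsMeasure α μ N).map (coords N) = gaussPi (gibbsVar α μ) := by
  obtain ⟨C, hC0, hCt, hC⟩ := gibbs_normalisation (N := N) hα hμ
  set ρ : Measure (Option (ModeN N) → ℝ) := volume.withDensity (gibbsDensity α μ) with hρ
  have hCρ : C * ρ univ = 1 := by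
    have := measure_univ (μ := gaussPi (gibbsVar α μ : Option (ModeN N) → ℝ≥0))
    rwa [hC, Measure.smul_apply, smul_eq_mul] at this
  have hρt : ρ univ ≠ ∞ := fun h => by
    rw [h, ENNReal.mul_top hC0] at hCρ
    exact ENNReal.top_ne_one hCρ
  have hρ0 : ρ univ ≠ 0 := fun h => by
    rw [h, mul_zero] at hCρ
    exact zero_ne_one hCρ
  have hcm : Measurable (coords N) := (coords N).continuous.measurable
  set ν : Measure (Option (ModeN N) → ℝ) :=
    (Measure.addHaar : Measure (ℝ × HN N)).map (coords N) with hν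
  obtain ⟨c, hc⟩ : ∃ c : ℝ≥0, ν = c • volume :=
    ⟨_, Measure.isAddLeftInvariant_eq_smul ν volume⟩
  have hf : ∀ u : ℝ × HN N, -α * pseudoenergy μ u
      = -(α / 2) * quadEnergy (energyWeight μ) (coords N u) := fun u => by
    rw [pseudoenergy_eq]; ring
  have hνρ : ν.withDensity (gibbsDensity α μ) = c • ρ := by
    rw [hc, hρ]
    exact withDensity_smul_measure (c : ℝ≥0∞) _
  have hmE : Measurable fun u : ℝ × HN N => Real.exp (-α * pseudoenergy μ u) := by
    simp_rw [hf]
    unfold quadEnergy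
    fun_prop
  -- Without integrability `tilted` would be the zero measure; finiteness is read off from the total
  -- mass of the Gaussian.
  have hInteg : Integrable (fun u : ℝ × HN N => Real.exp (-α * pseudoenergy μ u))
      Measure.addHaar := by
    refine ⟨hmE.aestronglyMeasurable, ?_⟩
    rw [hasFiniteIntegral_iff_ofReal (Filter.Eventually.of_forall fun u => (Real.exp_pos _).le)]
    have h1 : ∫⁻ u : ℝ × HN N, ENNReal.ofReal (Real.exp (-α * pseudoenergy μ u)) ∂Measure.addHaar
        = ∫⁻ x, gibbsDensity α μ x ∂ν := by
      rw [hν, lintegral_map (measurable_gibbsDensity α μ) hcm]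
      simp_rw [hf]
      rfl
    have h2 : ∫⁻ x, gibbsDensity α μ x ∂ν = c • ρ univ := by
      rw [← Measure.smul_apply, ← hνρ, withDensity_apply _ MeasurableSet.univ,
        Measure.restrict_univ]
    rw [h1, h2]
    exact ENNReal.mul_lt_top ENNReal.coe_lt_top hρt.lt_top
  have hprob : IsProbabilityMeasure (gibbsMeasure α μ N) := isProbabilityMeasure_tilted hInteg
  refine ⟨hprob, ?_⟩
  set Z : ℝ := ∫ u : ℝ × HN N, Real.exp (-α * pseudoenergy μ u) ∂Measure.addHaar with hZ
  have hmap : (gibbsMeasure α μ N).map (coords N)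
      = (ENNReal.ofReal Z⁻¹ * c) • ρ := by
    have hd : (fun u : ℝ × HN N => ENNReal.ofReal (Real.exp (-α * pseudoenergy μ u) / Z))
        = (ENNReal.ofReal Z⁻¹ • gibbsDensity α μ) ∘ coords N := by
      funext u
      rw [div_eq_inv_mul, hf]
      simp only [comp_apply, Pi.smul_apply, smul_eq_mul, gibbsDensity]
      refine ENNReal.ofReal_mul (inv_nonneg.2 (integral_nonneg fun u => (Real.exp_pos _).le))
    rw [gibbsMeasure, Measure.tilted, ← hZ, hd,
      map_withDensity_comp hcm ((measurable_gibbsDensity α μ).const_smul _), ← hν,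
      withDensity_smul _ (measurable_gibbsDensity α μ), hνρ, mul_smul]
    rfl
  have hmp : IsProbabilityMeasure ((gibbsMeasure α μ N).map (coords N)) :=
    Measure.isProbabilityMeasure_map hcm.aemeasurable
  have h1 : ENNReal.ofReal Z⁻¹ * c * ρ univ = C * ρ univ := by
    have := measure_univ (μ := (gibbsMeasure α μ N).map (coords N))
    rw [hmap, Measure.smul_apply, smul_eq_mul] at this
    rw [this, hCρ]
  rw [hmap, hC, (ENNReal.mul_left_inj hρ0 hρt).1 h1]

theorem gibbsMeasure_eq_map {α μ : ℝ} (hα : 0 < α) (hμ : 0 < μ) :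
    gibbsMeasure α μ N = (gaussPi (gibbsVar α μ)).map (coords N).symm := by
  rw [← (map_gibbsMeasure hα hμ).2, Measure.map_map (coords N).symm.continuous.measurable
    (coords N).continuous.measurable, ContinuousLinearEquiv.symm_comp_self, Measure.map_id]

theorem measurePreserving_gaussPi_flow {α μ : ℝ} (hα : 0 < α) (hμ : 0 < μ)
    [DecidableEq (Option (ModeN N))]
    {F : (Option (ModeN N) → ℝ) → Option (ModeN N) → ℝ}
    (hF : IsConservativeField (energyWeight μ) F) {Φ : (Option (ModeN N) → ℝ) → ℝ →
      Option (ModeN N) → ℝ} (hΦ : ∀ x, IsTrajectory F x (Φ x)) {t : ℝ} (ht : 0 ≤ t) :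
    MeasurePreserving (fun x => Φ x t) (gaussPi (gibbsVar α μ)) (gaussPi (gibbsVar α μ)) := by
  obtain ⟨C, -, hCt, hC⟩ := gibbs_normalisation (N := N) hα hμ
  set g : ℝ → ℝ≥0∞ := fun e => C * ENNReal.ofReal (Real.exp (-(α / 2) * e)) with hg
  have h1 : gaussPi (gibbsVar α μ)
      = (volume : Measure (Option (ModeN N) → ℝ)).withDensity
        fun x => g (quadEnergy (energyWeight μ) x) := by
    rw [hC, ← withDensity_smul _ (measurable_gibbsDensity α μ)]
    rfl
  have hprob : IsProbabilityMeasure ((volume : Measure (Option (ModeN N) → ℝ)).withDensity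
      fun x => g (quadEnergy (energyWeight μ) x)) := by
    rw [← h1]; infer_instance
  rw [h1]
  exact hF.measurePreserving_flow hΦ (by fun_prop) ht

end Gibbs

/-! ### Global solutions and stationarity of the truncated dynamics -/

section Flow

open Function

variable {N : ℕ} {μ β : ℝ} {h : ℝ → ℝ → ℝ}

theorem isGalerkinSolution_iff {u₀ : ℝ × HN N} {v : ℝ → ℝ × HN N} :
    IsGalerkinSolution μ β h N u₀ v ↔ IsTrajectory (coordField μ β (hartley (topographyN h N)))
      (coords N u₀) fun t => coords N (v t) := by
  refine and_congr (coords N).injective.eq_iff.symm (forall_congr' fun t => imp_congr Iff.rfl ?_)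
  rw [← coords_galerkinField]
  constructor
  · exact fun H => (coords N).hasFDerivAt.comp_hasDerivWithinAt t H
  · intro H
    have := (coords N).symm.hasFDerivAt.comp_hasDerivWithinAt t H
    simpa [comp_def] using this

theorem exists_isGalerkinSolution (hμ : 0 < μ) (u₀ : ℝ × HN N) :
    ∃ v, IsGalerkinSolution μ β h N u₀ v := by
  classical
  obtain ⟨v, hv⟩ := (isConservativeField_coordField hμ β
    (hartley (topographyN h N))).exists_trajectory (coords N u₀)
  refine ⟨fun t => (coords N).symm (v t), isGalerkinSolution_iff.2 ?_⟩
  simpa only [ContinuousLinearEquiv.apply_symm_apply] using hv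

theorem isGalerkinSolution_unique (hμ : 0 < μ) {u₀ : ℝ × HN N} {v w : ℝ → ℝ × HN N}
    (hv : IsGalerkinSolution μ β h N u₀ v) (hw : IsGalerkinSolution μ β h N u₀ w) :
    EqOn w v (Ici 0) := by
  classical
  intro t ht
  exact (coords N).injective ((isConservativeField_coordField hμ β
    (hartley (topographyN h N))).trajectory_unique (isGalerkinSolution_iff.1 hw)
      (isGalerkinSolution_iff.1 hv) ht)

/-- Solutions exist for every initial datum, so the constant default in `galerkinFlow` is never
used. -/
theorem isGalerkinSolution_galerkinFlow (hμ : 0 < μ) (u₀ : ℝ × HN N) :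
    IsGalerkinSolution μ β h N u₀ (galerkinFlow μ β h N u₀) := by
  have H := exists_isGalerkinSolution (β := β) (h := h) hμ u₀
  rw [galerkinFlow, dif_pos H]
  exact H.choose_spec

/-- The flow of the truncated equations in the real coordinates. -/
def coordFlow (μ β : ℝ) (h : ℝ → ℝ → ℝ) (N : ℕ) (x : Option (ModeN N) → ℝ) (t : ℝ) :
    Option (ModeN N) → ℝ :=
  coords N (galerkinFlow μ β h N ((coords N).symm x) t)

theorem isTrajectory_coordFlow (hμ : 0 < μ) (x : Option (ModeN N) → ℝ) :
    IsTrajectory (coordField μ β (hartley (topographyN h N))) x (coordFlow μ β h N x) := by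
  have := isGalerkinSolution_iff.1
    (isGalerkinSolution_galerkinFlow (β := β) (h := h) hμ ((coords N).symm x))
  rwa [ContinuousLinearEquiv.apply_symm_apply] at this

theorem galerkinFlow_eq (u₀ : ℝ × HN N) (t : ℝ) :
    galerkinFlow μ β h N u₀ t = (coords N).symm (coordFlow μ β h N (coords N u₀) t) := by
  rw [coordFlow, ContinuousLinearEquiv.symm_apply_apply, ContinuousLinearEquiv.symm_apply_apply]

theorem continuousOn_coordFlow (hμ : 0 < μ) :
    ContinuousOn (uncurry (coordFlow μ β h N)) (univ ×ˢ Ici 0) := by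
  classical
  exact (isConservativeField_coordField hμ β _).continuousOn_flow (isTrajectory_coordFlow hμ)

theorem measurePreserving_coordFlow {α : ℝ} (hα : 0 < α) (hμ : 0 < μ) {t : ℝ} (ht : 0 ≤ t) :
    MeasurePreserving (fun x => coordFlow μ β h N x t) (gaussPi (gibbsVar α μ))
      (gaussPi (gibbsVar α μ)) := by
  classical
  exact measurePreserving_gaussPi_flow hα hμ (isConservativeField_coordField hμ β _)
    (isTrajectory_coordFlow hμ) ht

theorem map_galerkinFlow_gibbsMeasure {α : ℝ} (hα : 0 < α) (hμ : 0 < μ) {t : ℝ} (ht : 0 ≤ t) :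
    (gibbsMeasure α μ N).map (fun u₀ => galerkinFlow μ β h N u₀ t) = gibbsMeasure α μ N := by
  have hm := measurePreserving_coordFlow (N := N) (β := β) (h := h) hα hμ ht
  have hc : Measurable (coords N) := (coords N).continuous.measurable
  have hs : Measurable (coords N).symm := (coords N).symm.continuous.measurable
  have h1 : (fun u₀ => galerkinFlow μ β h N u₀ t)
      = (coords N).symm ∘ (fun x => coordFlow μ β h N x t) ∘ coords N :=
    funext fun u₀ => galerkinFlow_eq u₀ t
  rw [h1, ← Measure.map_map hs (hm.measurable.comp hc), ← Measure.map_map hm.measurable hc,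
    (map_gibbsMeasure hα hμ).2, hm.map_eq, ← gibbsMeasure_eq_map hα hμ]

/-- Joint continuity in datum and time is curried into continuity with values in path space. This
gives the measurability without which the image measure would be meaningless. -/
theorem continuous_galerkinPath (hμ : 0 < μ) (T s : ℝ) :
    Continuous (galerkinPath μ β h T s N) := by
  refine ContinuousMap.continuous_of_continuous_uncurry _ ?_
  have h1 : Continuous fun p : (ℝ × HN N) × Icc (0 : ℝ) T => galerkinFlow μ β h N p.1 p.2 := by
    simp_rw [galerkinFlow_eq]
    refine (coords N).symm.continuous.comp ?_
    exact (continuousOn_coordFlow hμ).comp_continuous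
      (f := fun p : (ℝ × HN N) × Icc (0 : ℝ) T => (coords N p.1, (p.2 : ℝ))) (by fun_prop)
      fun p => ⟨mem_univ _, p.2.2.1⟩
  exact h1.fst.prodMk ((HN.continuous_toSobolev s).comp h1.snd)

end Flow

end BQG

end

/-! ### Compact sets in the Sobolev space and in path space -/

noncomputable section

namespace BQG

section Compactness

open Function Filter
open scoped Topology

namespace Sobolev

variable {s : ℝ}

theorem coeff_sub (u v : Sobolev s) (l : Mode) : (u - v).coeff l = u.coeff l - v.coeff l := rfl

theorem norm_coeff_le (u : Sobolev s) (l : Mode) :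
    ‖u.coeff l‖ ≤ Real.sqrt (l.normSq ^ s)⁻¹ * ‖u‖ := by
  have h0 : 0 < l.normSq ^ s := Real.rpow_pos_of_pos l.normSq_pos s
  have h1 : ‖u.coeff l‖ ^ 2 * l.normSq ^ s ≤ ‖u‖ ^ 2 := by
    rw [norm_sq_eq]
    exact u.2.2.le_tsum l fun p _ => mul_nonneg (sq_nonneg _) (Real.rpow_nonneg p.normSq_pos.le _)
  refine (sq_le_sq₀ (norm_nonneg _) (by positivity)).1 ?_
  rw [mul_pow, Real.sq_sqrt (by positivity), ← div_eq_inv_mul, le_div_iff₀ h0]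
  exact h1

theorem continuous_coeff (l : Mode) : Continuous fun u : Sobolev s => u.coeff l := by
  refine LipschitzWith.continuous (K := (Real.sqrt (l.normSq ^ s)⁻¹).toNNReal)
    (LipschitzWith.of_dist_le_mul fun u v => ?_)
  rw [dist_eq_norm, dist_eq_norm, ← coeff_sub, Real.coe_toNNReal _ (Real.sqrt_nonneg _)]
  exact norm_coeff_le _ l

theorem norm_sq_sub_le_tsum {u v : Sobolev s} {b : Mode → ℝ}
    (hb : Summable fun l => b l * l.normSq ^ s) (h : ∀ l, ‖u.coeff l - v.coeff l‖ ^ 2 ≤ b l) :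
    ‖u - v‖ ^ 2 ≤ ∑' l, b l * l.normSq ^ s := by
  rw [norm_sq_eq]
  refine (u - v).2.2.tsum_le_tsum (fun l => ?_) hb
  exact mul_le_mul_of_nonneg_right (h l) (Real.rpow_nonneg l.normSq_pos.le _)

/-- The elements of `ℋ^s` whose Fourier coefficients are bounded by `M`. -/
def box (s : ℝ) (M : Mode → ℝ) : Set (Sobolev s) := {u | ∀ l, ‖u.coeff l‖ ≤ M l}

/-- The coefficient sequences form a closed subset of a product of discs, compact by Tychonoff. With
the summable majorant `4 M²`, dominated convergence turns coefficientwise convergence into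
convergence in norm. -/
theorem isCompact_box {M : Mode → ℝ} (hM : Summable fun l => M l ^ 2 * l.normSq ^ s) :
    IsCompact (box s M) := by
  set X : Set (Mode → ℂ) := {f | (∀ l, f l.flip = conj (f l)) ∧ ∀ l, ‖f l‖ ≤ M l} with hX
  have hXc : IsCompact X := by
    refine IsCompact.of_isClosed_subset
      (isCompact_univ_pi fun l => isCompact_closedBall (0 : ℂ) (M l)) ?_ fun f hf l _ => by
        simpa using hf.2 l
    refine IsClosed.inter (s₁ := {f : Mode → ℂ | ∀ l, f l.flip = conj (f l)})
      (s₂ := {f : Mode → ℂ | ∀ l, ‖f l‖ ≤ M l}) ?_ ?_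
    · simp only [ofPred_forall]
      exact isClosed_iInter fun l => isClosed_eq (by fun_prop) (by fun_prop)
    · simp only [ofPred_forall]
      exact isClosed_iInter fun l => isClosed_le (by fun_prop) (by fun_prop)
  have hmem : ∀ f : X, f.1 ∈ sobolevSubmodule s := fun f => by
    refine ⟨f.2.1, Summable.of_nonneg_of_le (fun l => ?_) (fun l => ?_) hM⟩
    · exact mul_nonneg (sq_nonneg _) (Real.rpow_nonneg l.normSq_pos.le _)
    · exact mul_le_mul_of_nonneg_right (pow_le_pow_left₀ (norm_nonneg _) (f.2.2 l) 2)
        (Real.rpow_nonneg l.normSq_pos.le _)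
  let G : X → Sobolev s := fun f => ⟨f.1, hmem f⟩
  have hG : Continuous G := by
    refine continuous_iff_continuousAt.2 fun f₀ => tendsto_iff_norm_sub_tendsto_zero.2 ?_
    have h1 : Tendsto (fun f => ‖G f - G f₀‖ ^ 2) (𝓝 f₀) (𝓝 0) := by
      simp_rw [norm_sq_eq]
      have h2 := tendsto_tsum_of_dominated_convergence (𝓕 := 𝓝 f₀)
        (f := fun f l => ‖(G f - G f₀).coeff l‖ ^ 2 * l.normSq ^ s) (g := fun _ => (0 : ℝ))
        (bound := fun l => 4 * (M l ^ 2 * l.normSq ^ s)) (hM.mul_left 4) (fun l => ?_)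
        (Eventually.of_forall fun f l => ?_)
      · simpa using h2
      · have h3 : Continuous fun f : X => ‖(G f - G f₀).coeff l‖ ^ 2 * l.normSq ^ s := by
          have h4 : Continuous fun f : X => f.1 l :=
            (continuous_apply l).comp continuous_subtype_val
          exact ((h4.sub continuous_const).norm.pow 2).mul continuous_const
        have h4 := h3.tendsto f₀
        rwa [coeff_sub, sub_self, norm_zero, sq, zero_mul, zero_mul] at h4
      · have h0 : 0 ≤ l.normSq ^ s := Real.rpow_nonneg l.normSq_pos.le _
        have h3 : ‖(G f - G f₀).coeff l‖ ≤ 2 * M l := by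
          refine (norm_sub_le _ _).trans ?_
          have e1 := f.2.2 l
          have e2 := f₀.2.2 l
          change ‖f.1 l‖ + ‖f₀.1 l‖ ≤ _
          linarith
        rw [Real.norm_of_nonneg (by positivity)]
        calc _ ≤ (2 * M l) ^ 2 * l.normSq ^ s := by gcongr
          _ = _ := by ring
    have h2 := h1.sqrt
    simpa [Real.sqrt_sq] using h2
  have hbox : box s M = G '' univ := by
    ext u
    constructor
    · intro hu
      exact ⟨⟨u.1, u.2.1, hu⟩, mem_univ _, rfl⟩
    · rintro ⟨f, -, rfl⟩
      exact f.2.2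
  rw [hbox]
  have : CompactSpace X := isCompact_iff_compactSpace.1 hXc
  exact isCompact_univ.image hG

/-- A modulus of continuity for paths in `box s M` whose coefficients are `1/2`-Hölder. -/
def boxModulus (s : ℝ) (M A : Mode → ℝ) (r : ℝ) : ℝ :=
  Real.sqrt (∑' l : Mode, min (4 * M l ^ 2) (A l ^ 2 * |r|) * l.normSq ^ s)

theorem summable_boxModulus {M A : Mode → ℝ} (hM : Summable fun l => M l ^ 2 * l.normSq ^ s)
    (r : ℝ) : Summable fun l : Mode => min (4 * M l ^ 2) (A l ^ 2 * |r|) * l.normSq ^ s := by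
  refine Summable.of_nonneg_of_le (fun l => ?_) (fun l => ?_) (hM.mul_left 4)
  · have h0 : 0 ≤ l.normSq ^ s := Real.rpow_nonneg l.normSq_pos.le _
    positivity
  · rw [← mul_assoc]
    exact mul_le_mul_of_nonneg_right (min_le_left _ _) (Real.rpow_nonneg l.normSq_pos.le _)

/-- Each term tends to zero with `r` and is dominated by the summable `4 M²` term. The Hölder
constants `A` may therefore grow arbitrarily fast in the mode. -/
theorem tendsto_boxModulus {M : Mode → ℝ} (A : Mode → ℝ)
    (hM : Summable fun l => M l ^ 2 * l.normSq ^ s) :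
    Tendsto (boxModulus s M A) (𝓝 0) (𝓝 0) := by
  have h2 := tendsto_tsum_of_dominated_convergence (𝓕 := 𝓝 (0 : ℝ))
    (f := fun r l => min (4 * M l ^ 2) (A l ^ 2 * |r|) * l.normSq ^ s) (g := fun _ => (0 : ℝ))
    (bound := fun l => 4 * (M l ^ 2 * l.normSq ^ s)) (hM.mul_left 4) (fun l => ?_)
    (Eventually.of_forall fun r l => ?_)
  · have := h2.sqrt
    rwa [tsum_zero, Real.sqrt_zero] at this
  · have h3 : Continuous fun r : ℝ => min (4 * M l ^ 2) (A l ^ 2 * |r|) * l.normSq ^ s := by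
      fun_prop
    have h4 := h3.tendsto 0
    have h5 : min (4 * M l ^ 2) (A l ^ 2 * |(0 : ℝ)|) * l.normSq ^ s = 0 := by
      rw [abs_zero, mul_zero, min_eq_right (by positivity), zero_mul]
    rwa [h5] at h4
  · have h0 : 0 ≤ l.normSq ^ s := Real.rpow_nonneg l.normSq_pos.le _
    rw [Real.norm_of_nonneg (by positivity), ← mul_assoc]
    exact mul_le_mul_of_nonneg_right (min_le_left _ _) h0

theorem norm_sub_le_boxModulus {M A : Mode → ℝ} (hM : Summable fun l => M l ^ 2 * l.normSq ^ s)
    {u v : Sobolev s} (hu : u ∈ box s M) (hv : v ∈ box s M) {r : ℝ}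
    (h : ∀ l, ‖u.coeff l - v.coeff l‖ ^ 2 ≤ A l ^ 2 * |r|) : ‖u - v‖ ≤ boxModulus s M A r := by
  refine Real.le_sqrt_of_sq_le (norm_sq_sub_le_tsum (summable_boxModulus hM r) fun l =>
    le_min ?_ (h l))
  have h1 : ‖u.coeff l - v.coeff l‖ ≤ 2 * M l := by
    refine (norm_sub_le _ _).trans ?_
    have e1 := hu l
    have e2 := hv l
    linarith
  calc _ ≤ (2 * M l) ^ 2 := by gcongr
    _ = _ := by ring

end Sobolev

/-- Functions on `[0, T]` with bounded and `1/2`-Hölder continuous coordinates. -/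
def hoelderBox (T s M₀ A₀ : ℝ) (M A : Mode → ℝ) : Set (Icc (0 : ℝ) T → ℝ × Sobolev s) :=
  {w | (∀ t, w t ∈ Icc (-M₀) M₀ ×ˢ Sobolev.box s M) ∧
    ∀ t r, ((w t).1 - (w r).1) ^ 2 ≤ A₀ ^ 2 * |(t : ℝ) - r| ∧
      ∀ l, ‖(w t).2.coeff l - (w r).2.coeff l‖ ^ 2 ≤ A l ^ 2 * |(t : ℝ) - r|}

variable {T s M₀ A₀ : ℝ} {M A : Mode → ℝ}

/-- Compactness here is for pointwise convergence: Tychonoff over all times, intersected with closed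
conditions involving two times and one coefficient each. -/
theorem isCompact_hoelderBox (hM : Summable fun l => M l ^ 2 * l.normSq ^ s) :
    IsCompact (hoelderBox T s M₀ A₀ M A) := by
  have h1 : IsCompact (univ.pi fun _ : Icc (0 : ℝ) T => Icc (-M₀) M₀ ×ˢ Sobolev.box s M) :=
    isCompact_univ_pi fun _ => isCompact_Icc.prod (Sobolev.isCompact_box hM)
  have h2 : IsClosed {w : Icc (0 : ℝ) T → ℝ × Sobolev s |
      ∀ t r, ((w t).1 - (w r).1) ^ 2 ≤ A₀ ^ 2 * |(t : ℝ) - r| ∧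
      ∀ l, ‖(w t).2.coeff l - (w r).2.coeff l‖ ^ 2 ≤ A l ^ 2 * |(t : ℝ) - r|} := by
    simp only [ofPred_forall, ofPred_and]
    refine isClosed_iInter fun t => isClosed_iInter fun r => IsClosed.inter ?_
      (isClosed_iInter fun l => ?_)
    · exact isClosed_le (by fun_prop) continuous_const
    · refine isClosed_le ?_ continuous_const
      have hc : ∀ t : Icc (0 : ℝ) T,
          Continuous fun w : Icc (0 : ℝ) T → ℝ × Sobolev s => (w t).2.coeff l :=
        fun t => (Sobolev.continuous_coeff l).comp (continuous_apply t).snd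
      exact (((hc t).sub (hc r)).norm.pow 2)
  refine (h1.inter_right h2).of_isClosed_subset ?_ ?_
  · convert h1.isClosed.inter h2 using 1
    ext w
    simp [hoelderBox]
  · intro w hw
    exact ⟨fun t _ => hw.1 t, hw.2⟩

theorem uniformEquicontinuous_hoelderBox (hM : Summable fun l => M l ^ 2 * l.normSq ^ s) :
    UniformEquicontinuous ((↑) : hoelderBox T s M₀ A₀ M A → Icc (0 : ℝ) T → ℝ × Sobolev s) := by
  refine Metric.uniformEquicontinuous_of_continuity_modulus
    (fun r => max (Real.sqrt (A₀ ^ 2 * |r|)) (Sobolev.boxModulus s M A r)) ?_ _ fun t r w => ?_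
  · have h1 : Tendsto (fun r : ℝ => Real.sqrt (A₀ ^ 2 * |r|)) (𝓝 0) (𝓝 0) := by
      have h2 : Continuous fun r : ℝ => Real.sqrt (A₀ ^ 2 * |r|) := by fun_prop
      simpa using h2.tendsto 0
    simpa using h1.max (Sobolev.tendsto_boxModulus A hM)
  · have h1 := w.2.1 t
    have h2 := w.2.1 r
    have h3 := w.2.2 t r
    rw [Prod.dist_eq]
    refine max_le_max ?_ ?_
    · rw [Real.dist_eq, Subtype.dist_eq, Real.dist_eq]
      refine Real.abs_le_sqrt ?_
      rw [abs_abs]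
      exact h3.1
    · rw [dist_eq_norm, Subtype.dist_eq, Real.dist_eq]
      refine Sobolev.norm_sub_le_boxModulus hM h1.2 h2.2 fun l => ?_
      rw [abs_abs]
      exact h3.2 l

/-- Arzelà–Ascoli. Every function in the Hölder box is automatically continuous, so the continuous
paths in it are the whole pointwise compact set, on which equicontinuity gives uniform convergence.
-/
theorem isCompact_hoelderBox_paths (hM : Summable fun l => M l ^ 2 * l.normSq ^ s) :
    IsCompact {w : PathSpace T s | ⇑w ∈ hoelderBox T s M₀ A₀ M A} := by
  have hU := uniformEquicontinuous_hoelderBox (T := T) (M₀ := M₀) (A₀ := A₀) (A := A) hM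
  refine ArzelaAscoli.isCompact_of_equicontinuous _ ?_ ?_
  · convert isCompact_hoelderBox (T := T) (M₀ := M₀) (A₀ := A₀) (A := A) hM using 1
    ext w
    constructor
    · rintro ⟨f, hf, rfl⟩
      exact hf
    · intro hw
      exact ⟨⟨w, hU.equicontinuous.continuous ⟨w, hw⟩⟩, hw, rfl⟩
  · exact hU.equicontinuous.comp
      fun w : {w : PathSpace T s | ⇑w ∈ hoelderBox T s M₀ A₀ M A} =>
        (⟨w.1, w.2⟩ : hoelderBox T s M₀ A₀ M A)

end Compactness

end BQG

end

/-! ### Probability bounds on whole paths, uniform in `N` -/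

noncomputable section

namespace BQG

section PathBounds

open Function
open scoped ENNReal NNReal

theorem sq_integral_le {f : ℝ → ℝ} {a b : ℝ} (hab : a ≤ b) (hf : ContinuousOn f (Icc a b)) :
    (∫ r in a..b, f r) ^ 2 ≤ (b - a) * ∫ r in a..b, f r ^ 2 := by
  rcases hab.eq_or_lt with rfl | hlt
  · simp
  have hL : 0 < b - a := sub_pos.2 hlt
  set I := ∫ r in a..b, f r with hI
  have hi : IntervalIntegrable f volume a b := hf.intervalIntegrable_of_Icc hab
  have hi2 : IntervalIntegrable (fun r => f r ^ 2) volume a b :=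
    (hf.pow 2).intervalIntegrable_of_Icc hab
  have h1 : 0 ≤ ∫ r in a..b, ((f r ^ 2 - 2 * (I / (b - a)) * f r) + (I / (b - a)) ^ 2) :=
    intervalIntegral.integral_nonneg hab fun r _ => by nlinarith [sq_nonneg (f r - I / (b - a))]
  rw [intervalIntegral.integral_add (hi2.sub (hi.const_mul _)) (by simp),
    intervalIntegral.integral_sub hi2 (hi.const_mul _), intervalIntegral.integral_const_mul, ← hI,
    intervalIntegral.integral_const, smul_eq_mul] at h1
  have h2 : (b - a) * ((∫ r in a..b, f r ^ 2) - 2 * (I / (b - a)) * I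
      + (b - a) * (I / (b - a)) ^ 2) = (b - a) * (∫ r in a..b, f r ^ 2) - I ^ 2 := by
    field_simp
    ring
  nlinarith [mul_nonneg hL.le h1]

/-- Sup and Hölder bounds for a real function in terms of integrals of the function and of its
derivative. -/
theorem sup_and_hoelder_bound {y f : ℝ → ℝ} {T R : ℝ} (k : ℕ) (hT : 0 ≤ T)
    (hy : ∀ t, 0 ≤ t → HasDerivWithinAt y (f t) (Ici 0) t) (hf : ContinuousOn f (Ici 0))
    (hR : y 0 ^ (2 * (k + 1)) +
      ∫ r in (0 : ℝ)..T, (k + 1) * (y r ^ (2 * (2 * k + 1)) + f r ^ 2) ≤ R) :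
    (∀ t ∈ Icc 0 T, y t ^ (2 * (k + 1)) ≤ R) ∧
      ∀ t ∈ Icc 0 T, ∀ r ∈ Icc 0 T, (y t - y r) ^ 2 ≤ R * |t - r| := by
  have hyc : ContinuousOn y (Ici 0) := fun t ht => (hy t ht).continuousWithinAt
  set G : ℝ → ℝ := fun r => (k + 1) * (y r ^ (2 * (2 * k + 1)) + f r ^ 2) with hG
  have hGc : ContinuousOn G (Ici 0) :=
    continuousOn_const.mul ((hyc.pow _).add (hf.pow 2))
  have hG0 : ∀ r, 0 ≤ G r := fun r => by
    simp only [hG, pow_mul]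
    positivity
  have hsub : ∀ {a b : ℝ}, 0 ≤ a → Icc a b ⊆ Ici 0 := fun ha r hr => ha.trans hr.1
  have hGi : ∀ {a b : ℝ}, 0 ≤ a → a ≤ b → IntervalIntegrable G volume a b := fun ha hab =>
    (hGc.mono (hsub ha)).intervalIntegrable_of_Icc hab
  have hGm : ∀ {a b : ℝ}, 0 ≤ a → a ≤ b → b ≤ T → ∫ r in a..b, G r ≤ ∫ r in (0 : ℝ)..T, G r :=
    fun ha hab hb => intervalIntegral.integral_mono_interval ha hab hb
      (Filter.Eventually.of_forall hG0) (hGi le_rfl hT)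
  have hpow : ∀ z : ℝ, 0 ≤ z ^ (2 * (k + 1)) := fun z => by rw [pow_mul]; positivity
  constructor
  · intro t ht
    have h1 : ∫ r in (0 : ℝ)..t, ((2 * (k + 1) : ℕ) : ℝ) * y r ^ (2 * (k + 1) - 1) * f r
        = y t ^ (2 * (k + 1)) - y 0 ^ (2 * (k + 1)) := by
      refine intervalIntegral.integral_eq_sub_of_hasDeriv_right_of_le ht.1
        ((hyc.mono (hsub le_rfl)).pow _) (fun r hr => ?_) ?_
      · exact ((hy r hr.1.le).mono (Ioi_subset_Ici hr.1.le)).pow (2 * (k + 1))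
      · exact ((continuousOn_const.mul ((hyc.mono (hsub le_rfl)).pow _)).mul
          (hf.mono (hsub le_rfl))).intervalIntegrable_of_Icc ht.1
    -- The derivative of `y^(2k+2)` is `2(k+1) y^(2k+1) f`, at most `(k+1)(y^(2(2k+1)) + f²)`. Hence
    -- a second moment of `f` suffices, whatever the power `k`.
    have h2 : ∫ r in (0 : ℝ)..t, ((2 * (k + 1) : ℕ) : ℝ) * y r ^ (2 * (k + 1) - 1) * f r
        ≤ ∫ r in (0 : ℝ)..t, G r := by
      refine intervalIntegral.integral_mono_on ht.1 ?_ (hGi le_rfl ht.1) fun r _ => ?_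
      · exact ((continuousOn_const.mul ((hyc.mono (hsub le_rfl)).pow _)).mul
          (hf.mono (hsub le_rfl))).intervalIntegrable_of_Icc ht.1
      · have e : 2 * (k + 1) - 1 = 2 * k + 1 := by omega
        simp only [hG]
        rw [e, mul_comm 2 (2 * k + 1), pow_mul]
        push_cast
        have hk : (0 : ℝ) ≤ k + 1 := by positivity
        nlinarith [mul_nonneg hk (sq_nonneg (y r ^ (2 * k + 1) - f r))]
    have h3 := hGm le_rfl ht.1 ht.2
    linarith
  -- Cauchy–Schwarz bounds the squared increment by `(t - r) ∫ f²`, and `f² ≤ G` because `k + 1 ≥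
  -- 1`.
  · have key : ∀ r t, 0 ≤ r → r ≤ t → t ≤ T → (y t - y r) ^ 2 ≤ R * (t - r) := by
      intro r t hr hrt ht
      have h1 : ∫ s in r..t, f s = y t - y r :=
        intervalIntegral.integral_eq_sub_of_hasDeriv_right_of_le hrt (hyc.mono (hsub hr))
          (fun s hs => (hy s (hr.trans hs.1.le)).mono (Ioi_subset_Ici (hr.trans hs.1.le)))
          ((hf.mono (hsub hr)).intervalIntegrable_of_Icc hrt)
      have h2 := sq_integral_le hrt (hf.mono (hsub hr))
      rw [h1] at h2
      have h3 : ∫ s in r..t, f s ^ 2 ≤ ∫ s in r..t, G s := by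
        refine intervalIntegral.integral_mono_on hrt
          (((hf.mono (hsub hr)).pow 2).intervalIntegrable_of_Icc hrt) (hGi hr hrt) fun s _ => ?_
        simp only [hG, pow_mul]
        have : 0 ≤ (y s ^ 2) ^ (2 * k + 1) := by positivity
        nlinarith [sq_nonneg (f s), mul_nonneg (Nat.cast_nonneg (α := ℝ) k) this,
          mul_nonneg (Nat.cast_nonneg (α := ℝ) k) (sq_nonneg (f s))]
      have h4 := hGm hr hrt ht
      have h5 := hpow (y 0)
      calc _ ≤ (t - r) * ∫ s in r..t, f s ^ 2 := h2
        _ ≤ (t - r) * R := mul_le_mul_of_nonneg_left (by linarith) (sub_nonneg.2 hrt)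
        _ = _ := mul_comm _ _
    intro t ht r hr
    rcases le_total r t with h | h
    · rw [abs_of_nonneg (sub_nonneg.2 h)]
      exact key r t hr.1 h ht.2
    · rw [abs_sub_comm, abs_of_nonneg (sub_nonneg.2 h), ← neg_sub, neg_sq]
      exact key t r ht.1 h hr.2

variable {N : ℕ} {μ β T : ℝ} {h : ℝ → ℝ → ℝ}

/-- The integrand of `pathFunctional`. -/
def growth (k : ℕ) (μ β : ℝ) (h : ℝ → ℝ → ℝ) (i : Option (ModeN N))
    (z : Option (ModeN N) → ℝ) : ℝ :=
  (k + 1) * (z i ^ (2 * (2 * k + 1)) + coordField μ β (hartley (topographyN h N)) z i ^ 2)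

theorem growth_nonneg (k : ℕ) (i : Option (ModeN N)) (z : Option (ModeN N) → ℝ) :
    0 ≤ growth k μ β h i z := by
  simp only [growth, pow_mul]
  positivity

theorem continuous_growth (k : ℕ) (i : Option (ModeN N)) : Continuous (growth k μ β h i) := by
  have := (contDiff_coordField μ β (hartley (topographyN h N))).continuous
  unfold growth
  fun_prop

/-- A functional of the initial datum which controls the `i`-th coordinate of the path. -/
def pathFunctional (k : ℕ) (μ β : ℝ) (h : ℝ → ℝ → ℝ) (T : ℝ) (i : Option (ModeN N))
    (x : Option (ModeN N) → ℝ) : ℝ≥0∞ :=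
  ENNReal.ofReal (x i ^ (2 * (k + 1))) +
    ∫⁻ r in Ioc 0 T, ENNReal.ofReal (growth k μ β h i (coordFlow μ β h N x (max r 0)))

/-- The chosen solutions are uncontrolled at negative times; replacing `r` by `max r 0` gives a
function continuous on the whole space, hence measurable for Tonelli. -/
theorem continuous_growth_coordFlow (hμ : 0 < μ) (k : ℕ) (i : Option (ModeN N)) :
    Continuous fun p : (Option (ModeN N) → ℝ) × ℝ =>
      growth k μ β h i (coordFlow μ β h N p.1 (max p.2 0)) :=
  (continuous_growth k i).comp ((continuousOn_coordFlow hμ).comp_continuous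
    (f := fun p : (Option (ModeN N) → ℝ) × ℝ => (p.1, max p.2 0)) (by fun_prop)
    fun p => ⟨mem_univ _, mem_Ici.2 (le_max_right _ _)⟩)

theorem coordFlow_bounds_of_pathFunctional_le (hμ : 0 < μ) (hT : 0 ≤ T) {k : ℕ}
    {i : Option (ModeN N)} {x : Option (ModeN N) → ℝ} {R : ℝ} (hR0 : 0 ≤ R)
    (hR : pathFunctional k μ β h T i x ≤ ENNReal.ofReal R) :
    (∀ t ∈ Icc 0 T, coordFlow μ β h N x t i ^ (2 * (k + 1)) ≤ R) ∧
      ∀ t ∈ Icc 0 T, ∀ r ∈ Icc 0 T,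
        (coordFlow μ β h N x t i - coordFlow μ β h N x r i) ^ 2 ≤ R * |t - r| := by
  have htr := isTrajectory_coordFlow (β := β) (h := h) hμ x
  have hF := (contDiff_coordField μ β (hartley (topographyN h N))).continuous
  have hxc : Continuous fun r : ℝ => coordFlow μ β h N x (max r 0) :=
    htr.continuousOn.comp_continuous (f := fun r => max r 0) (by fun_prop)
      fun r => mem_Ici.2 (le_max_right r 0)
  have hgc' : Continuous fun r => growth k μ β h i (coordFlow μ β h N x (max r 0)) :=
    (continuous_growth k i).comp hxc
  have hd : ∀ t, 0 ≤ t → HasDerivWithinAt (fun t => coordFlow μ β h N x t i)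
      (coordField μ β (hartley (topographyN h N)) (coordFlow μ β h N x t) i) (Ici 0) t :=
    fun t ht => hasDerivWithinAt_pi.1 (htr.2 t ht) i
  have hc : ContinuousOn (fun t => coordField μ β (hartley (topographyN h N))
      (coordFlow μ β h N x t) i) (Ici 0) :=
    ((continuous_apply i).comp hF).comp_continuousOn htr.continuousOn
  refine sup_and_hoelder_bound k hT hd hc ?_
  have h1 : ∫ r in (0 : ℝ)..T, (k + 1) * (coordFlow μ β h N x r i ^ (2 * (2 * k + 1)) +
      coordField μ β (hartley (topographyN h N)) (coordFlow μ β h N x r) i ^ 2)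
      = ∫ r in Ioc 0 T, growth k μ β h i (coordFlow μ β h N x (max r 0)) := by
    rw [intervalIntegral.integral_of_le hT]
    refine setIntegral_congr_fun measurableSet_Ioc fun r hr => ?_
    simp only [growth, max_eq_left hr.1.le]
  rw [h1, htr.1]
  rw [pathFunctional, ← ofReal_integral_eq_lintegral_ofReal
    hgc'.integrableOn_Ioc (Filter.Eventually.of_forall fun r => growth_nonneg k i _),
    ← ENNReal.ofReal_add (by rw [pow_mul]; positivity)
      (integral_nonneg fun r => growth_nonneg k i _)] at hR
  exact (ENNReal.ofReal_le_ofReal_iff hR0).1 hR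

/-- By Tonelli and invariance, the time integral along the flow has expectation `T` times a
single-time Gaussian expectation. The constant depends on `k` but neither on `N` nor on the mode. -/
theorem exists_lintegral_pathFunctional_le {α : ℝ} (hα : 0 < α) (hμ : 0 < μ) (hT : 0 ≤ T) (β : ℝ)
    (hh : ContinuousOn (uncurry h) (Icc (-Real.pi) Real.pi ×ˢ Icc 0 Real.pi)) (k : ℕ) :
    ∃ C : ℝ, 0 ≤ C ∧ ∀ (N : ℕ) (i : Option (ModeN N)),
      ∫⁻ x, pathFunctional k μ β h T i x ∂gaussPi (gibbsVar α μ)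
        ≤ ENNReal.ofReal (C * modeWeight i ^ 3) := by
  set V : ℝ≥0 := ((α * μ)⁻¹ + α⁻¹).toNNReal with hVdef
  have hD : 0 ≤ ∫ p, uncurry (oddExtension h) p ^ 2 ∂torusMeasure :=
    integral_nonneg fun p => sq_nonneg _
  obtain ⟨C, hC0, hC⟩ := exists_sqBound_coordField hμ β V hD
  have hm1 := gaussMoment_nonneg (k + 1)
  have hm2 := gaussMoment_nonneg (2 * k + 1)
  refine ⟨V ^ (k + 1) * gaussMoment (k + 1)
    + T * ((k + 1) * (V ^ (2 * k + 1) * gaussMoment (2 * k + 1) + C)), by positivity,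
    fun N i => ?_⟩
  have hV : ∀ i : Option (ModeN N), gibbsVar α μ i ≤ V := gibbsVar_le hα hμ
  have hn := one_le_pow₀ (n := 3) (one_le_modeWeight i)
  have hgc := continuous_growth_coordFlow (N := N) (β := β) (h := h) hμ k i
  have hg : ∫⁻ z, ENNReal.ofReal (growth k μ β h i z) ∂gaussPi (gibbsVar α μ)
      ≤ ENNReal.ofReal ((k + 1) * (V ^ (2 * k + 1) * gaussMoment (2 * k + 1)
        + C * modeWeight i ^ 3)) := by
    have h1 := lintegral_eval_pow_le hV i (2 * k + 1)
    have h2 := hC N (gibbsVar α μ) _ hV (sum_hartley_topographyN_sq_le hh) i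
    have h3 : ∀ z, ENNReal.ofReal (growth k μ β h i z) = ENNReal.ofReal (k + 1) *
        (ENNReal.ofReal (z i ^ (2 * (2 * k + 1)))
          + ENNReal.ofReal (coordField μ β (hartley (topographyN h N)) z i ^ 2)) := fun z => by
      rw [growth, ENNReal.ofReal_mul (by positivity),
        ENNReal.ofReal_add (by rw [pow_mul]; positivity) (sq_nonneg _)]
    have h4 : 0 ≤ V ^ (2 * k + 1) * gaussMoment (2 * k + 1) := by positivity
    have h5 : 0 ≤ C * modeWeight i ^ 3 := by positivity
    simp_rw [h3]
    rw [lintegral_const_mul' _ _ ENNReal.ofReal_ne_top, lintegral_add_left (by fun_prop),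
      ENNReal.ofReal_mul (by positivity), ENNReal.ofReal_add h4 h5]
    exact mul_le_mul_right (add_le_add h1 h2) _
  have hswap : ∫⁻ x, (∫⁻ r in Ioc 0 T, ENNReal.ofReal
      (growth k μ β h i (coordFlow μ β h N x (max r 0)))) ∂gaussPi (gibbsVar α μ)
      = ENNReal.ofReal T * ∫⁻ z, ENNReal.ofReal (growth k μ β h i z) ∂gaussPi (gibbsVar α μ) := by
    rw [lintegral_lintegral_swap (hgc.measurable.ennreal_ofReal.aemeasurable)]
    have h1 : ∀ r : ℝ, ∫⁻ x, ENNReal.ofReal (growth k μ β h i (coordFlow μ β h N x (max r 0)))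
        ∂gaussPi (gibbsVar α μ)
        = ∫⁻ z, ENNReal.ofReal (growth k μ β h i z) ∂gaussPi (gibbsVar α μ) := fun r =>
      (measurePreserving_coordFlow hα hμ (le_max_right r 0)).lintegral_comp
        (continuous_growth k i).measurable.ennreal_ofReal
    simp_rw [h1]
    rw [setLIntegral_const, Real.volume_Ioc, sub_zero, mul_comm]
  unfold pathFunctional
  rw [lintegral_add_left (by fun_prop), hswap]
  refine (add_le_add (lintegral_eval_pow_le hV i (k + 1)) (mul_le_mul_right hg _)).trans ?_
  rw [← ENNReal.ofReal_mul hT, ← ENNReal.ofReal_add (by positivity) (by positivity)]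
  refine ENNReal.ofReal_le_ofReal ?_
  calc _ ≤ V ^ (k + 1) * gaussMoment (k + 1) * modeWeight i ^ 3
        + T * ((k + 1) * (V ^ (2 * k + 1) * gaussMoment (2 * k + 1) * modeWeight i ^ 3
          + C * modeWeight i ^ 3)) := by
        have h4 : 0 ≤ V ^ (2 * k + 1) * gaussMoment (2 * k + 1) := by positivity
        have h5 : 0 ≤ V ^ (k + 1) * gaussMoment (k + 1) := by positivity
        exact add_le_add (le_mul_of_one_le_right h5 hn) (mul_le_mul_of_nonneg_left
          (mul_le_mul_of_nonneg_left (add_le_add (le_mul_of_one_le_right h4 hn) le_rfl)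
            (by positivity)) hT)
    _ = _ := by ring

theorem sum_inv_modeWeight_sq_le :
    ∑ i : Option (ModeN N), (modeWeight i ^ 2)⁻¹ ≤ 1 + ∑' p : Mode, (p.normSq ^ 2)⁻¹ := by
  rw [Fintype.sum_option]
  refine add_le_add (by simp [modeWeight]) ?_
  exact sum_modeN_le fun s => Mode.summable_inv_normSq_sq.sum_le_tsum s fun p _ => by positivity

/-- Markov's inequality at level `R |l|¹⁰` against a mean of at most `C |l|⁶` leaves `|l|⁻⁴`,
summable over modes. One event of small probability thus handles all modes at once. -/
theorem exists_measure_pathFunctional_le {α : ℝ} (hα : 0 < α) (hμ : 0 < μ) (hT : 0 ≤ T) (β : ℝ)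
    (hh : ContinuousOn (uncurry h) (Icc (-Real.pi) Real.pi ×ˢ Icc 0 Real.pi)) (k : ℕ)
    {ε : ℝ} (hε : 0 < ε) :
    ∃ R : ℝ, 0 < R ∧ ∀ N : ℕ, gaussPi (gibbsVar α μ) {x : Option (ModeN N) → ℝ |
      ∃ i, ENNReal.ofReal (R * modeWeight i ^ 5) ≤ pathFunctional k μ β h T i x}
        ≤ ENNReal.ofReal ε := by
  obtain ⟨C, hC0, hC⟩ := exists_lintegral_pathFunctional_le hα hμ hT β hh k
  set Z : ℝ := ∑' p : Mode, (p.normSq ^ 2)⁻¹ with hZ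
  have hZ0 : 0 ≤ Z := tsum_nonneg fun p => by positivity
  -- `R` makes the union bound `C (1 + Z) / R` at most `ε`; the added `1` keeps it positive if `C =
  -- 0`.
  refine ⟨(C * (1 + Z) + 1) / ε, by positivity, fun N => ?_⟩
  set R := (C * (1 + Z) + 1) / ε with hR
  have hR0 : 0 < R := by positivity
  have h1 : ∀ i : Option (ModeN N), gaussPi (gibbsVar α μ) {x : Option (ModeN N) → ℝ |
      ENNReal.ofReal (R * modeWeight i ^ 5) ≤ pathFunctional k μ β h T i x}
      ≤ ENNReal.ofReal (C / R * (modeWeight i ^ 2)⁻¹) := fun i => by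
    have hn := one_le_modeWeight i
    have hm : Measurable (pathFunctional k μ β h T i : (Option (ModeN N) → ℝ) → ℝ≥0∞) := by
      have hgc := continuous_growth_coordFlow (N := N) (β := β) (h := h) hμ k i
      refine ((measurable_pi_apply i).pow_const _).ennreal_ofReal.add ?_
      exact Measurable.lintegral_prod_right' (ν := volume.restrict (Ioc 0 T))
        hgc.measurable.ennreal_ofReal
    refine (meas_ge_le_lintegral_div hm.aemeasurable
      (ENNReal.ofReal_pos.2 (by positivity)).ne' ENNReal.ofReal_ne_top).trans ?_
    refine (ENNReal.div_le_div_right (hC N i) _).trans ?_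
    rw [← ENNReal.ofReal_div_of_pos (by positivity)]
    refine ENNReal.ofReal_le_ofReal (le_of_eq ?_)
    field_simp
  rw [ofPred_exists]
  refine (measure_iUnion_fintype_le _ _).trans ((Finset.sum_le_sum fun i _ => h1 i).trans ?_)
  rw [← ENNReal.ofReal_sum_of_nonneg fun i _ => by
    have := one_le_modeWeight i
    positivity]
  refine ENNReal.ofReal_le_ofReal ?_
  rw [← Finset.mul_sum]
  calc C / R * ∑ i : Option (ModeN N), (modeWeight i ^ 2)⁻¹
      ≤ C / R * (1 + Z) := by gcongr; exact sum_inv_modeWeight_sq_le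
    _ = C * (1 + Z) * (ε / (C * (1 + Z) + 1)) := by rw [hR]; field_simp
    _ ≤ ε := by
      rw [← mul_div_assoc, div_le_iff₀ (by positivity)]
      nlinarith

end PathBounds

end BQG

end

/-! ### Assembling tightness -/

noncomputable section

namespace BQG

section Tightness

open Function

variable {N : ℕ} {μ β T s : ℝ} {h : ℝ → ℝ → ℝ}

theorem norm_coords_symm_sq (z : Option (ModeN N) → ℝ) (l : ModeN N) :
    ‖((coords N).symm z).2.1 l‖ ^ 2 = (z (some l) ^ 2 + z (some l.flip) ^ 2) / 2 := by
  have h1 : ((coords N).symm z).2.1 l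
      = ⟨(z (some l) + z (some l.flip)) / 2, (z (some l) - z (some l.flip)) / 2⟩ := rfl
  rw [h1, Complex.sq_norm, Complex.normSq_mk]
  ring

theorem coeff_toSobolev_coords_symm_sub (z z' : Option (ModeN N) → ℝ) (l : Mode) :
    (HN.toSobolev s ((coords N).symm z).2).coeff l - (HN.toSobolev s ((coords N).symm z').2).coeff l
      = (HN.toSobolev s ((coords N).symm (z - z')).2).coeff l := by
  rw [map_sub]
  change (if H : l.1 ^ 2 + (l.2 : ℤ) ^ 2 ≤ N then ((coords N).symm z).2.1 ⟨l, H⟩ else 0)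
    - (if H : l.1 ^ 2 + (l.2 : ℤ) ^ 2 ≤ N then ((coords N).symm z').2.1 ⟨l, H⟩ else 0)
    = (if H : l.1 ^ 2 + (l.2 : ℤ) ^ 2 ≤ N
      then ((coords N).symm z - (coords N).symm z').2.1 ⟨l, H⟩ else 0)
  split_ifs with H
  · rfl
  · exact sub_zero 0

/-- The squared modulus of a complex coefficient is the average of the squared real coordinates at
the mode and its flip. Both have the same `|l|²`, so bounds depending only on it carry over. -/
theorem norm_coeff_toSobolev_coords_symm_sq_le {z : Option (ModeN N) → ℝ} {l : Mode} {B : ℝ}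
    (hB : 0 ≤ B) (hz : ∀ p : ModeN N, p.1.normSq = l.normSq → z (some p) ^ 2 ≤ B) :
    ‖(HN.toSobolev s ((coords N).symm z).2).coeff l‖ ^ 2 ≤ B := by
  change ‖if H : l.1 ^ 2 + (l.2 : ℤ) ^ 2 ≤ N then _ else 0‖ ^ 2 ≤ B
  split_ifs with H
  · have h1 := norm_coords_symm_sq z ⟨l, H⟩
    have h2 := hz ⟨l, H⟩ rfl
    have h3 := hz (ModeN.flip ⟨l, H⟩) (Mode.normSq_flip l)
    rw [h1]
    linarith
  · simpa using hB

theorem sq_le_rpow_inv_sq {y B : ℝ} {k : ℕ} (h : y ^ (2 * (k + 1)) ≤ B) :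
    y ^ 2 ≤ (B ^ ((2 * (k + 1) : ℕ) : ℝ)⁻¹) ^ 2 := by
  have h1 : |y| ^ (2 * (k + 1)) ≤ B := by
    rwa [pow_mul, sq_abs, ← pow_mul]
  have h2 := Real.rpow_le_rpow (by positivity) h1
    (by positivity : 0 ≤ ((2 * (k + 1) : ℕ) : ℝ)⁻¹)
  rw [Real.pow_rpow_inv_natCast (abs_nonneg y) (by positivity)] at h2
  rw [← sq_abs]
  exact pow_le_pow_left₀ (abs_nonneg y) h2 2

theorem galerkinPath_mem_hoelderBox (hμ : 0 < μ) (hT : 0 ≤ T) {k : ℕ} {R : ℝ} (hR : 0 < R)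
    {x : Option (ModeN N) → ℝ}
    (hx : ∀ i, pathFunctional k μ β h T i x ≤ ENNReal.ofReal (R * modeWeight i ^ 5)) :
    ⇑(galerkinPath μ β h T s N ((coords N).symm x)) ∈
      hoelderBox T s (R ^ ((2 * (k + 1) : ℕ) : ℝ)⁻¹) (Real.sqrt R)
        (fun l => (R * l.normSq ^ 5) ^ ((2 * (k + 1) : ℕ) : ℝ)⁻¹)
        fun l => Real.sqrt (R * l.normSq ^ 5) := by
  have hn : ∀ i : Option (ModeN N), 0 ≤ R * modeWeight i ^ 5 := fun i => by
    have := one_le_modeWeight i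
    positivity
  have hb := fun i => coordFlow_bounds_of_pathFunctional_le hμ hT (hn i) (hx i)
  have hpath : ∀ t : Icc (0 : ℝ) T, galerkinPath μ β h T s N ((coords N).symm x) t
      = (coordFlow μ β h N x t none,
        HN.toSobolev s ((coords N).symm (coordFlow μ β h N x t)).2) := fun t => by
    have h1 : galerkinFlow μ β h N ((coords N).symm x) t
        = (coords N).symm (coordFlow μ β h N x t) := by
      rw [galerkinFlow_eq, ContinuousLinearEquiv.apply_symm_apply]
    change (_, HN.toSobolev s _) = _
    rw [h1]
    rfl
  refine ⟨fun t => ?_, fun t r => ?_⟩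
  · rw [hpath]
    refine ⟨?_, fun l => ?_⟩
    · have h1 := (hb none).1 t t.2
      simp only [modeWeight, one_pow, mul_one] at h1
      exact abs_le.1 (abs_le_of_sq_le_sq (sq_le_rpow_inv_sq h1) (by positivity))
    · have hl := l.normSq_pos
      refine (sq_le_sq₀ (norm_nonneg _) (by positivity)).1 ?_
      refine norm_coeff_toSobolev_coords_symm_sq_le (by positivity) fun p hp => ?_
      have h1 := (hb (some p)).1 t t.2
      rw [modeWeight, hp] at h1
      exact sq_le_rpow_inv_sq h1
  · rw [hpath, hpath]
    refine ⟨?_, fun l => ?_⟩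
    · have h1 := (hb none).2 t t.2 r r.2
      rw [modeWeight, one_pow, mul_one] at h1
      rwa [Real.sq_sqrt hR.le]
    · have hl := l.normSq_pos
      rw [coeff_toSobolev_coords_symm_sub, Real.sq_sqrt (by positivity)]
      refine norm_coeff_toSobolev_coords_symm_sq_le (by positivity) fun p hp => ?_
      have h1 := (hb (some p)).2 t t.2 r r.2
      rwa [modeWeight, hp] at h1

/-- The squared bound on mode `l` grows like `|l|^(10/(k+1))`, and `k + 1 ≥ 10/δ` makes this at most
`|l|^δ`. The weight `|l|^(-2-2δ)` then leaves `|l|^(-2-δ)`, summable in two dimensions. -/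
theorem summable_hoelderBox_bound {δ R : ℝ} (hδ : 0 < δ) (hR : 0 < R) {k : ℕ}
    (hk : 10 / δ ≤ k + 1) :
    Summable fun l : Mode =>
      ((R * l.normSq ^ 5) ^ ((2 * (k + 1) : ℕ) : ℝ)⁻¹) ^ 2 * l.normSq ^ (-1 - δ) := by
  have hk0 : (0 : ℝ) < k + 1 := by positivity
  refine Summable.of_nonneg_of_le (fun l => ?_) (fun l => ?_)
    ((Mode.summable_normSq_rpow (s := 1 + δ / 2) (by linarith)).mul_left (R ^ ((k : ℝ) + 1)⁻¹))
  · have := l.normSq_pos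
    positivity
  · have hl := l.normSq_pos
    have h1 : ((R * l.normSq ^ 5) ^ ((2 * (k + 1) : ℕ) : ℝ)⁻¹) ^ 2
        = R ^ ((k : ℝ) + 1)⁻¹ * l.normSq ^ (5 * ((k : ℝ) + 1)⁻¹) := by
      rw [← Real.rpow_natCast, ← Real.rpow_mul (by positivity),
        Real.mul_rpow hR.le (by positivity), ← Real.rpow_natCast l.normSq 5, ← Real.rpow_mul hl.le]
      have e : ((2 * (k + 1) : ℕ) : ℝ)⁻¹ * ((2 : ℕ) : ℝ) = ((k : ℝ) + 1)⁻¹ := by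
        push_cast
        field_simp
      rw [e]
      norm_num
    rw [h1, mul_assoc, ← Real.rpow_add hl]
    refine mul_le_mul_of_nonneg_left (Real.rpow_le_rpow_of_exponent_le l.one_le_normSq ?_)
      (by positivity)
    have h2 : 5 * ((k : ℝ) + 1)⁻¹ ≤ δ / 2 := by
      rw [div_le_iff₀ hδ] at hk
      rw [← div_eq_mul_inv, div_le_iff₀ hk0]
      linarith
    linarith

theorem galerkinLaw_eq_map {α : ℝ} (hα : 0 < α) (hμ : 0 < μ) :
    galerkinLaw α μ β h T s N = (gaussPi (gibbsVar α μ)).map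
      fun x => galerkinPath μ β h T s N ((coords N).symm x) := by
  rw [galerkinLaw, gibbsMeasure_eq_map hα hμ, Measure.map_map
    (continuous_galerkinPath hμ T s).measurable (coords N).symm.continuous.measurable]
  rfl

theorem isTightMeasureSet_galerkinLaw {α δ : ℝ} (hα : 0 < α) (hμ : 0 < μ) (hT : 0 ≤ T)
    (hδ : 0 < δ) (β : ℝ)
    (hh : ContinuousOn (uncurry h) (Icc (-Real.pi) Real.pi ×ˢ Icc 0 Real.pi)) :
    IsTightMeasureSet (range fun N : ℕ => galerkinLaw α μ β h T (-1 - δ) N) := by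
  rw [isTightMeasureSet_iff_exists_isCompact_measure_compl_le]
  intro ε hε
  obtain ⟨k, hk⟩ := exists_nat_ge (10 / δ)
  -- `ε` may be infinite; `min ε 1` supplies a finite positive tolerance.
  obtain ⟨ε', hε'0, hε'⟩ : ∃ ε' : ℝ, 0 < ε' ∧ ENNReal.ofReal ε' ≤ ε := by
    refine ⟨(min ε 1).toReal, ENNReal.toReal_pos (by positivity) (by simp), ?_⟩
    rw [ENNReal.ofReal_toReal (by simp)]
    exact min_le_left _ _
  obtain ⟨R, hR0, hR⟩ := exists_measure_pathFunctional_le hα hμ hT β hh k hε'0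
  have hK := isCompact_hoelderBox_paths (T := T) (M₀ := R ^ ((2 * (k + 1) : ℕ) : ℝ)⁻¹)
    (A₀ := Real.sqrt R) (A := fun l => Real.sqrt (R * l.normSq ^ 5))
    (summable_hoelderBox_bound hδ hR0 (hk.trans (by linarith)))
  refine ⟨_, hK, ?_⟩
  rintro _ ⟨N, rfl⟩
  beta_reduce
  have hm : Measurable fun x => galerkinPath μ β h T (-1 - δ) N ((coords N).symm x) :=
    ((continuous_galerkinPath hμ T _).comp (coords N).symm.continuous).measurable
  rw [galerkinLaw_eq_map hα hμ, Measure.map_apply hm hK.isClosed.measurableSet.compl]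
  refine (measure_mono fun x hx => ?_).trans ((hR N).trans hε')
  by_contra hcon
  refine hx (galerkinPath_mem_hoelderBox hμ hT hR0 fun i => ?_)
  exact (not_le.1 fun hi => hcon ⟨i, hi⟩).le

end Tightness

end BQG

end

/-! ### The theorem -/

theorem lemma4p3 (α μ β T δ : ℝ) (hα : 0 < α) (hμ : 0 < μ) (hT : 0 < T) (hδ : 0 < δ)
    (h : ℝ → ℝ → ℝ)
    (hh : ContDiffOn ℝ (⊤ : ℕ∞) (Function.uncurry h)
      (Set.Icc (-Real.pi) Real.pi ×ˢ Set.Icc 0 Real.pi)) :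
    -- the processes are well defined and stationary, with marginals `η^N`
    (∀ N : ℕ,
      (∀ᵐ u₀ ∂BQG.gibbsMeasure α μ N,
        ∃ v, BQG.IsGalerkinSolution μ β h N u₀ v ∧
          ∀ w, BQG.IsGalerkinSolution μ β h N u₀ w → Set.EqOn w v (Set.Ici 0)) ∧
      (∀ t : ℝ, 0 ≤ t → (BQG.gibbsMeasure α μ N).map
        (fun u₀ => BQG.galerkinFlow μ β h N u₀ t) = BQG.gibbsMeasure α μ N) ∧
      MeasureTheory.IsProbabilityMeasure (BQG.galerkinLaw α μ β h T (-1 - δ) N)) ∧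
    -- their laws `Θ^N` are tight
    MeasureTheory.IsTightMeasureSet
      (Set.range fun N : ℕ => BQG.galerkinLaw α μ β h T (-1 - δ) N) := by
  refine ⟨fun N => ⟨Filter.Eventually.of_forall fun u₀ => ?_, fun t ht =>
    BQG.map_galerkinFlow_gibbsMeasure hα hμ ht, ?_⟩,
    BQG.isTightMeasureSet_galerkinLaw hα hμ hT.le hδ β hh.continuousOn⟩
  · have hsol := BQG.isGalerkinSolution_galerkinFlow (β := β) (h := h) hμ u₀
    exact ⟨_, hsol, fun w hw => BQG.isGalerkinSolution_unique hμ hsol hw⟩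
  · have := (BQG.map_gibbsMeasure (N := N) hα hμ).1
    exact Measure.isProbabilityMeasure_map
      (BQG.continuous_galerkinPath hμ T _).measurable.aemeasurable
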